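/- **Background.** Let $M>0$, $\mu=2M/r$, and let $\mathcal M=(-\infty,\infty)_{t^*}\times[2M,\infty)_r\times S^2$ carry the Schwarzschild metric $g_M=\tilde g_M+r^2\mathring g$, $\tilde g_M=-(1-\mu)\,dt^{*2}+2\mu\,dt^*dr+(1+\mu)\,dr^2$, with $\mathring g$ the unit round metric. Fix $t_0^*\in\mathbb R$, let $\Sigma=\{t^*=t_0^*\}$ with future unit normal $n=\sqrt{1+\mu}\,\partial_{t^*}-\frac{\mu}{\sqrt{1+\mu}}\partial_r$, and let $D^+(\Sigma)=\{t^*\ge t_0^*\}\subset\mathcal M$ be its future domain of dependence. $\mathcal Q$ denotes the $(t^*,r)$ factor of $\mathcal M$. $\tilde\nabla,\ \tilde\delta=-\widetilde{\mathrm{div}},\ \tilde\Box,\ \tilde d$ are the operators of $\tilde g_M$, acting on components along $S^2$ as on functions of $(t^*,r)$, and $\slashed\nabla,\ \slashed{\mathrm{div}},\ \slashed\Delta,\ \slashed\star$ are those of $r^2\mathring g$, acting on $\mathcal Q$-components as on functions on $S^2$. Indices $a,b,c$ refer to $\mathcal Q$, $A$ to $S^2$; $P=(dr)^\sharp$, and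 a subscript $P$ denotes contraction with $P$. For $\mathcal Q$ 1-forms put $(p\hat\otimes q)_{ab}=p_aq_b+p_bq_a-(\tilde g_M)_{ab}\,p\cdot q$ and $(\tilde\nabla\hat\otimes p)_{ab}=\tilde\nabla_ap_b+\tilde\nabla_bp_a+(\tilde g_M)_{ab}\,\tilde\delta p$, and for symmetric $h$ put $(\tilde\nabla\hat\otimes h)_{P,ab}=P^c\big(\tilde\nabla_ah_{bc}+\tilde\nabla_bh_{ac}+(\tilde g_M)_{ab}(\tilde\delta h)_c\big)$. A subscript $l=0$, respectively $l=0,1$, denotes the $L^2(S^2)$-orthogonal projection, on every sphere of constant $(t^*,r)$, onto the $l=0$, respectively $l=0,1$, spherical harmonics, applied to scalars and to the $(t^*,r)$-components of $\mathcal Q$-tensors; for $\mathcal Q\otimes S$ 1-forms $\omega$ the projection $\omega_{l=0,1}$ is applied to $\omega_a$ for each $a\in\{t^*,r\}$ and is onto the span of $\slashed\nabla Y^1_m,\ \slashed\star\slashed\nabla Y^1_m$. **Solutions.** A smooth solution on $D^+(\Sigma)$ to the equations of linearised gravity is a collection $\mathscr S=(\hat{\tilde g},\ \mathrm{tr}\tilde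 g,\ \omega,\ \hat{\slashed g},\ \mathrm{tr}\slashed g)$ of smooth fields on $D^+(\Sigma)$, where $\hat{\tilde g}$ is a symmetric traceless 2-covariant $\mathcal Q$-tensor, $\mathrm{tr}\tilde g$ and $\mathrm{tr}\slashed g$ are functions, $\omega=(\omega_{aA})$ is a $\mathcal Q\otimes S$ 1-form (the mixed part of the linearised metric) and $\hat{\slashed g}$ is a symmetric traceless 2-covariant $S$-tensor, such that, with $\xi=(\hat{\tilde g}_{l=0})_P$, $$\tilde\Box\hat{\tilde g}+\slashed\Delta\hat{\tilde g}+\tfrac2r\tilde\nabla_P\hat{\tilde g}-\tfrac2r(\tilde\nabla\hat\otimes\hat{\tilde g})_P-\tfrac{4\mu}{r^2}\hat{\tilde g}=\tfrac1r dr\hat\otimes\tilde d\,\mathrm{tr}\tilde g+\tfrac2r dr\hat\otimes\slashed{\mathrm{div}}\,\omega-\tfrac1r dr\hat\otimes\tilde d\,\mathrm{tr}\slashed g-\tilde\nabla\hat\otimes(r^{-1}\xi),$$ $$\tilde\Box\,\mathrm{tr}\tilde g+\slashed\Delta\,\mathrm{tr}\tilde g=\tfrac2r\tilde\delta\xi-\tfrac2{r^2}\xi_P,$$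 $$\tilde\Box\omega_{aA}+\slashed\Delta\omega_{aA}-\tfrac2rP^b\tilde\nabla_a\omega_{bA}-\tfrac1{r^2}\omega_{aA}+\tfrac2{r^2}(dr)_a\,P^b\omega_{bA}=\tfrac2r(dr)_a(\slashed{\mathrm{div}}\,\hat{\slashed g})_A,$$ $$\tilde\Box\hat{\slashed g}+\slashed\Delta\hat{\slashed g}-\tfrac2r\tilde\nabla_P\hat{\slashed g}-\tfrac{4\mu}{r^2}\hat{\slashed g}=0,$$ $$\tilde\Box\,\mathrm{tr}\slashed g+\slashed\Delta\,\mathrm{tr}\slashed g+\tfrac2r\tilde\nabla_P\mathrm{tr}\slashed g+\tfrac2{r^2}\mathrm{tr}\slashed g=\tfrac4{r^2}\hat{\tilde g}_{PP}+\tfrac2{r^2}\mathrm{tr}\tilde g-\tfrac4{r^2}\xi_P,$$ together with the gauge conditions $$-\tilde\delta\hat{\tilde g}+\slashed{\mathrm{div}}\,\omega-\tfrac12\tilde d\,\mathrm{tr}\slashed g=-\tfrac1r\xi,\qquad -\tilde\delta\omega-\tfrac12\slashed\nabla\mathrm{tr}\tilde g+\slashed{\mathrm{div}}\,\hat{\slashed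 g}=0.$$ Its projection is $\mathscr S_{l=0,1}=(\hat{\tilde g}_{l=0,1},\ (\mathrm{tr}\tilde g)_{l=0,1},\ \omega_{l=0,1},\ 0,\ (\mathrm{tr}\slashed g)_{l=0,1})$. **Linearised Kerr.** For $\mathfrak M\in\mathbb R$ and $\mathfrak a$ in the span of the $l=1$ spherical harmonics, $\mathscr K_{\mathfrak M,\mathfrak a}$ is the collection with $$\hat{\tilde g}=\frac{2\mathfrak M}{r}(dt^*+dr)^2,\qquad \omega_{aA}=\big(\mu\,dt^*+(1+\mu)\,dr\big)_a(\slashed\star\slashed\nabla\mathfrak a)_A,\qquad \mathrm{tr}\tilde g=\mathrm{tr}\slashed g=0,\quad \hat{\slashed g}=0.$$ **Proposition.** Let $\mathscr S$ be a smooth solution on $D^+(\Sigma)$ to the equations of linearised gravity that is in the $\mathscr K_{\mathfrak M,\mathfrak a}$-adapted Regge–Wheeler gauge, i.e. on $\Sigma$ $$\slashed{\mathrm{div}}\,\omega=\mathcal L_n\slashed{\mathrm{div}}\,\omega=0,\qquad \hat{\slashed g}=\mathcal L_n\hat{\slashed g}=0,$$ and $\mathscr S_{l=0,1}$ has the same Cauchy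 data on $\Sigma$ (values and $\mathcal L_n$-derivatives of all five quantities) as $\mathscr K_{\mathfrak M,\mathfrak a}$. (In particular $\mathscr S$ may be the initial-data-normalised solution, obtained by adding to a given solution the pure gauge solution that achieves these conditions.) Then on all of $D^+(\Sigma)$ $$\slashed{\mathrm{div}}\,\omega=0,\qquad \hat{\slashed g}=0,\qquad \mathscr S_{l=0,1}=\mathscr K_{\mathfrak M,\mathfrak a},\qquad \mathrm{tr}\tilde g=0 .$$ -/

import Mathlib

noncomputable section

namespace LinGrav

/-! ### The sphere and scalar fields

The Schwarzschild exterior is `ℝ × [2M, ∞) × S²` with coordinates `(t*, r, ω)`, where `S²` is the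
unit sphere of Euclidean `ℝ³`.  The region `D⁺(Σ)` is `{t* ≥ t₀*, r ≥ 2M}`. -/

abbrev E3 : Type := EuclideanSpace ℝ (Fin 3)

/-- The unit sphere `S² ⊂ ℝ³`. -/
abbrev S2 : Type := Metric.sphere (0 : E3) 1

/-- Scalar functions of `(t*, r, ω)`; only their values on `D⁺(Σ)` are ever used. -/
abbrev Scal : Type := ℝ → ℝ → S2 → ℝ

/-- The extension of a function on `S²` to `ℝ³ \ {0}` that is constant along rays. -/
def sphereExt (f : S2 → ℝ) (x : E3) : ℝ :=
  if hx : x = 0 then 0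
  else f ⟨‖x‖⁻¹ • x, by
    rw [mem_sphere_zero_iff_norm, norm_smul, norm_inv, norm_norm,
      inv_mul_cancel₀ (norm_ne_zero_iff.mpr hx)]⟩

/-- The region `D⁺(Σ)`, the future of `Σ = {t* = t₀*}` in the exterior (horizon included):
since `Σ` is a Cauchy hypersurface this is the set `t* ≥ t₀*`, `r ≥ 2M`. -/
def DPlus (M t0 : ℝ) (t r : ℝ) : Prop := t0 ≤ t ∧ 2 * M ≤ r

/-- Smoothness on `D⁺(Σ)`, up to and including its boundary. -/
def SmoothScal (M t0 : ℝ) (f : Scal) : Prop :=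
  ContDiffOn ℝ ((⊤ : ℕ∞) : WithTop ℕ∞) (fun p : ℝ × ℝ × E3 => sphereExt (f p.1 p.2.1) p.2.2)
    (Set.Ici t0 ×ˢ Set.Ici (2 * M) ×ˢ {(0 : E3)}ᶜ)

/-! ### The background

`𝒬`-indices run over `Fin 2`, with `0` for `t*` and `1` for `r`. -/

def mu (M r : ℝ) : ℝ := 2 * M / r

/-- The `𝒬`-metric `-(1-μ)dt*² + 2μ dt* dr + (1+μ)dr²`. -/
def gQ (M r : ℝ) : Matrix (Fin 2) (Fin 2) ℝ :=
  !![-(1 - mu M r), mu M r; mu M r, 1 + mu M r]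

/-- The inverse `𝒬`-metric. -/
def gQinv (M r : ℝ) : Matrix (Fin 2) (Fin 2) ℝ :=
  !![-(1 + mu M r), mu M r; mu M r, 1 - mu M r]

theorem gQ_mul_gQinv (M r : ℝ) : gQ M r * gQinv M r = 1 := by
  ext i j
  fin_cases i <;> fin_cases j <;> simp [gQ, gQinv, Matrix.mul_apply, Fin.sum_univ_two] <;> ring

/-- Coordinate derivative `∂_a` of a function of `r` alone. -/
def pd (a : Fin 2) (u : ℝ → ℝ) (r : ℝ) : ℝ := ![0, deriv u r] a

/-- Christoffel symbols `Γ^c_{ab}` of the `𝒬`-metric. -/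
def Gam (M : ℝ) (c a b : Fin 2) (r : ℝ) : ℝ :=
  (1 / 2) * ∑ d, gQinv M r c d *
    (pd a (fun ρ => gQ M ρ b d) r + pd b (fun ρ => gQ M ρ a d) r - pd d (fun ρ => gQ M ρ a b) r)

/-- The components of the 1-form `dr`. -/
def dr : Fin 2 → ℝ := ![0, 1]

/-- The vector field `P = (dr)^♯`. -/
def P (M : ℝ) (a : Fin 2) (r : ℝ) : ℝ := ∑ b, gQinv M r a b * dr b

/-- The future unit normal `n = N ∂_t - (μ/N) ∂_r` of the slices `t* = const`, `N = √(1+μ)`. -/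
def nvec (M : ℝ) (a : Fin 2) (r : ℝ) : ℝ :=
  ![√(1 + mu M r), -(mu M r / √(1 + mu M r))] a

/-! ### `𝒬`-calculus

`nQk` is the covariant derivative of the `𝒬`-metric on covariant `𝒬`-tensors of rank `k`, the
derivative index being the first one.  Components along `S²` are differentiated as functions, with
`ω` fixed. -/

section QCalculus

variable (M t0 : ℝ)

/-- Coordinate derivative `∂_a` on `D⁺(Σ)`, one-sided at the boundary. -/
def dQ (a : Fin 2) (f : Scal) : Scal := fun t r ω =>
  ![derivWithin (fun s => f s r ω) (Set.Ici t0) t,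
    derivWithin (fun ρ => f t ρ ω) (Set.Ici (2 * M)) r] a

def nQ1 (w : Fin 2 → Scal) (c a : Fin 2) : Scal := fun t r ω =>
  dQ M t0 c (w a) t r ω - ∑ d, Gam M d c a r * w d t r ω

def nQ2 (h : Fin 2 → Fin 2 → Scal) (c a b : Fin 2) : Scal := fun t r ω =>
  dQ M t0 c (h a b) t r ω - ∑ d, Gam M d c a r * h d b t r ω - ∑ d, Gam M d c b r * h a d t r ω

def nQ3 (k : Fin 2 → Fin 2 → Fin 2 → Scal) (c a b e : Fin 2) : Scal := fun t r ω =>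
  dQ M t0 c (k a b e) t r ω - ∑ d, Gam M d c a r * k d b e t r ω
    - ∑ d, Gam M d c b r * k a d e t r ω - ∑ d, Gam M d c e r * k a b d t r ω

/-- `δ̃` on 1-forms: minus the divergence. -/
def deltaQ1 (w : Fin 2 → Scal) : Scal := fun t r ω =>
  -∑ a, ∑ b, gQinv M r a b * nQ1 M t0 w a b t r ω

/-- `δ̃` on 2-covariant tensors. -/
def deltaQ2 (h : Fin 2 → Fin 2 → Scal) (c : Fin 2) : Scal := fun t r ω =>
  -∑ a, ∑ b, gQinv M r a b * nQ2 M t0 h a b c t r ω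

/-- The wave operators `□̃` on functions, 1-forms and 2-covariant tensors. -/
def boxQ0 (f : Scal) : Scal := fun t r ω =>
  ∑ c, ∑ d, gQinv M r c d * nQ1 M t0 (fun a => dQ M t0 a f) c d t r ω

def boxQ1 (w : Fin 2 → Scal) (a : Fin 2) : Scal := fun t r ω =>
  ∑ c, ∑ d, gQinv M r c d * nQ2 M t0 (nQ1 M t0 w) c d a t r ω

def boxQ2 (h : Fin 2 → Fin 2 → Scal) (a b : Fin 2) : Scal := fun t r ω =>
  ∑ c, ∑ d, gQinv M r c d * nQ3 M t0 (nQ2 M t0 h) c d a b t r ω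

/-- Contraction of a 2-covariant `𝒬`-tensor with `P`. -/
def conP (h : Fin 2 → Fin 2 → Scal) (b : Fin 2) : Scal := fun t r ω =>
  ∑ a, P M a r * h a b t r ω

/-- Traceless symmetrised product `p ⊗̂ q` of `𝒬` 1-forms. -/
def hatProd (p q : Fin 2 → Scal) (a b : Fin 2) : Scal := fun t r ω =>
  p a t r ω * q b t r ω + p b t r ω * q a t r ω
    - gQ M r a b * ∑ c, ∑ d, gQinv M r c d * p c t r ω * q d t r ω

/-- `∇̃ ⊗̂ w`, the traceless part of the Lie derivative of the `𝒬`-metric along `w^♯`. -/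
def nHat1 (w : Fin 2 → Scal) (a b : Fin 2) : Scal := fun t r ω =>
  nQ1 M t0 w a b t r ω + nQ1 M t0 w b a t r ω + gQ M r a b * deltaQ1 M t0 w t r ω

/-- `(∇̃ ⊗̂ h)_P` for a symmetric 2-covariant `h`, the last slot of `h` being contracted with `P`. -/
def nHat2P (h : Fin 2 → Fin 2 → Scal) (a b : Fin 2) : Scal := fun t r ω =>
  ∑ c, P M c r * (nQ2 M t0 h a b c t r ω + nQ2 M t0 h b a c t r ω
    + gQ M r a b * deltaQ2 M t0 h c t r ω)

/-- Lie derivative along `n` of `𝒬`-tensors of rank 0, 1, 2.  As `n` does not depend on `ω`, these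
also give the Lie derivative of tensors with additional `S²`-indices, component by component. -/
def lieN0 (f : Scal) : Scal := fun t r ω => ∑ b, nvec M b r * dQ M t0 b f t r ω

def lieN1 (w : Fin 2 → Scal) (a : Fin 2) : Scal := fun t r ω =>
  lieN0 M t0 (w a) t r ω + ∑ b, pd a (nvec M b) r * w b t r ω

def lieN2 (h : Fin 2 → Fin 2 → Scal) (a c : Fin 2) : Scal := fun t r ω =>
  lieN0 M t0 (h a c) t r ω + ∑ b, pd a (nvec M b) r * h b c t r ω
    + ∑ b, pd c (nvec M b) r * h a b t r ω

end QCalculus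

/-! ### Calculus on the spheres

A covariant tensor on `S²` is represented by its components in the ambient `ℝ³` (indices in
`Fin 3`), which vanish when contracted with the position vector `ω`.  The Levi-Civita derivative of
the metric `r²g̊` (which does not depend on `r`) is the tangential projection of the ambient
derivative; `nSk` acts on rank `k`, the derivative index being the first one.  Each contraction with
the inverse of `r²g̊` gives a factor `r⁻²`. -/

/-- The `i`-th ambient component of the gradient of a function on `S²`. -/
def dS (i : Fin 3) (f : Scal) : Scal := fun t r ω =>
  fderiv ℝ (sphereExt (f t r)) (ω : E3) (EuclideanSpace.single i 1)

/-- The orthogonal projection onto the tangent plane at `ω`. -/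
def proj (ω : S2) (i j : Fin 3) : ℝ := (if i = j then 1 else 0) - (ω : E3) i * (ω : E3) j

def nS1 (ξ : Fin 3 → Scal) (i j : Fin 3) : Scal := fun t r ω =>
  ∑ k, proj ω j k * dS i (ξ k) t r ω

def nS2 (θ : Fin 3 → Fin 3 → Scal) (i j k : Fin 3) : Scal := fun t r ω =>
  ∑ l, ∑ m, proj ω j l * proj ω k m * dS i (θ l m) t r ω

def nS3 (κ : Fin 3 → Fin 3 → Fin 3 → Scal) (i j k p : Fin 3) : Scal := fun t r ω =>
  ∑ l, ∑ m, ∑ q, proj ω j l * proj ω k m * proj ω p q * dS i (κ l m q) t r ω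

/-- Divergence of `S` 1-forms and of 2-covariant `S`-tensors. -/
def divS1 (ξ : Fin 3 → Scal) : Scal := fun t r ω => (r ^ 2)⁻¹ * ∑ i, nS1 ξ i i t r ω

def divS2 (θ : Fin 3 → Fin 3 → Scal) (j : Fin 3) : Scal := fun t r ω =>
  (r ^ 2)⁻¹ * ∑ i, nS2 θ i i j t r ω

/-- The Laplacians of `r²g̊` on functions, 1-forms and 2-covariant tensors. -/
def lapS0 (f : Scal) : Scal := fun t r ω =>
  (r ^ 2)⁻¹ * ∑ i, nS1 (fun j => dS j f) i i t r ω

def lapS1 (ξ : Fin 3 → Scal) (j : Fin 3) : Scal := fun t r ω =>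
  (r ^ 2)⁻¹ * ∑ i, nS2 (nS1 ξ) i i j t r ω

def lapS2 (θ : Fin 3 → Fin 3 → Scal) (j k : Fin 3) : Scal := fun t r ω =>
  (r ^ 2)⁻¹ * ∑ i, nS3 (nS2 θ) i i j k t r ω

/-- The Hodge star of `S` 1-forms (rotation by a right angle in the tangent plane). -/
def starS (ξ : Fin 3 → Scal) (i : Fin 3) : Scal := fun t r ω =>
  crossProduct (fun j => (ω : E3) j) (fun j => ξ j t r ω) i

/-! ### Projection to the spherical harmonics `l = 0, 1` -/

/-- The surface measure of the unit sphere. -/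
def sigma : MeasureTheory.Measure S2 :=
  (MeasureTheory.volume : MeasureTheory.Measure E3).toSphere

/-- The `l = 0` spherical harmonic. -/
def Y0 : S2 → ℝ := fun _ => 1 / √(4 * Real.pi)

/-- The three (real, normalised) `l = 1` spherical harmonics. -/
def Y1 (k : Fin 3) : S2 → ℝ := fun ω => √(3 / (4 * Real.pi)) * (ω : E3) k

/-- `f_{l=0}`, the spherically symmetric part of `f`. -/
def projL0 (f : Scal) : Scal := fun t r ω => (∫ η, f t r η * Y0 η ∂sigma) * Y0 ω

/-- `f_{l=0,1}`, the `L²(S²)`-orthogonal projection of `f` to the span of `Y0` and the `Y1 k`. -/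
def projL01 (f : Scal) : Scal := fun t r ω =>
  projL0 f t r ω + ∑ k, (∫ η, f t r η * Y1 k η ∂sigma) * Y1 k ω

/-- The even and odd `l = 1` vector harmonics `∇̸Y` and `⋆∇̸Y` on the unit sphere. -/
def gradY1 (k i : Fin 3) : Scal := dS i (fun _ _ => Y1 k)

def starGradY1 (k i : Fin 3) : Scal := starS (gradY1 k) i

/-- The `l = 0, 1` part of an `S` 1-form `ξ = ∇̸ξ_e + ⋆∇̸ξ_o` is `∇̸(ξ_e)_{l=1} + ⋆∇̸(ξ_o)_{l=1}`,
i.e. the `L²(S²)`-orthogonal projection to the span of the `∇̸Y1 k` and `⋆∇̸Y1 k`.  These six fields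
are orthogonal, with squared norm `l(l+1) = 2`. -/
def projL01Form (ξ : Fin 3 → Scal) (i : Fin 3) : Scal := fun t r ω =>
  ∑ k, (1 / 2) *
    ((∫ η, ∑ j, ξ j t r η * gradY1 k j t r η ∂sigma) * gradY1 k i t r ω
      + (∫ η, ∑ j, ξ j t r η * starGradY1 k j t r η ∂sigma) * starGradY1 k i t r ω)

/-! ### Linearised metrics and the equations of linearised gravity -/

/-- A collection `(ĝ̃, tr g̃, g̸̃, ĝ̸, tr g̸)` of linearised metric quantities. -/
structure LinMetric where
  /-- the traceless part of the `𝒬`-metric -/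
  ghat : Fin 2 → Fin 2 → Scal
  /-- the `𝒬`-trace -/
  trQ : Scal
  /-- the mixed `𝒬 ⊗ S` 1-form -/
  cross : Fin 2 → Fin 3 → Scal
  /-- the traceless part of the `S`-metric -/
  shat : Fin 3 → Fin 3 → Scal
  /-- the `S`-trace -/
  trS : Scal

/-- `(ĝ̃_{l=0})_P`. -/
def ghatL0P (M : ℝ) (h : Fin 2 → Fin 2 → Scal) : Fin 2 → Scal :=
  conP M (fun a b => projL0 (h a b))

/-- Smooth solutions on `D⁺(Σ)` of the equations of linearised gravity around Schwarzschild. -/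
structure IsSolution (M t0 : ℝ) (S : LinMetric) : Prop where
  smooth_ghat : ∀ a b, SmoothScal M t0 (S.ghat a b)
  smooth_trQ : SmoothScal M t0 S.trQ
  smooth_cross : ∀ a i, SmoothScal M t0 (S.cross a i)
  smooth_shat : ∀ i j, SmoothScal M t0 (S.shat i j)
  smooth_trS : SmoothScal M t0 S.trS
  /-- `ĝ̃` is symmetric and traceless -/
  ghat_symm : ∀ t r (ω : S2), DPlus M t0 t r → ∀ a b, S.ghat a b t r ω = S.ghat b a t r ω
  ghat_trace : ∀ t r (ω : S2), DPlus M t0 t r → ∑ a, ∑ b, gQinv M r a b * S.ghat a b t r ω = 0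
  /-- the `S`-slot of the mixed part is tangential -/
  cross_tangent : ∀ t r (ω : S2), DPlus M t0 t r → ∀ a, ∑ i, (ω : E3) i * S.cross a i t r ω = 0
  /-- `ĝ̸` is symmetric, tangential and traceless -/
  shat_symm : ∀ t r (ω : S2), DPlus M t0 t r → ∀ i j, S.shat i j t r ω = S.shat j i t r ω
  shat_tangent : ∀ t r (ω : S2), DPlus M t0 t r → ∀ j, ∑ i, (ω : E3) i * S.shat i j t r ω = 0
  shat_trace : ∀ t r (ω : S2), DPlus M t0 t r → ∑ i, S.shat i i t r ω = 0
  /-- `□̃ĝ̃ + Δ̸ĝ̃ + (2/r)∇̃_P ĝ̃ - (2/r)(∇̃⊗̂ĝ̃)_P - (4/r)(μ/r)ĝ̃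
  = (1/r)dr⊗̂d̃tr g̃ + (2/r)dr⊗̂div g̸̃ - (1/r)dr⊗̂d̃tr g̸ - ∇̃⊗̂(r⁻¹(ĝ̃_{l=0})_P)` -/
  eq_ghat : ∀ t r (ω : S2), DPlus M t0 t r → ∀ a b,
    boxQ2 M t0 S.ghat a b t r ω + lapS0 (S.ghat a b) t r ω
      + 2 / r * ∑ c, P M c r * nQ2 M t0 S.ghat c a b t r ω
      - 2 / r * nHat2P M t0 S.ghat a b t r ω
      - 4 / r * (mu M r / r) * S.ghat a b t r ω
    = 1 / r * hatProd M (fun c _ _ _ => dr c) (fun c => dQ M t0 c S.trQ) a b t r ω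
      + 2 / r * hatProd M (fun c _ _ _ => dr c) (fun c => divS1 (S.cross c)) a b t r ω
      - 1 / r * hatProd M (fun c _ _ _ => dr c) (fun c => dQ M t0 c S.trS) a b t r ω
      - nHat1 M t0 (fun c t' r' ω' => r'⁻¹ * ghatL0P M S.ghat c t' r' ω') a b t r ω
  /-- `□̃tr g̃ + Δ̸tr g̃ = (2/r)δ̃((ĝ̃_{l=0})_P) - (2/r²)(ĝ̃_{l=0})_{PP}` -/
  eq_trQ : ∀ t r (ω : S2), DPlus M t0 t r →
    boxQ0 M t0 S.trQ t r ω + lapS0 S.trQ t r ω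
    = 2 / r * deltaQ1 M t0 (ghatL0P M S.ghat) t r ω
      - 2 / r ^ 2 * ∑ a, P M a r * ghatL0P M S.ghat a t r ω
  /-- `□̃g̸̃ + Δ̸g̸̃ - (2/r)(∇̃⊗g̸̃)_P - (1/r²)g̸̃ + (2/r²)dr⊗g̸̃_P = (2/r)dr⊗div ĝ̸`, where
  `(∇̃⊗g̸̃)_P` has components `P^b ∇̃_a g̸̃_{bi}` -/
  eq_cross : ∀ t r (ω : S2), DPlus M t0 t r → ∀ a i,
    boxQ1 M t0 (fun c => S.cross c i) a t r ω + lapS1 (S.cross a) i t r ω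
      - 2 / r * ∑ b, P M b r * nQ1 M t0 (fun c => S.cross c i) a b t r ω
      - 1 / r ^ 2 * S.cross a i t r ω
      + 2 / r ^ 2 * (dr a * ∑ b, P M b r * S.cross b i t r ω)
    = 2 / r * (dr a * divS2 S.shat i t r ω)
  /-- `□̃ĝ̸ + Δ̸ĝ̸ - (2/r)∇̃_P ĝ̸ - (4/r)(μ/r)ĝ̸ = 0` -/
  eq_shat : ∀ t r (ω : S2), DPlus M t0 t r → ∀ i j,
    boxQ0 M t0 (S.shat i j) t r ω + lapS2 S.shat i j t r ω
      - 2 / r * ∑ c, P M c r * dQ M t0 c (S.shat i j) t r ω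
      - 4 / r * (mu M r / r) * S.shat i j t r ω = 0
  /-- `□̃tr g̸ + Δ̸tr g̸ + (2/r)∇̃_P tr g̸ + (2/r²)tr g̸
  = (4/r²)ĝ̃_{PP} + (2/r²)tr g̃ - (4/r²)(ĝ̃_{l=0})_{PP}` -/
  eq_trS : ∀ t r (ω : S2), DPlus M t0 t r →
    boxQ0 M t0 S.trS t r ω + lapS0 S.trS t r ω
      + 2 / r * ∑ c, P M c r * dQ M t0 c S.trS t r ω
      + 2 / r ^ 2 * S.trS t r ω
    = 4 / r ^ 2 * ∑ a, P M a r * conP M S.ghat a t r ω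
      + 2 / r ^ 2 * S.trQ t r ω
      - 4 / r ^ 2 * ∑ a, P M a r * ghatL0P M S.ghat a t r ω
  /-- `-δ̃ĝ̃ + div g̸̃ - ½ d̃tr g̸ = -(1/r)(ĝ̃_{l=0})_P` -/
  gauge_Q : ∀ t r (ω : S2), DPlus M t0 t r → ∀ a,
    -deltaQ2 M t0 S.ghat a t r ω + divS1 (S.cross a) t r ω - 1 / 2 * dQ M t0 a S.trS t r ω
    = -(1 / r * ghatL0P M S.ghat a t r ω)
  /-- `-δ̃g̸̃ - ½ ∇̸tr g̃ + div ĝ̸ = 0` -/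
  gauge_S : ∀ t r (ω : S2), DPlus M t0 t r → ∀ i,
    -deltaQ1 M t0 (fun c => S.cross c i) t r ω - 1 / 2 * dS i S.trQ t r ω
      + divS2 S.shat i t r ω = 0

/-- The projection of a linearised metric onto `l = 0, 1`; symmetric traceless 2-covariant
`S`-tensors have no `l = 0, 1` part. -/
def LinMetric.projL01 (S : LinMetric) : LinMetric where
  ghat a b := LinGrav.projL01 (S.ghat a b)
  trQ := LinGrav.projL01 S.trQ
  cross a := projL01Form (S.cross a)
  shat _ _ := fun _ _ _ => 0
  trS := LinGrav.projL01 S.trS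

/-- Functions on `S²` that are linear combinations of the `l = 1` spherical harmonics. -/
def SupportedOnL1 (f : S2 → ℝ) : Prop := ∃ c : Fin 3 → ℝ, ∀ ω, f ω = ∑ k, c k * Y1 k ω

/-- The linearised Kerr solution with parameters `𝔪` and `𝔞`: the mass part is
`ĝ̃ = (2𝔪/r)(dt* + dr)²`, the linearisation of the Schwarzschild family in the mass, and the
rotation part is `g̸̃ = (μ dt* + (1+μ) dr) ⊗ ⋆∇̸𝔞`. -/
def kerr (M 𝔪 : ℝ) (𝔞 : S2 → ℝ) : LinMetric where
  ghat _ _ := fun _ r _ => 2 * 𝔪 / r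
  trQ := fun _ _ _ => 0
  cross a i := fun t r ω =>
    ![mu M r, 1 + mu M r] a * starS (fun j => dS j (fun _ _ => 𝔞)) i t r ω
  shat _ _ := fun _ _ _ => 0
  trS := fun _ _ _ => 0

/-- `S` and `S'` agree at the points of the sphere `(t, r)`. -/
def AgreeAt (S S' : LinMetric) (t r : ℝ) : Prop :=
  ∀ ω : S2,
    (∀ a b, S.ghat a b t r ω = S'.ghat a b t r ω) ∧ S.trQ t r ω = S'.trQ t r ω ∧
    (∀ a i, S.cross a i t r ω = S'.cross a i t r ω) ∧
    (∀ i j, S.shat i j t r ω = S'.shat i j t r ω) ∧ S.trS t r ω = S'.trS t r ω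

/-- The Lie derivative along `n` of all the quantities of a linearised metric. -/
def LinMetric.lieN (M t0 : ℝ) (S : LinMetric) : LinMetric where
  ghat := lieN2 M t0 S.ghat
  trQ := lieN0 M t0 S.trQ
  cross a i := lieN1 M t0 (fun c => S.cross c i) a
  shat i j := lieN0 M t0 (S.shat i j)
  trS := lieN0 M t0 S.trS

/-- `S` and `S'` have the same Cauchy data on `Σ = {t* = t₀*}`. -/
def SameCauchyData (M t0 : ℝ) (S S' : LinMetric) : Prop :=
  ∀ r, 2 * M ≤ r → AgreeAt S S' t0 r ∧ AgreeAt (S.lieN M t0) (S'.lieN M t0) t0 r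

/-- `S` is in the `𝒦_{𝔪,𝔞}`-adapted Regge–Wheeler gauge. -/
structure IsKerrAdaptedRW (M t0 𝔪 : ℝ) (𝔞 : S2 → ℝ) (S : LinMetric) : Prop where
  /-- `div g̸̃ = 0` and `ℒ_n div g̸̃ = 0` on `Σ` -/
  div_cross : ∀ r ω, 2 * M ≤ r → ∀ a, divS1 (S.cross a) t0 r ω = 0
  lie_div_cross : ∀ r ω, 2 * M ≤ r → ∀ a,
    lieN1 M t0 (fun c => divS1 (S.cross c)) a t0 r ω = 0
  /-- `ĝ̸ = 0` and `ℒ_n ĝ̸ = 0` on `Σ` -/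
  shat : ∀ r ω, 2 * M ≤ r → ∀ i j, S.shat i j t0 r ω = 0
  lie_shat : ∀ r ω, 2 * M ≤ r → ∀ i j, lieN0 M t0 (S.shat i j) t0 r ω = 0
  /-- `S_{l=0,1}` has the Cauchy data of the linearised Kerr solution on `Σ` -/
  kerr_data : SameCauchyData M t0 S.projL01 (kerr M 𝔪 𝔞)

end LinGrav

end

noncomputable section
namespace LinGrav
open Set Filter Topology MeasureTheory

/-! The theorem is a chain of uniqueness statements for linear wave equations, each closed because
of the earlier ones. The equation for the traceless `S`-part is homogeneous, so its zero data
propagate (`IsSolution.s_eq_zero`). This removes the source from the equation for the mixed part ω.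
On 1-forms of the unit sphere div Δ = (Δ + 1) div (`dv_sum_NS2_NS1`), so the divergence of that
equation is a homogeneous system for div ω alone, and div ω vanishes too
(`IsSolution.dv_x_eq_zero`).

With both gone, projecting the remaining scalar-type equations to an l = 0 or l = 1 harmonic gives a
closed system for the modes of the traceless `𝒬`-part and of the two traces
(`IsSolution.modeSystem`). The term ξ is purely l = 0. For l = 0 the mass perturbation solves the
same system (`modeSystem_mass`), so the difference has zero data and vanishes; for l = 1 the data
themselves vanish. The even l = 1 part of ω is zero because ω is divergence-free; the odd part is
compared with the rotating solution (`crossOp_rotation`, `IsSolution.pairing_x`).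

The `𝒬`-trace needs another argument, since only its l = 0, 1 data are prescribed. The divergence of
the second gauge condition gives that its sphere Laplacian vanishes. Hence it is constant on each
sphere and equals its mean, which is already known to be zero (`IsSolution.q_eq_zero`).

All uniqueness statements are instances of `eq_zero_of_wave_mem_jetIdeal`. A finite family with zero
Cauchy data vanishes if each wave operator lies in the ideal generated by the functions and their
first derivatives. Working modulo this ideal avoids computing Christoffel and curvature terms. The
proof is an energy estimate with a multiplier that is timelike up to the horizon. The flux has a
favourable sign both at r = 2M and through the ingoing null cones t* + r = const, so a weight
supported behind such a cone needs no condition at infinity, and Grönwall concludes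
(`energy_eq_zero`).

The computations take place in the commutative algebra `SF` of smooth functions, with derivations
`Dt`, `Dr` and `DS i`; the last are the ambient derivatives of extensions homogeneous of degree
zero. `Rep` translates between the given fields and this algebra. -/

/-- The smoothness exponent `C^∞`. -/
abbrev Cinf : WithTop ℕ∞ := ((⊤ : ℕ∞) : WithTop ℕ∞)

/-! ### The algebra of smooth functions on `D⁺(Σ)` -/

/-- Points of `D⁺(Σ)`. -/
abbrev Pt (M t0 : ℝ) : Type := {p : ℝ × ℝ // DPlus M t0 p.1 p.2} × S2

/-- The ambient space of the cone over `D⁺(Σ)`. -/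
abbrev Amb : Type := ℝ × ℝ × E3

def region (M t0 : ℝ) : Set Amb := Ici t0 ×ˢ Ici (2 * M) ×ˢ {(0 : E3)}ᶜ

/-- The value at the origin is arbitrary and keeps the radial projection total; the origin is
excluded from `region`. -/
def toS2 (x : E3) : S2 :=
  if hx : x = 0 then ⟨EuclideanSpace.single 0 1, by simp⟩
  else ⟨‖x‖⁻¹ • x, by
    rw [mem_sphere_zero_iff_norm, norm_smul, norm_inv, norm_norm,
      inv_mul_cancel₀ (norm_ne_zero_iff.mpr hx)]⟩

theorem sphereExt_eq (f : S2 → ℝ) {x : E3} (hx : x ≠ 0) : sphereExt f x = f (toS2 x) := by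
  simp [sphereExt, toS2, hx]

theorem toS2_coe (ω : S2) : toS2 (ω : E3) = ω := by
  have h : ‖(ω : E3)‖ = 1 := mem_sphere_zero_iff_norm.1 ω.2
  have h0 : (ω : E3) ≠ 0 := by rw [← norm_ne_zero_iff, h]; exact one_ne_zero
  apply Subtype.ext
  simp only [toS2, h0, dite_false, h, inv_one, one_smul]

theorem toS2_smul {c : ℝ} (hc : 0 < c) (x : E3) : toS2 (c • x) = toS2 x := by
  by_cases hx : x = 0
  · simp [hx]
  · have : c • x ≠ 0 := smul_ne_zero hc.ne' hx
    simp only [toS2, hx, this, dite_false, norm_smul, Real.norm_eq_abs, abs_of_pos hc, smul_smul]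
    congr 2
    field_simp

variable {M t0 : ℝ}

def incl (x : Pt M t0) : Amb := (x.1.1.1, x.1.1.2, (x.2 : E3))

-- Clamping t and r and projecting radially turn a function of points into one on the whole ambient
-- space, invariant under positive scalings of the cone variable. Smoothness is only required over
-- `region`.
variable (M t0) in
def retract (p : Amb) : Pt M t0 :=
  (⟨(max t0 p.1, max (2 * M) p.2.1), le_max_left _ _, le_max_left _ _⟩, toS2 p.2.2)

theorem coe_S2_ne (ω : S2) : (ω : E3) ≠ 0 := by
  rw [← norm_ne_zero_iff, mem_sphere_zero_iff_norm.1 ω.2]; exact one_ne_zero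

theorem norm_S2 (ω : S2) : ‖(ω : E3)‖ = 1 := mem_sphere_zero_iff_norm.1 ω.2

theorem incl_mem (x : Pt M t0) : incl x ∈ region M t0 :=
  ⟨x.1.2.1, x.1.2.2, coe_S2_ne x.2⟩

theorem retract_incl (x : Pt M t0) : retract M t0 (incl x) = x := by
  rcases x with ⟨⟨⟨t, r⟩, h1, h2⟩, ω⟩
  simp only at h1 h2
  simp [retract, incl, toS2_coe, h1, h2]

/-- Scaling of the cone variable. -/
def scale (c : ℝ) : Amb →L[ℝ] Amb :=
  (ContinuousLinearMap.id ℝ ℝ).prodMap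
    ((ContinuousLinearMap.id ℝ ℝ).prodMap (c • ContinuousLinearMap.id ℝ E3))

theorem scale_apply (c : ℝ) (p : Amb) : scale c p = (p.1, p.2.1, c • p.2.2) := rfl

theorem scale_mem {c : ℝ} (hc : 0 < c) {p : Amb} (hp : p ∈ region M t0) :
    scale c p ∈ region M t0 :=
  ⟨hp.1, hp.2.1, smul_ne_zero hc.ne' hp.2.2⟩

theorem retract_scale {c : ℝ} (hc : 0 < c) (p : Amb) :
    retract M t0 (scale c p) = retract M t0 p := by
  simp [retract, scale_apply, toS2_smul hc]

theorem incl_retract {p : Amb} (hp : p ∈ region M t0) :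
    incl (retract M t0 p) = scale ‖p.2.2‖⁻¹ p := by
  have h1 : t0 ≤ p.1 := hp.1
  have h2 : 2 * M ≤ p.2.1 := hp.2.1
  have h3 : p.2.2 ≠ 0 := hp.2.2
  simp [retract, incl, scale_apply, toS2, h1, h2, h3]

theorem norm_pos_of_mem {p : Amb} (hp : p ∈ region M t0) : 0 < ‖p.2.2‖ :=
  norm_pos_iff.2 hp.2.2

/-- This makes derivatives up to the boundary t = t0, r = 2M well defined by the values inside the
closed region. -/
theorem region_uniqueDiffOn : UniqueDiffOn ℝ (region M t0) :=
  (uniqueDiffOn_Ici _).prod ((uniqueDiffOn_Ici _).prod isOpen_compl_singleton.uniqueDiffOn)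

/-- Needed for the symmetry of second derivatives at boundary points, which are limits of interior
ones. -/
theorem region_subset_closure_interior : region M t0 ⊆ closure (interior (region M t0)) := by
  have : interior (region M t0) = Ioi t0 ×ˢ Ioi (2 * M) ×ˢ {(0 : E3)}ᶜ := by
    rw [region, interior_prod_eq, interior_prod_eq, interior_Ici, interior_Ici,
      isOpen_compl_singleton.interior_eq]
  rw [this, closure_prod_eq, closure_prod_eq, closure_Ioi, closure_Ioi]
  exact prod_mono le_rfl (prod_mono le_rfl subset_closure)

variable (M t0) in
/-- The algebra of smooth functions on `D⁺(Σ)`. -/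
def smoothAlg : Subalgebra ℝ (Pt M t0 → ℝ) where
  carrier := {F | ContDiffOn ℝ Cinf (F ∘ retract M t0) (region M t0)}
  mul_mem' hf hg := ContDiffOn.mul hf hg
  add_mem' hf hg := ContDiffOn.add hf hg
  algebraMap_mem' c := contDiffOn_const (c := c)

variable (M t0) in
abbrev SF : Type := ↥(smoothAlg M t0)

instance : CharZero (SF M t0) where
  cast_injective m n h := by
    have h2 := congrFun (congrArg Subtype.val h)
      (⟨(t0, 2 * M), le_rfl, le_rfl⟩, ⟨EuclideanSpace.single 0 1, by simp⟩)
    have h3 : (m : ℝ) = n := h2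
    exact_mod_cast h3

def SF.ext (F : SF M t0) (p : Amb) : ℝ := F.1 (retract M t0 p)

theorem SF.contDiffOn (F : SF M t0) : ContDiffOn ℝ Cinf F.ext (region M t0) := F.2

theorem SF.ext_incl (F : SF M t0) (x : Pt M t0) : F.ext (incl x) = F.1 x := by
  rw [SF.ext, retract_incl]

theorem contDiffOn_radial :
    ContDiffOn ℝ Cinf (fun p : Amb => incl (retract M t0 p)) (region M t0) := by
  refine ContDiffOn.congr (f := fun p : Amb => (p.1, p.2.1, ‖p.2.2‖⁻¹ • p.2.2)) ?_
    (fun p hp => incl_retract hp)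
  refine contDiffOn_fst.prodMk ((contDiff_fst.comp contDiff_snd).contDiffOn.prodMk ?_)
  have h2 : ContDiffOn ℝ Cinf (fun p : Amb => p.2.2) (region M t0) :=
    (contDiff_snd.comp contDiff_snd).contDiffOn
  refine ContDiffOn.smul (ContDiffOn.inv (h2.norm ℝ fun p hp => hp.2.2) fun p hp => ?_) h2
  exact (norm_pos_of_mem hp).ne'

theorem SF.differentiableOn (F : SF M t0) : DifferentiableOn ℝ F.ext (region M t0) :=
  F.contDiffOn.differentiableOn (by simp)

theorem SF.fderivWithin_contDiffOn (F : SF M t0) :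
    ContDiffOn ℝ Cinf (fderivWithin ℝ F.ext (region M t0)) (region M t0) :=
  F.contDiffOn.fderivWithin region_uniqueDiffOn (by simp)

/-- Differentiation in the direction of an ambient vector. -/
def der (v : Amb) : Derivation ℝ (SF M t0) (SF M t0) where
  toFun F := ⟨fun x => fderivWithin ℝ F.ext (region M t0) (incl x) v, by
    have h : ContDiffOn ℝ Cinf (fun p => fderivWithin ℝ F.ext (region M t0)
        (incl (retract M t0 p))) (region M t0) :=
      F.fderivWithin_contDiffOn.comp contDiffOn_radial fun p _ => incl_mem _
    exact h.clm_apply contDiffOn_const⟩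
  map_add' F G := by
    apply Subtype.ext
    funext x
    exact congrArg (· v) (fderivWithin_add (region_uniqueDiffOn _ (incl_mem x))
      (F.differentiableOn _ (incl_mem x)) (G.differentiableOn _ (incl_mem x)))
  map_smul' c F := by
    apply Subtype.ext
    funext x
    exact congrArg (· v) (fderivWithin_const_smul (region_uniqueDiffOn _ (incl_mem x))
      (F.differentiableOn _ (incl_mem x)) c)
  map_one_eq_zero' := by
    apply Subtype.ext
    funext x
    have h : fderivWithin ℝ (SF.ext (1 : SF M t0)) (region M t0) (incl x) = 0 :=
      fderivWithin_const_apply (1 : ℝ)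
    exact congrArg (· v) h
  leibniz' F G := by
    apply Subtype.ext
    funext x
    have := congrArg (· v) (fderivWithin_mul (region_uniqueDiffOn _ (incl_mem x))
      (F.differentiableOn _ (incl_mem x)) (G.differentiableOn _ (incl_mem x)))
    simp only [SF.ext_incl] at this
    exact this

theorem der_apply (v : Amb) (F : SF M t0) (x : Pt M t0) :
    (der v F).1 x = fderivWithin ℝ F.ext (region M t0) (incl x) v := rfl

theorem der_smul (c : ℝ) (v : Amb) (F : SF M t0) : der (c • v) F = c • der v F := by
  apply Subtype.ext; funext x; exact map_smul _ _ _

/-- The chain rule applied to the scale invariance of `F.ext`: in the cone variable the derivative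
has degree -1. -/
theorem SF.fderivWithin_scale (F : SF M t0) {c : ℝ} (hc : 0 < c) {p : Amb}
    (hp : p ∈ region M t0) (w : Amb) :
    fderivWithin ℝ F.ext (region M t0) (scale c p) (scale c w)
      = fderivWithin ℝ F.ext (region M t0) p w := by
  have h1 : HasFDerivWithinAt F.ext (fderivWithin ℝ F.ext (region M t0) (scale c p))
      (region M t0) (scale c p) := (F.differentiableOn _ (scale_mem hc hp)).hasFDerivWithinAt
  have h2 := h1.comp p ((scale c).hasFDerivWithinAt (s := region M t0))
    (fun q hq => scale_mem hc hq)
  have h3 : F.ext ∘ scale c = F.ext := by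
    funext q; simp [SF.ext, retract_scale hc]
  rw [h3] at h2
  rw [h2.fderivWithin (region_uniqueDiffOn _ hp)]
  rfl

/-- Euler's relation in degree zero, since `F.ext` is constant along the ray through the point. It
makes sphere gradients tangential. -/
theorem SF.fderivWithin_radial (F : SF M t0) (x : Pt M t0) :
    fderivWithin ℝ F.ext (region M t0) (incl x) (0, 0, (x.2 : E3)) = 0 := by
  have h1 : HasFDerivWithinAt F.ext (fderivWithin ℝ F.ext (region M t0) (incl x))
      (region M t0) (incl x) := (F.differentiableOn _ (incl_mem x)).hasFDerivWithinAt
  have hc : HasDerivAt (fun s : ℝ => scale s (incl x)) ((0, 0, (x.2 : E3)) : Amb) 1 := by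
    have h := ((hasDerivAt_id (1 : ℝ)).smul_const (x.2 : E3))
    rw [one_smul] at h
    exact (hasDerivAt_const _ _).prodMk ((hasDerivAt_const _ _).prodMk h)
  have e1 : scale 1 (incl x) = incl x := by simp [scale_apply, incl]
  rw [← e1] at h1
  have h2 := h1.comp_hasDerivWithinAt (s := Ioi 0) (1 : ℝ) hc.hasDerivWithinAt
    (fun s hs => scale_mem hs (incl_mem x))
  have h3 : HasDerivWithinAt (F.ext ∘ fun s : ℝ => scale s (incl x)) 0 (Ioi 0) 1 := by
    refine (hasDerivWithinAt_const (1 : ℝ) (Ioi 0) (F.1 x)).congr (fun s hs => ?_) ?_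
    · simp only [Function.comp, SF.ext, retract_scale hs, retract_incl]
    · simp only [Function.comp, SF.ext, e1, retract_incl]
  rw [e1] at h2
  exact UniqueDiffWithinAt.eq_deriv _ (uniqueDiffOn_Ioi (0 : ℝ) 1 (mem_Ioi.2 one_pos)) h2 h3

/-- `der w F` is differentiated on the unit sphere and then extended again with degree 0, whereas
the true derivative in the cone directions has degree -1. Scaling the cone component of `w` by the
norm compensates for this. -/
theorem der_ext (F : SF M t0) (w : Amb) {p : Amb} (hp : p ∈ region M t0) :
    (der w F).ext p = fderivWithin ℝ F.ext (region M t0) p (scale ‖p.2.2‖ w) := by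
  have hn := norm_pos_of_mem hp
  rw [SF.ext, der_apply, incl_retract hp, ← F.fderivWithin_scale (inv_pos.2 hn) hp]
  congr 1
  simp [scale_apply, smul_smul, inv_mul_cancel₀ hn.ne']

theorem hasFDerivAt_norm_incl (x : Pt M t0) :
    HasFDerivAt (fun p : Amb => ‖p.2.2‖)
      ((innerSL ℝ (x.2 : E3)).comp ((ContinuousLinearMap.snd ℝ ℝ E3).comp
        (ContinuousLinearMap.snd ℝ ℝ (ℝ × E3)))) (incl x) := by
  have h0 : HasFDerivAt (fun p : Amb => p.2.2) ((ContinuousLinearMap.snd ℝ ℝ E3).comp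
        (ContinuousLinearMap.snd ℝ ℝ (ℝ × E3))) (incl x) :=
    ((ContinuousLinearMap.snd ℝ ℝ E3).comp
        (ContinuousLinearMap.snd ℝ ℝ (ℝ × E3))).hasFDerivAt
  have h1 := h0.norm_sq.sqrt (by simp [incl])
  have e : (fun p : Amb => √(‖p.2.2‖ ^ 2)) = fun p : Amb => ‖p.2.2‖ := by
    funext p; rw [Real.sqrt_sq (norm_nonneg _)]
  rw [e] at h1
  refine h1.congr_fderiv ?_
  ext v <;> simp [incl]

/-- The second term comes from differentiating the norm factor of `der_ext`, whose gradient on the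
unit sphere is the position vector. -/
theorem der_der_apply (v w : Amb) (F : SF M t0) (x : Pt M t0) :
    (der v (der w F)).1 x =
      fderivWithin ℝ (fderivWithin ℝ F.ext (region M t0)) (region M t0) (incl x) v w
      + inner ℝ (x.2 : E3) v.2.2 * (der (0, 0, w.2.2) F).1 x := by
  have hu := region_uniqueDiffOn (M := M) (t0 := t0) _ (incl_mem x)
  have h1 : HasFDerivWithinAt (fderivWithin ℝ F.ext (region M t0)) _ (region M t0) (incl x) :=
    (F.fderivWithin_contDiffOn.differentiableOn (by simp) _ (incl_mem x)).hasFDerivWithinAt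
  have h2 : HasFDerivWithinAt (fun p : Amb => ((w.1, w.2.1, 0) : Amb)
      + ‖p.2.2‖ • ((0, 0, w.2.2) : Amb)) _ (region M t0) (incl x) :=
    ((hasFDerivAt_norm_incl x).smul_const ((0, 0, w.2.2) : Amb)).hasFDerivWithinAt.const_add _
  have h3 := h1.clm_apply h2
  have h5 : ∀ p ∈ region M t0, (der w F).ext p = fderivWithin ℝ F.ext (region M t0) p
      ((w.1, w.2.1, 0) + ‖p.2.2‖ • ((0, 0, w.2.2) : Amb)) := fun p hp => by
    rw [der_ext F w hp]; congr 1; simp [scale_apply]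
  have h4 := h3.congr h5 (h5 _ (incl_mem x))
  rw [der_apply, h4.fderivWithin hu]
  have e : ((w.1, w.2.1, 0) : Amb) + ((0, 0, w.2.2) : Amb) = w := by simp
  simp [incl, der_apply, e, -Prod.smul_mk, add_comm]

/-- The second Fréchet derivative is symmetric and cancels; only the corrections of `der_der_apply`
survive. -/
theorem der_comm (v w : Amb) (F : SF M t0) (x : Pt M t0) :
    (der v (der w F)).1 x - (der w (der v F)).1 x =
      inner ℝ (x.2 : E3) v.2.2 * (der (0, 0, w.2.2) F).1 x
      - inner ℝ (x.2 : E3) w.2.2 * (der (0, 0, v.2.2) F).1 x := by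
  have hs : IsSymmSndFDerivWithinAt ℝ F.ext (region M t0) (incl x) :=
    (F.contDiffOn _ (incl_mem x)).isSymmSndFDerivWithinAt
      (by simp only [minSmoothness_of_isRCLikeNormedField]
          exact WithTop.coe_le_coe.2 (le_top (a := (2 : ℕ∞)))) region_uniqueDiffOn
      (region_subset_closure_interior (incl_mem x)) (incl_mem x)
  rw [der_der_apply, der_der_apply, hs.eq]
  ring

/-! ### Representation of scalar fields by elements of the algebra -/

/-- `f` agrees on `D⁺(Σ)` with `F`. -/
def Rep (f : Scal) (F : SF M t0) : Prop :=
  ∀ t r (h : DPlus M t0 t r) (ω : S2), f t r ω = F.1 (⟨(t, r), h⟩, ω)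

def SmoothScal.toSF {f : Scal} (hf : SmoothScal M t0 f) : SF M t0 :=
  ⟨fun x => f x.1.1.1 x.1.1.2 x.2, by
    refine ContDiffOn.congr hf fun p hp => ?_
    have h1 : t0 ≤ p.1 := hp.1
    have h2 : 2 * M ≤ p.2.1 := hp.2.1
    have h3 : p.2.2 ≠ 0 := hp.2.2
    simp [retract, h1, h2, sphereExt_eq _ h3]⟩

theorem SmoothScal.rep {f : Scal} (hf : SmoothScal M t0 f) : Rep f hf.toSF :=
  fun _ _ _ _ => rfl

theorem Rep.ext {f : Scal} {F G : SF M t0} (hF : Rep f F) (hG : Rep f G) : F = G := by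
  apply Subtype.ext
  funext ⟨⟨⟨t, r⟩, h⟩, ω⟩
  rw [← hF t r h ω, hG t r h ω]

/-- A smooth function of `r`. -/
def rad (c : ℝ → ℝ) (hc : ContDiffOn ℝ Cinf c (Ici (2 * M))) : SF M t0 :=
  ⟨fun x => c x.1.1.2, by
    refine ContDiffOn.congr (f := fun p : Amb => c p.2.1) (hc.comp
      (contDiff_fst.comp contDiff_snd).contDiffOn fun p hp => hp.2.1) fun p hp => ?_
    have h2 : 2 * M ≤ p.2.1 := hp.2.1
    simp [retract, h2]⟩

/-- The Cartesian coordinates on the sphere. -/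
def om (i : Fin 3) : SF M t0 :=
  ⟨fun x => (x.2 : E3) i, by
    have h : ContDiffOn ℝ Cinf (fun p : Amb => (incl (retract M t0 p)).2.2 i) (region M t0) :=
      ((EuclideanSpace.proj (𝕜 := ℝ) i).contDiff.comp
        (contDiff_snd.comp contDiff_snd)).comp_contDiffOn contDiffOn_radial
    exact h⟩

def Dt : Derivation ℝ (SF M t0) (SF M t0) := der (1, 0, 0)
def Dr : Derivation ℝ (SF M t0) (SF M t0) := der (0, 1, 0)
def DS (i : Fin 3) : Derivation ℝ (SF M t0) (SF M t0) := der (0, 0, EuclideanSpace.single i 1)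
def DQ (a : Fin 2) : Derivation ℝ (SF M t0) (SF M t0) := ![Dt, Dr] a

theorem der_hasDerivWithinAt (F : SF M t0) (x : Pt M t0) {v : Amb} {γ : ℝ → Amb} {s : Set ℝ}
    {a : ℝ} (hγ : HasDerivWithinAt γ v s a) (hs : MapsTo γ s (region M t0)) (ha : γ a = incl x) :
    HasDerivWithinAt (fun u => F.ext (γ u)) ((der v F).1 x) s a := by
  have h1 : HasFDerivWithinAt F.ext (fderivWithin ℝ F.ext (region M t0) (incl x))
      (region M t0) (γ a) := by
    rw [ha]; exact (F.differentiableOn _ (incl_mem x)).hasFDerivWithinAt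
  exact h1.comp_hasDerivWithinAt a hγ hs

theorem SF.hasDerivWithinAt_t (F : SF M t0) {t r : ℝ} (h : DPlus M t0 t r) (ω : S2) :
    HasDerivWithinAt (fun s => F.ext (s, r, (ω : E3))) ((Dt F).1 (⟨(t, r), h⟩, ω)) (Ici t0) t :=
  der_hasDerivWithinAt F (⟨(t, r), h⟩, ω)
    ((hasDerivWithinAt_id t _).prodMk (hasDerivWithinAt_const _ _ (r, (ω : E3))))
    (fun _ hs => ⟨hs, h.2, coe_S2_ne ω⟩) rfl

theorem SF.hasDerivWithinAt_r (F : SF M t0) {t r : ℝ} (h : DPlus M t0 t r) (ω : S2) :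
    HasDerivWithinAt (fun s => F.ext (t, s, (ω : E3))) ((Dr F).1 (⟨(t, r), h⟩, ω))
      (Ici (2 * M)) r :=
  der_hasDerivWithinAt F (⟨(t, r), h⟩, ω)
    ((hasDerivWithinAt_const _ _ t).prodMk
      ((hasDerivWithinAt_id r _).prodMk (hasDerivWithinAt_const _ _ (ω : E3))))
    (fun _ hs => ⟨h.1, hs, coe_S2_ne ω⟩) rfl

theorem SF.ext_mk (F : SF M t0) {t r : ℝ} (h : DPlus M t0 t r) (ω : S2) :
    F.ext (t, r, (ω : E3)) = F.1 (⟨(t, r), h⟩, ω) :=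
  F.ext_incl (⟨(t, r), h⟩, ω)

/-- The one-sided coordinate derivatives are the derivative within `region` taken along coordinate
half-lines, by the chain rule. -/
theorem Rep.dQ {f : Scal} {F : SF M t0} (hf : Rep f F) (a : Fin 2) :
    Rep (LinGrav.dQ M t0 a f) (DQ a F) := by
  intro t r h ω
  fin_cases a
  · refine ((F.hasDerivWithinAt_t h ω).congr (fun s hs => ?_) ?_).derivWithin
      (uniqueDiffOn_Ici t0 t h.1)
    · rw [hf s r ⟨hs, h.2⟩ ω, F.ext_mk ⟨hs, h.2⟩ ω]
    · rw [hf t r h ω, F.ext_mk h ω]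
  · refine ((F.hasDerivWithinAt_r h ω).congr (fun s hs => ?_) ?_).derivWithin
      (uniqueDiffOn_Ici (2 * M) r h.2)
    · rw [hf t s ⟨h.1, hs⟩ ω, F.ext_mk ⟨h.1, hs⟩ ω]
    · rw [hf t r h ω, F.ext_mk h ω]

theorem SF.hasFDerivAt_sphere (F : SF M t0) {t r : ℝ} (h : DPlus M t0 t r) (ω : S2) :
    HasFDerivAt (fun y : E3 => F.ext (t, r, y))
      ((fderivWithin ℝ F.ext (region M t0) (t, r, (ω : E3))).comp
        ((ContinuousLinearMap.inr ℝ ℝ (ℝ × E3)).comp (ContinuousLinearMap.inr ℝ ℝ E3))) (ω : E3) := by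
  have h1 : HasFDerivWithinAt F.ext (fderivWithin ℝ F.ext (region M t0) (t, r, (ω : E3)))
      (region M t0) (t, r, (ω : E3)) :=
    (F.differentiableOn _ (incl_mem (⟨(t, r), h⟩, ω))).hasFDerivWithinAt
  have h2 : HasFDerivAt (fun y : E3 => ((t, r, y) : Amb))
      ((ContinuousLinearMap.inr ℝ ℝ (ℝ × E3)).comp (ContinuousLinearMap.inr ℝ ℝ E3)) (ω : E3) := by
    refine ((hasFDerivAt_const t (ω : E3)).prodMk
      ((hasFDerivAt_const r (ω : E3)).prodMk (hasFDerivAt_id (ω : E3)))).congr_fderiv ?_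
    ext v <;> simp
  have h3 := h1.comp (s := {(0 : E3)}ᶜ) (ω : E3) h2.hasFDerivWithinAt
    (show MapsTo (fun y : E3 => ((t, r, y) : Amb)) {(0 : E3)}ᶜ (region M t0) from
      fun y hy => ⟨h.1, h.2, hy⟩)
  exact h3.hasFDerivAt (isOpen_compl_singleton.mem_nhds (coe_S2_ne ω))

theorem Rep.dS {f : Scal} {F : SF M t0} (hf : Rep f F) (i : Fin 3) :
    Rep (LinGrav.dS i f) (DS i F) := by
  intro t r h ω
  have h1 := (F.hasFDerivAt_sphere h ω).congr_of_eventuallyEq (f₁ := sphereExt (f t r)) (by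
    filter_upwards [isOpen_compl_singleton.mem_nhds (coe_S2_ne ω)] with y hy
    rw [sphereExt_eq _ hy, hf t r h, SF.ext]
    have h1 : t0 ≤ t := h.1
    have h2 : 2 * M ≤ r := h.2
    simp [retract, h1, h2])
  rw [LinGrav.dS, h1.fderiv]
  rfl

/-- The extension of `om j` is the j-th coordinate divided by the norm; its gradient on the unit
sphere is the tangential projection of a basis vector. -/
theorem der_om (v : Amb) (j : Fin 3) (x : Pt M t0) :
    (der v (om j)).1 x = v.2.2 j - inner ℝ (x.2 : E3) v.2.2 * (x.2 : E3) j := by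
  have hn : HasFDerivAt (fun p : Amb => ‖p.2.2‖⁻¹) _ (incl x) :=
    (hasDerivAt_inv (by simp [incl])).comp_hasFDerivAt (incl x)
      (hasFDerivAt_norm_incl x)
  have h1 : HasFDerivAt (fun p : Amb => ‖p.2.2‖⁻¹ * p.2.2 j) _ (incl x) :=
    hn.mul ((EuclideanSpace.proj (𝕜 := ℝ) j).comp ((ContinuousLinearMap.snd ℝ ℝ E3).comp
        (ContinuousLinearMap.snd ℝ ℝ (ℝ × E3)))).hasFDerivAt
  have h5 : ∀ p ∈ region M t0, (om (M := M) (t0 := t0) j).ext p = ‖p.2.2‖⁻¹ * p.2.2 j :=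
    fun p hp => by
      have := congrArg (fun q : Amb => q.2.2 j) (incl_retract hp)
      simpa [scale_apply, om, SF.ext, incl] using this
  have h2 := h1.hasFDerivWithinAt.congr h5 (h5 _ (incl_mem x))
  rw [der_apply, h2.fderivWithin (region_uniqueDiffOn _ (incl_mem x))]
  simp [incl]
  ring

theorem DS_om (i j : Fin 3) :
    DS (M := M) (t0 := t0) i (om j) = (if i = j then 1 else 0) - om i * om j := by
  apply Subtype.ext
  funext x
  rw [DS, der_om]
  have e : ((if i = j then 1 else 0 : SF M t0) - om i * om j).1 x
      = (if i = j then 1 else 0 : SF M t0).1 x - (x.2 : E3) i * (x.2 : E3) j := rfl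
  rw [e]
  by_cases hij : i = j
  · subst hij
    simp [EuclideanSpace.inner_single_right]
  · simp [EuclideanSpace.inner_single_right, hij, Ne.symm hij]

theorem der_om_horizontal (j : Fin 3) (a b : ℝ) :
    der (M := M) (t0 := t0) (a, b, 0) (om j) = 0 := by
  apply Subtype.ext
  funext x
  rw [der_om]
  simp

theorem der_rad (v : Amb) {c c' : ℝ → ℝ} (hc : ContDiffOn ℝ Cinf c (Ici (2 * M)))
    (hc' : ContDiffOn ℝ Cinf c' (Ici (2 * M)))
    (h : ∀ r, 2 * M ≤ r → HasDerivAt c (c' r) r) :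
    der v (rad (t0 := t0) c hc) = v.2.1 • rad c' hc' := by
  apply Subtype.ext
  funext x
  have h1 : HasFDerivAt (fun p : Amb => c p.2.1) _ (incl x) :=
    (h x.1.1.2 x.1.2.2).comp_hasFDerivAt (incl x) ((ContinuousLinearMap.fst ℝ ℝ E3).comp
        (ContinuousLinearMap.snd ℝ ℝ (ℝ × E3))).hasFDerivAt
  have h5 : ∀ p ∈ region M t0, (rad (t0 := t0) c hc).ext p = c p.2.1 := fun p hp => by
    have h2 : 2 * M ≤ p.2.1 := hp.2.1
    simp [SF.ext, rad, retract, h2]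
  have h2 := h1.hasFDerivWithinAt.congr h5 (h5 _ (incl_mem x))
  rw [der_apply, h2.fderivWithin (region_uniqueDiffOn _ (incl_mem x))]
  simp [rad, mul_comm]

end LinGrav
end

noncomputable section
namespace LinGrav
open Set Filter Topology MeasureTheory

variable {M t0 : ℝ}

/-! ### Structure relations of the derivations -/

theorem Dt_om (j : Fin 3) : Dt (M := M) (t0 := t0) (om j) = 0 := der_om_horizontal j 1 0

theorem Dr_om (j : Fin 3) : Dr (M := M) (t0 := t0) (om j) = 0 := der_om_horizontal j 0 1

/-- Both corrections in `der_comm` involve the cone component of the first vector, which is zero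
here. -/
theorem der_comm_horizontal (a b : ℝ) (w : Amb) (F : SF M t0) :
    der (a, b, 0) (der w F) = der w (der (a, b, 0) F) := by
  apply Subtype.ext
  funext x
  have h := der_comm (a, b, 0) w F x
  have h0 : der ((0, 0, 0) : Amb) F = 0 := by
    have := der_smul 0 (0 : Amb) F
    rw [zero_smul, zero_smul] at this
    exact this
  rw [h0] at h
  simp only [inner_zero_right, zero_mul] at h
  have : ((0 : SF M t0).1 x) = 0 := rfl
  rw [this, mul_zero, sub_zero] at h
  exact sub_eq_zero.1 h

theorem Dt_Dr (F : SF M t0) : Dt (Dr F) = Dr (Dt F) :=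
  der_comm_horizontal 1 0 _ F

theorem Dt_DS (i : Fin 3) (F : SF M t0) : Dt (DS i F) = DS i (Dt F) :=
  der_comm_horizontal 1 0 _ F

theorem Dr_DS (i : Fin 3) (F : SF M t0) : Dr (DS i F) = DS i (Dr F) :=
  der_comm_horizontal 0 1 _ F

/-- Tangential ambient derivatives do not commute: their commutator is the rotation field of the (i,
j) plane. -/
theorem DS_DS (i j : Fin 3) (F : SF M t0) :
    DS i (DS j F) = DS j (DS i F) + om i * DS j F - om j * DS i F := by
  apply Subtype.ext
  funext x
  have h := der_comm (0, 0, EuclideanSpace.single i 1) (0, 0, EuclideanSpace.single j 1) F x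
  simp only [EuclideanSpace.inner_single_right, one_mul, conj_trivial] at h
  rw [sub_eq_iff_eq_add] at h
  change (der _ (der _ F)).1 x = (der _ (der _ F)).1 x
    + (x.2 : E3) i * (der _ F).1 x - (x.2 : E3) j * (der _ F).1 x
  rw [h]
  ring

theorem om_sq : ∑ i, om (M := M) (t0 := t0) i * om i = 1 := by
  apply Subtype.ext
  funext x
  have h := norm_S2 x.2
  rw [EuclideanSpace.norm_eq, Real.sqrt_eq_one] at h
  have e : (∑ i, om (M := M) (t0 := t0) i * om i).1 x = ∑ i, (x.2 : E3) i * (x.2 : E3) i := by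
    simp [om]
  rw [e]
  simpa [sq] using h

theorem om_DS (F : SF M t0) : ∑ i, om i * DS i F = 0 := by
  apply Subtype.ext
  funext x
  have h := F.fderivWithin_radial x
  have e1 : ((0, 0, (x.2 : E3)) : Amb) = ∑ i, (x.2 : E3) i • (0, 0, EuclideanSpace.single i 1) := by
    ext j <;> simp [Prod.fst_sum, Prod.snd_sum]
    fin_cases j <;> simp [Fin.sum_univ_three]
  rw [e1, map_sum] at h
  simp only [map_smul, smul_eq_mul] at h
  simp only [AddSubmonoidClass.coe_finsetSum, Finset.sum_apply]
  exact h

variable [hM : Fact (0 < M)]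

variable (M t0) in
/-- The function `1 / r`. -/
def rho : SF M t0 := rad (fun r => r⁻¹) (contDiffOn_id.inv fun r hr => by
  have h1 : 2 * M ≤ r := hr
  have := hM.out
  exact (by linarith : 0 < r).ne')

theorem r_pos {r : ℝ} (h : 2 * M ≤ r) : 0 < r := by
  have := hM.out; linarith

theorem der_rho (v : Amb) : der v (rho M t0) = v.2.1 • (-(rho M t0 * rho M t0)) := by
  have hc : ContDiffOn ℝ Cinf (fun r : ℝ => r⁻¹) (Ici (2 * M)) :=
    contDiffOn_id.inv fun r hr => (r_pos hr).ne'
  rw [rho, der_rad v hc (c' := fun r => -(r⁻¹ * r⁻¹)) (hc.mul hc).neg]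
  · rfl
  · intro r hr
    have := hasDerivAt_inv (r_pos hr).ne'
    rwa [sq, mul_inv] at this

theorem Dt_rho : Dt (rho M t0) = 0 := by rw [Dt, der_rho]; exact zero_smul _ _

theorem DS_rho (i : Fin 3) : DS i (rho M t0) = 0 := by rw [DS, der_rho]; exact zero_smul _ _

theorem Dr_rho : Dr (rho M t0) = -(rho M t0 * rho M t0) := by
  rw [Dr, der_rho]; exact one_smul _ _

end LinGrav
end

noncomputable section
namespace LinGrav
open Set Filter Topology MeasureTheory

/-! ### Integration over the spheres -/

theorem integrable_of_continuous {K : Type*} [TopologicalSpace K] [CompactSpace K]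
    [MeasurableSpace K] [OpensMeasurableSpace K] {V : Type*} [NormedAddCommGroup V]
    [SecondCountableTopologyEither K V] {ν : Measure K} [IsFiniteMeasure ν]
    {f : K → V} (hf : Continuous f) : Integrable f ν := by
  obtain ⟨C, hC⟩ := (isCompact_univ (X := K)).exists_bound_of_continuousOn hf.continuousOn
  exact Integrable.of_bound hf.aestronglyMeasurable C (Eventually.of_forall fun k => hC k trivial)

/-- Differentiation under the integral sign on a convex set of parameters. -/
theorem hasFDerivWithinAt_integral_of_convex {E K : Type*} [NormedAddCommGroup E]
    [NormedSpace ℝ E] [TopologicalSpace K] [CompactSpace K] [MeasurableSpace K]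
    [OpensMeasurableSpace K] [SecondCountableTopology K] {ν : Measure K} [IsFiniteMeasure ν]
    {s : Set E} (hs : Convex ℝ s) {f : E → K → ℝ} {f' : E → K → E →L[ℝ] ℝ}
    (hf : ∀ p ∈ s, ∀ k, HasFDerivWithinAt (fun q => f q k) (f' p k) s p)
    (hfc : ContinuousOn (Function.uncurry f) (s ×ˢ univ))
    (hfc' : ContinuousOn (Function.uncurry f') (s ×ˢ univ)) {p : E} (hp : p ∈ s) :
    HasFDerivWithinAt (fun q => ∫ k, f q k ∂ν) (∫ k, f' p k ∂ν) s p := by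
  have hint : ∀ q ∈ s, Integrable (f q) ν := fun q hq => integrable_of_continuous
    (hfc.comp_continuous (by fun_prop : Continuous fun k : K => (q, k)) fun k => ⟨hq, trivial⟩)
  have hint' : Integrable (f' p) ν := integrable_of_continuous
    (hfc'.comp_continuous (by fun_prop : Continuous fun k : K => (p, k)) fun k => ⟨hp, trivial⟩)
  apply HasFDerivWithinAt.of_isLittleO
  rw [Asymptotics.isLittleO_iff]
  intro ε hε
  -- Adding 1 keeps the constant positive even when the measure is zero.
  set c := ν.real univ + 1 with hc
  have hc0 : 0 < c := by have : 0 ≤ ν.real univ := measureReal_nonneg; linarith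
  -- Compactness of the integration space makes the continuity of the derivative at `p` uniform in
  -- `k`.
  obtain ⟨v, hv, hvu⟩ := isCompact_univ.mem_uniformity_of_prod hfc' hp
    (Metric.dist_mem_uniformity (div_pos hε hc0))
  obtain ⟨δ, hδ, hball⟩ := Metric.mem_nhdsWithin_iff.1 hv
  filter_upwards [inter_mem_nhdsWithin s (Metric.ball_mem_nhds p hδ)] with q hq
  have hconv : Convex ℝ (s ∩ Metric.ball p δ) := hs.inter (convex_ball p δ)
  -- Mean value inequality on the convex set where the derivative stays within ε / c of its value at
  -- `p`.
  have hpt : ∀ k, ‖f q k - f p k - f' p k (q - p)‖ ≤ ε / c * ‖q - p‖ := fun k =>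
    Convex.norm_image_sub_le_of_norm_hasFDerivWithin_le' (f' := fun z => f' z k)
      (fun z hz => (hf z hz.1 k).mono inter_subset_left)
      (fun z hz => by
        rw [← dist_eq_norm]
        exact (hvu z (hball ⟨hz.2, hz.1⟩) k trivial).le) hconv ⟨hp, Metric.mem_ball_self hδ⟩ hq
  have e : (∫ k, f q k ∂ν) - (∫ k, f p k ∂ν) - (∫ k, f' p k ∂ν) (q - p)
      = ∫ k, (f q k - f p k - f' p k (q - p)) ∂ν := by
    have h1 := integral_sub ((hint q hq.1).sub (hint p hp)) (hint'.apply_continuousLinearMap (q - p))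
    have h2 := integral_sub (hint q hq.1) (hint p hp)
    simp only [Pi.sub_apply] at h1
    rw [h1, h2, ContinuousLinearMap.integral_apply hint']
  rw [e]
  calc _ ≤ (ε / c * ‖q - p‖) * ν.real univ :=
        norm_integral_le_of_norm_le_const (Eventually.of_forall hpt)
    _ ≤ (ε / c * ‖q - p‖) * c := by
        gcongr; rw [hc]; linarith
    _ = ε * ‖q - p‖ := by field_simp

instance : IsFiniteMeasure sigma := by unfold sigma; infer_instance

theorem sigma_univ : sigma.real univ = 4 * Real.pi := by
  rw [sigma, Measure.toSphere_real_apply_univ, Measure.real, EuclideanSpace.volume_ball_fin_three]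
  have : 0 ≤ Real.pi * 4 / 3 := by positivity
  simp [ENNReal.toReal_ofReal this]
  ring

variable {M t0 : ℝ}

theorem continuous_incl_prod :
    Continuous (fun p : (ℝ × ℝ) × S2 => ((p.1.1, p.1.2, (p.2 : E3)) : Amb)) := by
  fun_prop

theorem SF.continuousOn_prod (F : SF M t0) :
    ContinuousOn (fun p : (ℝ × ℝ) × S2 => F.ext (p.1.1, p.1.2, (p.2 : E3)))
      ((Ici t0 ×ˢ Ici (2 * M)) ×ˢ univ) :=
  F.contDiffOn.continuousOn.comp continuous_incl_prod.continuousOn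
    fun p hp => ⟨hp.1.1, hp.1.2, coe_S2_ne p.2⟩

/-- The integral over the sphere as a function of the cone variables. -/
def SF.int (F : SF M t0) (q : ℝ × ℝ) : ℝ := ∫ η : S2, F.ext (q.1, q.2, (η : E3)) ∂sigma

theorem SF.integrable (F : SF M t0) {q : ℝ × ℝ} (hq : q ∈ Ici t0 ×ˢ Ici (2 * M)) :
    Integrable (fun η : S2 => F.ext (q.1, q.2, (η : E3))) sigma :=
  integrable_of_continuous (F.continuousOn_prod.comp_continuous
    (by fun_prop : Continuous fun k : S2 => (q, k)) fun _ => ⟨hq, trivial⟩)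

theorem SF.hasFDerivWithinAt_int (F : SF M t0) {q : ℝ × ℝ} (hq : q ∈ Ici t0 ×ˢ Ici (2 * M)) :
    HasFDerivWithinAt F.int ((Dt F).int q • ContinuousLinearMap.fst ℝ ℝ ℝ
      + (Dr F).int q • ContinuousLinearMap.snd ℝ ℝ ℝ) (Ici t0 ×ˢ Ici (2 * M)) q := by
  have h := hasFDerivWithinAt_integral_of_convex (ν := sigma)
    (s := Ici t0 ×ˢ Ici (2 * M)) ((convex_Ici _).prod (convex_Ici _))
    (f := fun q η => F.ext (q.1, q.2, ((η : S2) : E3)))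
    (f' := fun q η => (Dt F).ext (q.1, q.2, (η : E3)) • ContinuousLinearMap.fst ℝ ℝ ℝ
      + (Dr F).ext (q.1, q.2, (η : E3)) • ContinuousLinearMap.snd ℝ ℝ ℝ) ?_
      F.continuousOn_prod ?_ hq
  · rw [integral_add, integral_smul_const, integral_smul_const] at h
    · exact h
    · exact ((Dt F).integrable hq).smul_const _
    · exact ((Dr F).integrable hq).smul_const _
  · intro q hq η
    have h1 : HasFDerivWithinAt F.ext (fderivWithin ℝ F.ext (region M t0) (q.1, q.2, (η : E3)))
        (region M t0) (q.1, q.2, (η : E3)) :=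
      (F.differentiableOn _ (incl_mem (⟨q, hq⟩, η))).hasFDerivWithinAt
    have h2 : HasFDerivAt (fun y : ℝ × ℝ => ((y.1, y.2, (η : E3)) : Amb))
        ((ContinuousLinearMap.fst ℝ ℝ ℝ).prod ((ContinuousLinearMap.snd ℝ ℝ ℝ).prod 0)) q :=
      hasFDerivAt_fst.prodMk (hasFDerivAt_snd.prodMk (hasFDerivAt_const _ _))
    have h3 := h1.comp (s := Ici t0 ×ˢ Ici (2 * M)) q h2.hasFDerivWithinAt
      (show MapsTo (fun y : ℝ × ℝ => ((y.1, y.2, (η : E3)) : Amb)) _ (region M t0) from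
      fun y hy => ⟨hy.1, hy.2, coe_S2_ne η⟩)
    refine h3.congr_fderiv ?_
    rw [SF.ext_mk _ hq, SF.ext_mk _ hq]
    ext
    · simp [Dt, der_apply, incl]
    · simp [Dr, der_apply, incl]
  · exact ((Dt F).continuousOn_prod.smul continuousOn_const).add
      ((Dr F).continuousOn_prod.smul continuousOn_const)

/-- The partial derivatives of a sphere integral are again sphere integrals of elements of the
algebra, so the induction runs over all `F` simultaneously. -/
theorem SF.contDiffOn_int (n : ℕ) : ∀ F : SF M t0,
    ContDiffOn ℝ n F.int (Ici t0 ×ˢ Ici (2 * M)) := by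
  have hu : UniqueDiffOn ℝ (Ici t0 ×ˢ Ici (2 * M)) :=
    (uniqueDiffOn_Ici _).prod (uniqueDiffOn_Ici _)
  induction n with
  | zero =>
    intro F
    exact contDiffOn_zero.2 fun q hq => (F.hasFDerivWithinAt_int hq).continuousWithinAt
  | succ n ih =>
    intro F
    push_cast
    refine (contDiffOn_succ_iff_hasFDerivWithinAt_of_uniqueDiffOn hu).2 ⟨?_, _, ?_,
      fun q hq => F.hasFDerivWithinAt_int hq⟩
    · intro h; exact absurd h (by exact_mod_cast WithTop.coe_ne_top)
    · exact ((ih _).smul contDiffOn_const).add ((ih _).smul contDiffOn_const)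

/-- The integral over the spheres of constant `(t*, r)`. -/
def avg : SF M t0 →ₗ[ℝ] SF M t0 where
  toFun F := ⟨fun x => ∫ η, F.1 (x.1, η) ∂sigma, by
    refine ContDiffOn.congr (f := fun p : Amb => F.int (p.1, p.2.1)) ?_ fun p hp => ?_
    · exact (contDiffOn_infty.2 fun n => F.contDiffOn_int n).comp
        (contDiff_fst.prodMk (contDiff_fst.comp contDiff_snd)).contDiffOn
        fun p hp => ⟨hp.1, hp.2.1⟩
    · have h1 : t0 ≤ p.1 := hp.1
      have h2 : 2 * M ≤ p.2.1 := hp.2.1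
      simp [SF.int, SF.ext, retract, toS2_coe, h1, h2]⟩
  map_add' F G := by
    apply Subtype.ext
    funext x
    have := integral_add (F.integrable x.1.2) (G.integrable x.1.2)
    simp only [SF.ext_mk _ x.1.2] at this
    exact this
  map_smul' c F := by
    apply Subtype.ext
    funext x
    exact integral_const_mul _ _

theorem avg_apply (F : SF M t0) (x : Pt M t0) : (avg F).1 x = ∫ η, F.1 (x.1, η) ∂sigma := rfl

theorem avg_ext (F : SF M t0) {p : Amb} (hp : p ∈ region M t0) :
    (avg F).ext p = F.int (p.1, p.2.1) := by
  have h1 : t0 ≤ p.1 := hp.1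
  have h2 : 2 * M ≤ p.2.1 := hp.2.1
  simp [SF.int, SF.ext, avg_apply, retract, toS2_coe, h1, h2]

theorem der_avg (v : Amb) (F : SF M t0) :
    der v (avg F) = v.1 • avg (Dt F) + v.2.1 • avg (Dr F) := by
  apply Subtype.ext
  funext x
  have h1 := F.hasFDerivWithinAt_int x.1.2
  have h2 : HasFDerivAt (fun y : Amb => (y.1, y.2.1))
      ((ContinuousLinearMap.fst ℝ ℝ (ℝ × E3)).prod ((ContinuousLinearMap.fst ℝ ℝ E3).comp
        (ContinuousLinearMap.snd ℝ ℝ (ℝ × E3)))) (incl x) :=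
    ((ContinuousLinearMap.fst ℝ ℝ (ℝ × E3)).prod ((ContinuousLinearMap.fst ℝ ℝ E3).comp
        (ContinuousLinearMap.snd ℝ ℝ (ℝ × E3)))).hasFDerivAt
  have h3 := HasFDerivWithinAt.comp (s := region M t0) (incl x) h1 h2.hasFDerivWithinAt
    (show MapsTo (fun y : Amb => (y.1, y.2.1)) (region M t0) (Ici t0 ×ˢ Ici (2 * M)) from
      fun y hy => ⟨hy.1, hy.2.1⟩)
  have h4 := h3.congr (f₁ := (avg F).ext) (fun p hp => avg_ext F hp) (avg_ext F (incl_mem x))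
  rw [der_apply, h4.fderivWithin (region_uniqueDiffOn _ (incl_mem x))]
  have e : ∀ G : SF M t0, G.int x.1.1 = (avg G).1 x := fun G => by
    simp [SF.int, avg_apply, SF.ext_mk G x.1.2]
  simp [e]
  ring

theorem Dt_avg (F : SF M t0) : Dt (avg F) = avg (Dt F) := by
  rw [Dt, der_avg]; simp [Dt]

theorem Dr_avg (F : SF M t0) : Dr (avg F) = avg (Dr F) := by
  rw [Dr, der_avg]; simp [Dr]

theorem DS_avg (i : Fin 3) (F : SF M t0) : DS i (avg F) = 0 := by
  rw [DS, der_avg]; simp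

/-- Functions that are constant on every sphere of constant `(t*, r)`. -/
def IsRadial (F : SF M t0) : Prop := ∀ b ω ω', F.1 (b, ω) = F.1 (b, ω')

theorem isRadial_avg (F : SF M t0) : IsRadial (avg F) := fun _ _ _ => rfl

theorem avg_mul_of_isRadial {G : SF M t0} (hG : IsRadial G) (F : SF M t0) :
    avg (G * F) = G * avg F := by
  apply Subtype.ext
  funext x
  change ∫ η, G.1 (x.1, η) * F.1 (x.1, η) ∂sigma = G.1 x * ∫ η, F.1 (x.1, η) ∂sigma
  rw [← integral_const_mul]
  congr 1
  funext η
  rw [hG x.1 η x.2]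

end LinGrav
end

noncomputable section
namespace LinGrav
open Set Filter Topology MeasureTheory

variable {M t0 : ℝ}

/-! ### Rotations and integration by parts on the sphere -/

/-- Up to a constant the surface measure of a set is the volume of the cone over it; a linear
isometry carries cones to cones and preserves volume. -/
theorem measurePreserving_sphere (R : E3 ≃ₗᵢ[ℝ] E3) (f : S2 → S2) (hf : ∀ ω, (f ω : E3) = R ω) :
    MeasurePreserving f sigma sigma := by
  have hc : Continuous f := by
    rw [continuous_induced_rng]
    exact (by fun_prop : Continuous fun ω : S2 => R ω).congr fun ω => (hf ω).symm
  refine ⟨hc.measurable, ?_⟩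
  ext s hs
  rw [Measure.map_apply hc.measurable hs, sigma, Measure.toSphere_apply' _ hs,
    Measure.toSphere_apply' _ (hc.measurable hs)]
  congr 1
  conv_rhs => rw [← R.measurePreserving.measure_preimage_emb
    R.toHomeomorph.measurableEmbedding]
  congr 1
  ext y
  simp only [Set.mem_smul, mem_image, mem_preimage]
  constructor
  · rintro ⟨c, hc, _, ⟨ω, hω, rfl⟩, rfl⟩
    exact ⟨c, hc, _, ⟨f ω, hω, rfl⟩, by rw [hf, map_smul]⟩
  · rintro ⟨c, hc, _, ⟨ω, hω, rfl⟩, h⟩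
    have hn : ‖R.symm (ω : E3)‖ = 1 := by rw [LinearIsometryEquiv.norm_map, norm_S2]
    have e : f ⟨R.symm ω, mem_sphere_zero_iff_norm.2 hn⟩ = ω := by
      apply Subtype.ext; rw [hf]; simp
    refine ⟨c, hc, _, ⟨⟨R.symm ω, mem_sphere_zero_iff_norm.2 hn⟩, by rwa [e], rfl⟩, ?_⟩
    rw [← map_smul, h]; simp

/-- The rotation by the angle `s` in the coordinate plane of the axes `a` and `b`. -/
def rotLin (a b : Fin 3) (s : ℝ) : E3 →ₗ[ℝ] E3 :=
  LinearMap.id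
    + (Real.cos s - 1) • ((EuclideanSpace.proj (𝕜 := ℝ) a).toLinearMap.smulRight
        (EuclideanSpace.single a (1 : ℝ))
      + (EuclideanSpace.proj (𝕜 := ℝ) b).toLinearMap.smulRight (EuclideanSpace.single b (1 : ℝ)))
    + Real.sin s • ((EuclideanSpace.proj (𝕜 := ℝ) a).toLinearMap.smulRight
        (EuclideanSpace.single b (1 : ℝ))
      - (EuclideanSpace.proj (𝕜 := ℝ) b).toLinearMap.smulRight (EuclideanSpace.single a (1 : ℝ)))

theorem rotLin_apply (a b : Fin 3) (s : ℝ) (x : E3) :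
    rotLin a b s x = x + (Real.cos s - 1) • (x a • EuclideanSpace.single a (1 : ℝ)
      + x b • EuclideanSpace.single b (1 : ℝ))
      + Real.sin s • (x a • EuclideanSpace.single b (1 : ℝ)
      - x b • EuclideanSpace.single a (1 : ℝ)) := by
  simp [rotLin]

def rotVel (a b : Fin 3) (s : ℝ) (x : E3) : E3 :=
  -Real.sin s • (x a • EuclideanSpace.single a (1 : ℝ) + x b • EuclideanSpace.single b (1 : ℝ))
    + Real.cos s • (x a • EuclideanSpace.single b (1 : ℝ)
      - x b • EuclideanSpace.single a (1 : ℝ))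

theorem norm_rotLin {a b : Fin 3} (hab : a ≠ b) (s : ℝ) (x : E3) : ‖rotLin a b s x‖ = ‖x‖ := by
  rw [EuclideanSpace.norm_eq, EuclideanSpace.norm_eq]
  congr 1
  have h := Real.sin_sq_add_cos_sq s
  rw [rotLin_apply]
  fin_cases a <;> fin_cases b <;> first | exact absurd rfl hab | skip
  all_goals
    simp [Fin.sum_univ_three]
  all_goals first
    | linear_combination (x 0 ^ 2 + x 1 ^ 2) * h
    | linear_combination (x 0 ^ 2 + x 2 ^ 2) * h
    | linear_combination (x 1 ^ 2 + x 2 ^ 2) * h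

/-- The action of a rotation on the sphere. -/
def rotS2 {a b : Fin 3} (hab : a ≠ b) (s : ℝ) (ω : S2) : S2 :=
  ⟨rotLin a b s ω, by rw [mem_sphere_zero_iff_norm, norm_rotLin hab, norm_S2]⟩

theorem measurePreserving_rotS2 {a b : Fin 3} (hab : a ≠ b) (s : ℝ) :
    MeasurePreserving (rotS2 hab s) sigma sigma :=
  measurePreserving_sphere
    ((⟨rotLin a b s, norm_rotLin hab s⟩ : E3 →ₗᵢ[ℝ] E3).toLinearIsometryEquiv rfl) _ fun _ => rfl

/-- Infinitesimal rotation invariance: the integral of the rotated function does not depend on the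
angle, and its derivative at angle 0 is the integral of the rotation field applied to `F`. -/
theorem avg_rot {a b : Fin 3} (hab : a ≠ b) (F : SF M t0) :
    avg (om a * DS b F - om b * DS a F) = 0 := by
  apply Subtype.ext
  funext x
  have hmem : ∀ s η, ((x.1.1.1, x.1.1.2, rotLin a b s (η : S2)) : Amb) ∈ region M t0 :=
    fun s η => incl_mem (x.1, rotS2 hab s η)
  have hconst : ∀ s : ℝ, ∫ η : S2, F.ext (x.1.1.1, x.1.1.2, rotLin a b s η) ∂sigma
      = ∫ η : S2, F.1 (x.1, η) ∂sigma := fun s => by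
    have hc : Continuous fun η => F.1 (x.1, η) :=
      ((F.continuousOn_prod.comp_continuous (by fun_prop : Continuous fun k : S2 => (x.1.1, k))
        fun _ => ⟨x.1.2, trivial⟩).congr fun η => F.ext_mk x.1.2 η)
    have h := (measurePreserving_rotS2 hab s).map_eq
    conv_rhs => rw [← h, integral_map (measurePreserving_rotS2 hab s).measurable.aemeasurable
      hc.aestronglyMeasurable]
    congr 1
    funext η
    exact F.ext_incl (x.1, rotS2 hab s η)
  have hγ : ∀ s (η : S2), HasDerivAt (fun s => ((x.1.1.1, x.1.1.2, rotLin a b s (η : S2)) : Amb))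
      (0, 0, rotVel a b s η) s := fun s η => by
    refine (hasDerivAt_const _ _).prodMk ((hasDerivAt_const _ _).prodMk ?_)
    simp only [rotLin_apply, rotVel]
    exact ((((Real.hasDerivAt_cos s).sub_const 1).smul_const _).const_add _).add
      ((Real.hasDerivAt_sin s).smul_const _)
  have hcont : Continuous fun p : ℝ × S2 =>
      ((x.1.1.1, x.1.1.2, rotLin a b p.1 (p.2 : S2)) : Amb) := by
    simp only [rotLin_apply]; fun_prop
  have hcont' : Continuous fun p : ℝ × S2 => ((0, 0, rotVel a b p.1 p.2) : Amb) := by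
    simp only [rotVel]; fun_prop
  have hder : ContinuousOn (Function.uncurry fun (s : ℝ) (η : S2) =>
      ContinuousLinearMap.toSpanSingleton ℝ (fderivWithin ℝ F.ext (region M t0)
        (x.1.1.1, x.1.1.2, rotLin a b s η) (0, 0, rotVel a b s η))) (univ ×ˢ univ) :=
    (ContinuousLinearMap.toSpanSingletonCLE (𝕜 := ℝ) (E := ℝ)).continuous.comp_continuousOn
      ((F.fderivWithin_contDiffOn.continuousOn.comp hcont.continuousOn
        fun p _ => hmem p.1 p.2).clm_apply hcont'.continuousOn)
  have h := hasFDerivWithinAt_integral_of_convex (ν := sigma) (s := univ) convex_univ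
    (f := fun s (η : S2) => F.ext (x.1.1.1, x.1.1.2, rotLin a b s η))
    (f' := fun s η => ContinuousLinearMap.toSpanSingleton ℝ (fderivWithin ℝ F.ext (region M t0)
      (x.1.1.1, x.1.1.2, rotLin a b s η) (0, 0, rotVel a b s η))) (fun s _ η => by
        have h1 := (F.differentiableOn _ (hmem s η)).hasFDerivWithinAt
        exact (h1.comp_hasDerivWithinAt s (hγ s η).hasDerivWithinAt
          fun u _ => hmem u η).hasFDerivWithinAt)
    (F.contDiffOn.continuousOn.comp hcont.continuousOn fun p _ => hmem p.1 p.2)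
    hder (mem_univ 0)
  have h0 : HasFDerivWithinAt (fun s : ℝ => ∫ η : S2,
      F.ext (x.1.1.1, x.1.1.2, rotLin a b s η) ∂sigma) (0 : ℝ →L[ℝ] ℝ) univ 0 := by
    simp only [hconst]; exact hasFDerivWithinAt_const _ _ _
  have h1 := (uniqueDiffOn_univ (𝕜 := ℝ) 0 trivial).eq h h0
  have h2 := congrArg (· (1 : ℝ)) h1
  have hpt : ∀ η : S2, (om a * DS b F - om b * DS a F).1 (x.1, η)
      = fderivWithin ℝ F.ext (region M t0)
        (x.1.1.1, x.1.1.2, rotLin a b 0 η) (0, 0, rotVel a b 0 η) := fun η => by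
    have e1 : rotLin a b 0 (η : E3) = η := by simp [rotLin_apply]
    have e2 : ((0, 0, rotVel a b 0 η) : Amb)
        = (η : E3) a • (0, 0, EuclideanSpace.single b 1)
          - (η : E3) b • (0, 0, EuclideanSpace.single a 1) := by simp [rotVel]
    rw [e1, e2, map_sub, map_smul, map_smul]
    rfl
  rw [avg_apply]
  simp only [hpt]
  rw [ContinuousLinearMap.integral_apply] at h2
  · simpa using h2
  · have hi : Continuous (fun η : S2 =>
        ContinuousLinearMap.toSpanSingleton ℝ (fderivWithin ℝ F.ext (region M t0)
          (x.1.1.1, x.1.1.2, rotLin a b 0 η) (0, 0, rotVel a b 0 η))) :=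
      hder.comp_continuous (f := fun η : S2 => ((0 : ℝ), η)) (by fun_prop)
        fun _ => ⟨trivial, trivial⟩
    exact integrable_of_continuous hi

/-- Integration by parts; the 2 is the mean curvature of the unit sphere. The difference `DS i F - 2
* (om i * F)` is a sum over j of rotation fields applied to `om j * F`, and each of these integrates
to zero by `avg_rot`. -/
theorem avg_DS (i : Fin 3) (F : SF M t0) : avg (DS i F) = 2 * avg (om i * F) := by
  have hL : ∀ j, avg (om j * DS i (om j * F) - om i * DS j (om j * F)) = 0 := fun j => by
    by_cases hj : j = i
    · subst hj; simp
    · exact avg_rot hj _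
  have h1 := om_DS F
  have h2 := om_sq (M := M) (t0 := t0)
  have key : DS i F - 2 * (om i * F)
      = ∑ j, (om j * DS i (om j * F) - om i * DS j (om j * F)) := by
    simp only [Derivation.leibniz, smul_eq_mul, DS_om, Fin.sum_univ_three] at *
    fin_cases i <;> simp <;> linear_combination (-(DS _ F)) * h2 + om _ * h1
  have h3 := congrArg avg key
  rw [map_sum, Finset.sum_eq_zero fun j _ => hL j, map_sub, sub_eq_zero] at h3
  rw [h3, two_mul, two_mul, map_add]

end LinGrav
end

noncomputable section
namespace LinGrav
open Set Filter Topology MeasureTheory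

variable {M t0 : ℝ}

/-! ### The energy argument in `1 + 1` dimensions -/

theorem hasDerivWithinAt_intervalIntegral {s : Set ℝ} (hs : Convex ℝ s) {a b : ℝ} (hab : a ≤ b)
    {g g' : ℝ → ℝ → ℝ} (hg : ∀ t ∈ s, ∀ r ∈ Icc a b, HasDerivWithinAt (fun u => g u r) (g' t r) s t)
    (hgc : ContinuousOn (Function.uncurry g) (s ×ˢ Icc a b))
    (hgc' : ContinuousOn (Function.uncurry g') (s ×ˢ Icc a b)) {t : ℝ} (ht : t ∈ s) :
    HasDerivWithinAt (fun u => ∫ r in a..b, g u r) (∫ r in a..b, g' t r) s t := by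
  have key : ∀ f : ℝ → ℝ, ∫ r in a..b, f r
      = ∫ r : Icc a b, f r ∂(Measure.comap Subtype.val volume) := fun f => by
    rw [intervalIntegral.integral_of_le hab, ← integral_Icc_eq_integral_Ioc,
      integral_subtype_comap measurableSet_Icc]
  have : IsFiniteMeasure (Measure.comap (Subtype.val : Icc a b → ℝ) volume) := by
    refine ⟨?_⟩
    rw [comap_subtype_coe_apply measurableSet_Icc, image_univ, Subtype.range_coe]
    exact measure_Icc_lt_top
  have hmaps : Continuous fun p : ℝ × Icc a b => (p.1, (p.2 : ℝ)) := by fun_prop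
  have hc' : ContinuousOn (Function.uncurry fun (u : ℝ) (r : Icc a b) =>
      ContinuousLinearMap.toSpanSingleton ℝ (g' u r)) (s ×ˢ univ) :=
    (ContinuousLinearMap.toSpanSingletonCLE (𝕜 := ℝ) (E := ℝ)).continuous.comp_continuousOn
      (hgc'.comp hmaps.continuousOn fun p hp => ⟨hp.1, p.2.2⟩)
  have h := hasFDerivWithinAt_integral_of_convex
    (ν := Measure.comap (Subtype.val : Icc a b → ℝ) volume) hs
    (f := fun u (r : Icc a b) => g u r)
    (f' := fun u (r : Icc a b) => ContinuousLinearMap.toSpanSingleton ℝ (g' u r))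
    (fun u hu r => (hg u hu r r.2).hasFDerivWithinAt)
    (hgc.comp hmaps.continuousOn fun p hp => ⟨hp.1, p.2.2⟩) hc' ht
  have h2 := h.hasDerivWithinAt
  have hi : Continuous fun r : Icc a b => ContinuousLinearMap.toSpanSingleton ℝ (g' t r) :=
    hc'.comp_continuous (f := fun r : Icc a b => (t, r)) (by fun_prop) fun _ => ⟨ht, trivial⟩
  rw [ContinuousLinearMap.integral_apply (integrable_of_continuous hi)] at h2
  simp only [key]
  simpa using h2

/-- Grönwall's inequality, by monotonicity of W multiplied by the integrating factor exp(-Ct). -/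
theorem nonpos_of_deriv_le {t1 C : ℝ} {W W' : ℝ → ℝ}
    (hW : ∀ t, t0 ≤ t → HasDerivWithinAt W (W' t) (Ici t0) t)
    (h : ∀ t, t0 ≤ t → t ≤ t1 → W' t ≤ C * W t) (h0 : W t0 ≤ 0) (ht1 : t0 ≤ t1) : W t1 ≤ 0 := by
  have hd : ∀ t, t0 ≤ t → HasDerivWithinAt (fun t => Real.exp (-(C * t)) * W t)
      (Real.exp (-(C * t)) * (W' t - C * W t)) (Ici t0) t := fun t ht => by
    have h1 : HasDerivAt (fun t : ℝ => Real.exp (-(C * t))) (Real.exp (-(C * t)) * (-(C * 1))) t :=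
      ((hasDerivAt_id t).const_mul C).neg.exp
    refine (h1.hasDerivWithinAt.mul (hW t ht)).congr_deriv ?_
    ring
  have ha : AntitoneOn (fun t => Real.exp (-(C * t)) * W t) (Icc t0 t1) := by
    refine antitoneOn_of_hasDerivWithinAt_nonpos (convex_Icc _ _)
      (f' := fun t => Real.exp (-(C * t)) * (W' t - C * W t))
      (fun t ht => ((hd t ht.1).mono Icc_subset_Ici_self).continuousWithinAt) (fun t ht => ?_)
      fun t ht => ?_
    · rw [interior_Icc] at ht ⊢
      exact (hd t ht.1.le).mono fun u hu => hu.1.le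
    · rw [interior_Icc] at ht
      exact mul_nonpos_of_nonneg_of_nonpos (Real.exp_pos _).le
        (sub_nonpos.2 (h t ht.1.le ht.2.le))
  have h1 := ha ⟨le_rfl, ht1⟩ ⟨ht1, le_rfl⟩ ht1
  simp only at h1
  have h2 : Real.exp (-(C * t0)) * W t0 ≤ 0 :=
    mul_nonpos_of_nonneg_of_nonpos (Real.exp_pos _).le h0
  exact nonpos_of_mul_nonpos_right (h1.trans h2) (Real.exp_pos _)

/-- The square of the positive part serves as cutoff: it is continuously differentiable, as
differentiation under the integral requires. -/
theorem hasDerivAt_max_sq (x : ℝ) : HasDerivAt (fun s : ℝ => max s 0 ^ 2) (2 * max x 0) x := by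
  rcases lt_trichotomy x 0 with h | h | h
  · have : (fun s : ℝ => max s 0 ^ 2) =ᶠ[𝓝 x] fun _ => 0 := by
      filter_upwards [Iio_mem_nhds h] with s hs
      simp [max_eq_right (le_of_lt (mem_Iio.1 hs))]
    rw [max_eq_right h.le, mul_zero]
    exact (hasDerivAt_const x (0 : ℝ)).congr_of_eventuallyEq this
  · subst h
    rw [hasDerivAt_iff_isLittleO]
    simp only [max_self, mul_zero, ne_eq, OfNat.ofNat_ne_zero, not_false_eq_true, zero_pow,
      sub_zero, smul_zero]
    refine Asymptotics.IsBigO.trans_isLittleO (g := fun s : ℝ => s ^ 2) ?_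
      (by simpa using Asymptotics.isLittleO_pow_id (𝕜 := ℝ) one_lt_two)
    refine Asymptotics.IsBigO.of_bound 1 (Eventually.of_forall fun s => ?_)
    rw [norm_pow, norm_pow, one_mul]
    refine pow_le_pow_left₀ (norm_nonneg _) ?_ 2
    rcases le_total s 0 with h | h
    · rw [max_eq_right h, norm_zero]; exact norm_nonneg s
    · rw [max_eq_left h]
  · have : (fun s : ℝ => max s 0 ^ 2) =ᶠ[𝓝 x] fun s => s ^ 2 := by
      filter_upwards [Ioi_mem_nhds h] with s hs
      rw [max_eq_left (le_of_lt (mem_Ioi.1 hs))]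
    rw [max_eq_left h.le]
    simpa using (hasDerivAt_pow 2 x).congr_of_eventuallyEq this

theorem SF.continuousOn_slice (F : SF M t0) (w : S2) :
    ContinuousOn (fun p : ℝ × ℝ => F.ext (p.1, p.2, (w : E3))) (Ici t0 ×ˢ Ici (2 * M)) :=
  F.continuousOn_prod.comp (f := fun p : ℝ × ℝ => (p, w)) (by fun_prop) fun _ hp => ⟨hp, trivial⟩

/-- Vanishing of an energy density `E` whose flux `F` has the right sign at the horizon and through
the ingoing null cones. -/
theorem energy_eq_zero (E F : SF M t0) (w : S2)
    (hE : ∀ b, 0 ≤ E.1 (b, w)) (hEF : ∀ b, 0 ≤ E.1 (b, w) + F.1 (b, w))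
    (hF : ∀ b, b.1.2 = 2 * M → F.1 (b, w) ≤ 0) (h0 : ∀ b, b.1.1 = t0 → E.1 (b, w) = 0)
    (hC : ∀ T R, ∃ C, ∀ b, b.1.1 ≤ T → b.1.2 ≤ R →
      (Dt E + Dr F).1 (b, w) ≤ C * E.1 (b, w)) (b) : E.1 (b, w) = 0 := by
  obtain ⟨⟨t1, r1⟩, ht1 : t0 ≤ t1, hr1 : 2 * M ≤ r1⟩ := b
  -- The weight `c` is the positive part of R - t - r. It vanishes beyond an ingoing null line,
  -- equals 1 at (t1, r1), and `B` is chosen so that it vanishes at r = B for every t ≥ t0.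
  set R := t1 + r1 + 1 with hR
  set B := R - t0 with hB
  have hMB : 2 * M < B := by linarith
  obtain ⟨C, hC⟩ := hC t1 B
  let c : ℝ → ℝ → ℝ := fun t r => max (R - t - r) 0
  let e : SF M t0 → ℝ → ℝ → ℝ := fun G t r => G.ext (t, r, (w : E3))
  have hcc : Continuous (fun p : ℝ × ℝ => c p.1 p.2) := by fun_prop
  have hec : ∀ G : SF M t0, ContinuousOn (fun p : ℝ × ℝ => e G p.1 p.2) (Ici t0 ×ˢ Icc (2 * M) B) :=
    fun G => (G.continuousOn_slice w).mono (prod_mono le_rfl Icc_subset_Ici_self)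
  have hecr : ∀ (G : SF M t0) t, t0 ≤ t → ContinuousOn (e G t) (Icc (2 * M) B) := fun G t ht =>
    (hec G).comp (f := fun r => (t, r)) (by fun_prop) fun r hr => ⟨ht, hr⟩
  have hcr : ∀ t, Continuous (c t) := fun t => by fun_prop
  let W : ℝ → ℝ := fun t => ∫ r in (2 * M)..B, c t r ^ 2 * e E t r
  let W' : ℝ → ℝ := fun t => ∫ r in (2 * M)..B, (-(2 * c t r) * e E t r + c t r ^ 2 * e (Dt E) t r)
  have hW : ∀ t, t0 ≤ t → HasDerivWithinAt W (W' t) (Ici t0) t := fun t ht => by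
    refine hasDerivWithinAt_intervalIntegral (convex_Ici t0) hMB.le
      (g := fun t r => c t r ^ 2 * e E t r)
      (g' := fun t r => -(2 * c t r) * e E t r + c t r ^ 2 * e (Dt E) t r) ?_ ?_ ?_ ht
    · intro t ht r hr
      have h1 : HasDerivAt (fun t => c t r ^ 2) (2 * c t r * (0 - 1 - 0)) t :=
        (hasDerivAt_max_sq (R - t - r)).comp t (h := fun t => R - t - r)
          (((hasDerivAt_const t R).sub (hasDerivAt_id t)).sub (hasDerivAt_const t r))
      have hd : DPlus M t0 t r := ⟨ht, hr.1⟩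
      have h2 := E.hasDerivWithinAt_t hd w
      rw [← SF.ext_mk (Dt E)] at h2
      refine (h1.hasDerivWithinAt.mul h2).congr_deriv ?_
      simp only [e]
      ring
    · exact (hcc.continuousOn.pow 2).mul (hec E)
    · exact (((continuousOn_const.mul hcc.continuousOn).neg).mul (hec E)).add
        ((hcc.continuousOn.pow 2).mul (hec (Dt E)))
  have hle : ∀ t, t0 ≤ t → t ≤ t1 → W' t ≤ C * W t := fun t ht htt => by
    -- The integrand is the r-derivative of c²F. The boundary term at `B` vanishes with the weight
    -- and the one at the horizon has a good sign, so adding this integral can only increase `W'`.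
    have hbp : ∫ r in (2 * M)..B, (-(2 * c t r) * e F t r + c t r ^ 2 * e (Dr F) t r)
        = c t B ^ 2 * e F t B - c t (2 * M) ^ 2 * e F t (2 * M) := by
      refine intervalIntegral.integral_eq_sub_of_hasDerivAt_of_le hMB.le
        (f := fun r => c t r ^ 2 * e F t r) (((hcr t).continuousOn.pow 2).mul (hecr F t ht)) ?_ ?_
      · intro r hr
        have h1 : HasDerivAt (fun r => c t r ^ 2) (2 * c t r * (0 - 1)) r :=
          (hasDerivAt_max_sq (R - t - r)).comp r (h := fun r => R - t - r)
            ((hasDerivAt_const r (R - t)).sub (hasDerivAt_id r))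
        have hd : DPlus M t0 t r := ⟨ht, hr.1.le⟩
        have h2 := (F.hasDerivWithinAt_r hd w).hasDerivAt (Ici_mem_nhds hr.1)
        rw [← SF.ext_mk (Dr F)] at h2
        refine (h1.mul h2).congr_deriv ?_
        simp only [e]
        ring
      · refine ContinuousOn.intervalIntegrable_of_Icc hMB.le ?_
        exact (((continuousOn_const.mul (hcr t).continuousOn).neg).mul (hecr F t ht)).add
          (((hcr t).continuousOn.pow 2).mul (hecr (Dr F) t ht))
    have hcB : c t B = 0 := max_eq_right (by rw [hB]; linarith)
    have hFM : e F t (2 * M) ≤ 0 := by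
      have := hF ⟨(t, 2 * M), ht, le_rfl⟩ rfl
      simp only [e]; rwa [SF.ext_mk F ⟨ht, le_rfl⟩]
    have hnn : 0 ≤ ∫ r in (2 * M)..B, (-(2 * c t r) * e F t r + c t r ^ 2 * e (Dr F) t r) := by
      rw [hbp, hcB]
      nlinarith [sq_nonneg (c t (2 * M))]
    have hi : ∀ G H : SF M t0, IntervalIntegrable
        (fun r => -(2 * c t r) * e G t r + c t r ^ 2 * e H t r) volume (2 * M) B := fun G H =>
      ContinuousOn.intervalIntegrable_of_Icc hMB.le
        ((((continuousOn_const.mul (hcr t).continuousOn).neg).mul (hecr G t ht)).add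
          (((hcr t).continuousOn.pow 2).mul (hecr H t ht)))
    calc W' t ≤ W' t + ∫ r in (2 * M)..B, (-(2 * c t r) * e F t r + c t r ^ 2 * e (Dr F) t r) :=
          le_add_of_nonneg_right hnn
      _ = ∫ r in (2 * M)..B, ((-(2 * c t r) * e E t r + c t r ^ 2 * e (Dt E) t r)
            + (-(2 * c t r) * e F t r + c t r ^ 2 * e (Dr F) t r)) :=
          (intervalIntegral.integral_add (hi _ _) (hi _ _)).symm
      _ ≤ ∫ r in (2 * M)..B, C * (c t r ^ 2 * e E t r) := by
          refine intervalIntegral.integral_mono_on hMB.le ((hi _ _).add (hi _ _)) ?_ ?_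
          · exact ContinuousOn.intervalIntegrable_of_Icc hMB.le
              (continuousOn_const.mul (((hcr t).continuousOn.pow 2).mul (hecr E t ht)))
          · intro r hr
            have hd : DPlus M t0 t r := ⟨ht, hr.1⟩
            have h1 := hC ⟨(t, r), hd⟩ htt hr.2
            have h2 := hEF ⟨(t, r), hd⟩
            have h3 : (Dt E + Dr F).1 (⟨(t, r), hd⟩, w) = e (Dt E) t r + e (Dr F) t r := by
              simp only [e]; rw [SF.ext_mk _ hd, SF.ext_mk _ hd]; rfl
            rw [h3, ← SF.ext_mk E] at h1
            rw [← SF.ext_mk E, ← SF.ext_mk F] at h2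
            have h4 : 0 ≤ c t r := le_max_right _ _
            have h5 : 0 ≤ e E t r + e F t r := h2
            have h6 : e (Dt E) t r + e (Dr F) t r ≤ C * e E t r := h1
            -- The derivatives of the weight combine to -2c(E + F), which is nonpositive: this is
            -- the flux through the ingoing cones. The c² terms are bounded by the hypothesis on the
            -- divergence.
            nlinarith [mul_nonneg h4 h5, mul_le_mul_of_nonneg_left h6 (sq_nonneg (c t r))]
      _ = C * W t := intervalIntegral.integral_const_mul _ _
  have hW0 : W t0 ≤ 0 := by
    have : W t0 = ∫ r in (2 * M)..B, (0 : ℝ) := by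
      refine intervalIntegral.integral_congr fun r hr => ?_
      rw [uIcc_of_le hMB.le] at hr
      have hd : DPlus M t0 t0 r := ⟨le_rfl, hr.1⟩
      have := h0 ⟨(t0, r), hd⟩ rfl
      rw [← SF.ext_mk E] at this
      simp only [e, this, mul_zero]
    rw [this]; simp
  have hfin := nonpos_of_deriv_le hW hle hW0 ht1
  -- The weight is positive at (t1, r1), so a positive energy density there would make the weighted
  -- integral positive.
  by_contra hne
  have hpos : 0 < E.1 (⟨(t1, r1), ht1, hr1⟩, w) := lt_of_le_of_ne (hE _) (Ne.symm hne)
  have hWp : 0 < W t1 := by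
    refine intervalIntegral.integral_pos hMB
      (((hcr t1).continuousOn.pow 2).mul (hecr E t1 ht1)) (fun r hr => ?_)
      ⟨r1, ⟨hr1, by rw [hB]; linarith⟩, ?_⟩
    · refine mul_nonneg (sq_nonneg _) ?_
      have := hE ⟨(t1, r), ht1, hr.1.le⟩
      simp only [e]; rwa [SF.ext_mk E ⟨ht1, hr.1.le⟩]
    · refine mul_pos (pow_pos (lt_max_of_lt_left (by rw [hR]; linarith)) 2) ?_
      simp only [e]; rwa [SF.ext_mk E ⟨ht1, hr1⟩]
  exact absurd hfin (not_le.2 hWp)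

end LinGrav
end

noncomputable section
namespace LinGrav
open Set Filter Topology MeasureTheory

variable {M t0 : ℝ}

/-! ### Uniqueness for systems of wave equations with first order coupling -/

/-- Functions vanishing on the initial hypersurface. -/
def ZeroOnSigma (F : SF M t0) : Prop := ∀ x : Pt M t0, x.1.1.1 = t0 → F.1 x = 0

/-- The directions of r and of the spheres are tangent to Σ, so the whole first jet vanishes on Σ
once the function and its `Dt` derivative do. -/
theorem ZeroOnSigma.Dr {F : SF M t0} (hF : ZeroOnSigma F) : ZeroOnSigma (Dr F) := by
  rintro ⟨⟨⟨t, r⟩, h⟩, w⟩ ht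
  have ht : t = t0 := ht
  subst ht
  have h1 := F.hasDerivWithinAt_r h w
  have h2 : HasDerivWithinAt (fun s => F.ext (t, s, (w : E3))) 0 (Ici (2 * M)) r := by
    refine (hasDerivWithinAt_const r (Ici (2 * M)) (0 : ℝ)).congr (fun s hs => ?_) ?_
    · rw [F.ext_mk ⟨le_rfl, hs⟩]; exact hF _ rfl
    · rw [F.ext_mk h]; exact hF _ rfl
  exact UniqueDiffWithinAt.eq_deriv _ (uniqueDiffOn_Ici _ r h.2) h1 h2

theorem ZeroOnSigma.DS {F : SF M t0} (hF : ZeroOnSigma F) (i : Fin 3) : ZeroOnSigma (DS i F) := by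
  rintro ⟨⟨⟨t, r⟩, h⟩, w⟩ ht
  have ht : t = t0 := ht
  subst ht
  have h1 := F.hasFDerivAt_sphere h w
  have h2 : HasFDerivAt (fun y : E3 => F.ext (t, r, y)) (0 : E3 →L[ℝ] ℝ) (w : E3) := by
    refine (hasFDerivAt_const (0 : ℝ) (w : E3)).congr_of_eventuallyEq ?_
    filter_upwards with y
    refine hF _ ?_
    simp [retract]
  have := congrArg (· (EuclideanSpace.single i (1 : ℝ))) (h1.unique h2)
  exact this

theorem SF.exists_bound (F : SF M t0) (T R : ℝ) :
    ∃ C, ∀ x : Pt M t0, x.1.1.1 ≤ T → x.1.1.2 ≤ R → |F.1 x| ≤ C := by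
  obtain ⟨C, hC⟩ := ((isCompact_Icc (a := t0) (b := T)).prod
    (isCompact_Icc (a := 2 * M) (b := R)) |>.prod isCompact_univ).exists_bound_of_continuousOn
    (F.continuousOn_prod.mono (prod_mono (prod_mono Icc_subset_Ici_self Icc_subset_Ici_self) le_rfl))
  refine ⟨C, fun x hT hR => ?_⟩
  have := hC (x.1.1, x.2) ⟨⟨⟨x.1.2.1, hT⟩, ⟨x.1.2.2, hR⟩⟩, trivial⟩
  rw [← F.ext_incl x]
  exact this

theorem SF.continuous_slice (F : SF M t0) (b) : Continuous fun w : S2 => F.1 (b, w) :=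
  (F.continuousOn_prod.comp_continuous (by fun_prop : Continuous fun k : S2 => (b.1, k))
    fun _ => ⟨b.2, trivial⟩).congr fun w => F.ext_mk b.2 w

theorem SF.integrable_slice (F : SF M t0) (b) : Integrable (fun w : S2 => F.1 (b, w)) sigma :=
  integrable_of_continuous (F.continuous_slice b)

theorem avg_nonneg {F : SF M t0} {b} (h : ∀ w, 0 ≤ F.1 (b, w)) (w : S2) : 0 ≤ (avg F).1 (b, w) :=
  integral_nonneg h

theorem avg_mono {F G : SF M t0} {b} (h : ∀ w, F.1 (b, w) ≤ G.1 (b, w)) (w : S2) :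
    (avg F).1 (b, w) ≤ (avg G).1 (b, w) :=
  integral_mono (F.integrable_slice b) (G.integrable_slice b) h

instance : Measure.IsOpenPosMeasure sigma := by unfold sigma; infer_instance

/-- A continuous nonnegative function with zero integral vanishes, because the surface measure
charges every nonempty open set. -/
theorem eq_zero_of_avg_eq_zero {F : SF M t0} {b} (h : ∀ w, 0 ≤ F.1 (b, w)) {w : S2}
    (h0 : (avg F).1 (b, w) = 0) (w') : F.1 (b, w') = 0 := by
  have h1 := (integral_eq_zero_iff_of_nonneg h (F.integrable_slice b)).1 h0
  have h2 := (F.continuous_slice b).ae_eq_iff_eq sigma continuous_const |>.1 h1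
  exact congrFun h2 w'

variable [hM : Fact (0 < M)]

variable (M t0) in
/-- The mass function `μ = 2 M / r`. -/
def mus : SF M t0 := (2 * M) • rho M t0

theorem Dt_mus : Dt (mus M t0) = 0 := by rw [mus, Derivation.map_smul, Dt_rho, smul_zero]
theorem DS_mus (i : Fin 3) : DS i (mus M t0) = 0 := by
  rw [mus, Derivation.map_smul, DS_rho, smul_zero]
theorem Dr_mus : Dr (mus M t0) = -(mus M t0 * rho M t0) := by
  rw [mus, Derivation.map_smul, Dr_rho, smul_neg, smul_mul_assoc]

/-- The Laplacian of the unit sphere. -/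
def lapl (F : SF M t0) : SF M t0 := ∑ i, DS i (DS i F)

/-- The principal part of the wave operator. -/
def wave (F : SF M t0) : SF M t0 :=
  -(1 + mus M t0) * Dt (Dt F) + 2 * mus M t0 * Dt (Dr F) + (1 - mus M t0) * Dr (Dr F)
    + rho M t0 ^ 2 * lapl F

def jet (F : SF M t0) : Fin 6 → SF M t0 := ![F, Dt F, Dr F, DS 0 F, DS 1 F, DS 2 F]

/-- The ideal generated by the first jets of a family of functions. -/
def jetIdeal {ι : Type*} (φ : ι → SF M t0) : Ideal (SF M t0) :=
  Ideal.span (range fun p : ι × Fin 6 => jet (φ p.1) p.2)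

section jetIdeal
variable {ι : Type*} (φ : ι → SF M t0) (I : ι)

theorem jet_mem (n : Fin 6) : jet (φ I) n ∈ jetIdeal φ := Ideal.subset_span ⟨(I, n), rfl⟩
theorem self_mem : φ I ∈ jetIdeal φ := jet_mem φ I 0
theorem Dt_mem : Dt (φ I) ∈ jetIdeal φ := jet_mem φ I 1
theorem Dr_mem : Dr (φ I) ∈ jetIdeal φ := jet_mem φ I 2
theorem DS_mem (k : Fin 3) : DS k (φ I) ∈ jetIdeal φ := by
  fin_cases k
  · exact jet_mem φ I 3
  · exact jet_mem φ I 4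
  · exact jet_mem φ I 5

end jetIdeal

/-- This and `outDer` are derivatives along null vectors, regular up to the horizon, with inner
product -2. At μ = 1 the outgoing one is tangent to the horizon. -/
def inDer (F : SF M t0) : SF M t0 := Dt F - Dr F
def outDer (F : SF M t0) : SF M t0 := (1 + mus M t0) * Dt F + (1 - mus M t0) * Dr F
def gradSq (F : SF M t0) : SF M t0 := ∑ i, DS i F ^ 2

/-- The energy density on the slices for the timelike multiplier `inDer + outDer`. The term F² is
added so that the function itself is controlled as well as its derivatives. -/
def enDens (F : SF M t0) : SF M t0 :=
  (1 + mus M t0) * inDer F ^ 2 + outDer F ^ 2 + (2 + mus M t0) * rho M t0 ^ 2 * gradSq F + F ^ 2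

/-- The matching radial flux. At μ = 1 only nonpositive terms remain, and in the sum with `enDens`
the outgoing derivative cancels, leaving squares. -/
def enFlux (F : SF M t0) : SF M t0 :=
  (1 - mus M t0) * inDer F ^ 2 - outDer F ^ 2 - mus M t0 * rho M t0 ^ 2 * gradSq F

theorem der_two (D : Derivation ℝ (SF M t0) (SF M t0)) : D 2 = 0 := by
  exact_mod_cast D.map_natCast 2

/-- The multiplier identity: the wave operator times `inDer F + outDer F` is a space-time divergence
up to terms quadratic in the first jet. Those terms come from the r-dependence of the coefficients
and from the added F². -/
theorem energy_identity (F : SF M t0) :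
    Dt (enDens F) + Dr (enFlux F)
      = 2 * (rho M t0 ^ 2 * ∑ i, DS i ((inDer F + outDer F) * DS i F))
        - 2 * (inDer F + outDer F) * wave F
        + (2 * (F * Dt F) + 2 * (mus M t0 * rho M t0) * (inDer F * outDer F)
          + mus M t0 * rho M t0 * (inDer F * inDer F)
          + 3 * (mus M t0 * rho M t0 ^ 3) * ∑ i, DS i F * DS i F) := by
  simp only [enDens, enFlux, inDer, outDer, gradSq, wave, lapl, Fin.sum_univ_three, map_add,
    map_sub,
    Derivation.leibniz, Derivation.leibniz_pow, smul_eq_mul, Dt_mus, Dr_mus, DS_mus, Dt_rho, Dr_rho,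
    Dt_Dr, Dt_DS, Dr_DS, Derivation.map_one_eq_zero, nsmul_eq_mul, Nat.cast_ofNat, der_two]
  ring

end LinGrav
end

noncomputable section
namespace LinGrav
open Set Filter Topology MeasureTheory

variable {M t0 : ℝ} [hM : Fact (0 < M)]

/-! ### Pointwise energy bounds and the uniqueness theorem. -/

theorem rho_apply (x : Pt M t0) : (rho M t0).1 x = (x.1.1.2)⁻¹ := rfl

theorem mus_apply (x : Pt M t0) : (mus M t0).1 x = 2 * M * (x.1.1.2)⁻¹ := rfl

theorem mus_bounds (x : Pt M t0) : 0 ≤ (mus M t0).1 x ∧ (mus M t0).1 x ≤ 1 := by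
  have hr := r_pos x.1.2.2
  have h := x.1.2.2
  have := hM.out
  rw [mus_apply]
  constructor
  · positivity
  · rw [← div_eq_mul_inv, div_le_one hr]; exact h

theorem enDens_apply (F : SF M t0) (x : Pt M t0) :
    (enDens F).1 x = (1 + (mus M t0).1 x) * ((Dt F).1 x - (Dr F).1 x) ^ 2
      + ((1 + (mus M t0).1 x) * (Dt F).1 x + (1 - (mus M t0).1 x) * (Dr F).1 x) ^ 2
      + (2 + (mus M t0).1 x) * (rho M t0).1 x ^ 2
        * ((DS 0 F).1 x ^ 2 + (DS 1 F).1 x ^ 2 + (DS 2 F).1 x ^ 2) + F.1 x ^ 2 := by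
  simp only [enDens, inDer, outDer, gradSq, Fin.sum_univ_three]
  rfl

theorem enFlux_apply (F : SF M t0) (x : Pt M t0) :
    (enFlux F).1 x = (1 - (mus M t0).1 x) * ((Dt F).1 x - (Dr F).1 x) ^ 2
      - ((1 + (mus M t0).1 x) * (Dt F).1 x + (1 - (mus M t0).1 x) * (Dr F).1 x) ^ 2
      - (mus M t0).1 x * (rho M t0).1 x ^ 2
        * ((DS 0 F).1 x ^ 2 + (DS 1 F).1 x ^ 2 + (DS 2 F).1 x ^ 2) := by
  simp only [enFlux, inDer, outDer, gradSq, Fin.sum_univ_three]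
  rfl

theorem enDens_nonneg (F : SF M t0) (x : Pt M t0) : 0 ≤ (enDens F).1 x := by
  have := (mus_bounds x).1
  rw [enDens_apply]
  positivity

theorem enDens_add_enFlux_nonneg (F : SF M t0) (x : Pt M t0) :
    0 ≤ (enDens F).1 x + (enFlux F).1 x := by
  have : (enDens F).1 x + (enFlux F).1 x = 2 * ((Dt F).1 x - (Dr F).1 x) ^ 2
      + 2 * (rho M t0).1 x ^ 2
        * ((DS 0 F).1 x ^ 2 + (DS 1 F).1 x ^ 2 + (DS 2 F).1 x ^ 2) + F.1 x ^ 2 := by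
    rw [enDens_apply, enFlux_apply]; ring
  rw [this]
  positivity

theorem enFlux_nonpos (F : SF M t0) (x : Pt M t0) (hx : x.1.1.2 = 2 * M) :
    (enFlux F).1 x ≤ 0 := by
  have h1 : (mus M t0).1 x = 1 := by
    rw [mus_apply, hx]
    have := hM.out
    field_simp
  rw [enFlux_apply, h1]
  have h2 : 0 ≤ (rho M t0).1 x ^ 2
        * ((DS 0 F).1 x ^ 2 + (DS 1 F).1 x ^ 2 + (DS 2 F).1 x ^ 2) := by positivity
  nlinarith [sq_nonneg ((Dt F).1 x)]

/-- The null decomposition is inverted with coefficients bounded uniformly for m in [0, 1], so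
control of both derivatives does not degenerate at the horizon m = 1. -/
theorem sq_le_of_null_components {m a b : ℝ} (h0 : 0 ≤ m) (h1 : m ≤ 1) :
    a ^ 2 ≤ 4 * ((1 + m) * (a - b) ^ 2 + ((1 + m) * a + (1 - m) * b) ^ 2) ∧
    b ^ 2 ≤ 4 * ((1 + m) * (a - b) ^ 2 + ((1 + m) * a + (1 - m) * b) ^ 2) := by
  obtain ⟨u, hu⟩ : ∃ u, u = a - b := ⟨_, rfl⟩
  obtain ⟨v, hv⟩ : ∃ v, v = (1 + m) * a + (1 - m) * b := ⟨_, rfl⟩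
  have ha : a = (v + (1 - m) * u) / 2 := by rw [hu, hv]; ring
  have hb : b = (v - (1 + m) * u) / 2 := by rw [hu, hv]; ring
  rw [← hu, ← hv]
  have h3 : 0 ≤ m * u ^ 2 := by positivity
  have h4 : ((1 - m) * u) ^ 2 ≤ u ^ 2 := by
    rw [mul_pow]
    exact mul_le_of_le_one_left (sq_nonneg _) (by nlinarith)
  have h5 : ((1 + m) * u) ^ 2 ≤ 4 * u ^ 2 := by
    rw [mul_pow]
    exact mul_le_mul_of_nonneg_right (by nlinarith) (sq_nonneg _)
  constructor
  · rw [ha]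
    linarith [sq_nonneg (v - (1 - m) * u), sq_nonneg u, sq_nonneg v,
      (by ring : ((v + (1 - m) * u) / 2) ^ 2
        = (v ^ 2 + ((1 - m) * u) ^ 2) / 2 - (v - (1 - m) * u) ^ 2 / 4),
      (by ring : (1 + m) * u ^ 2 = u ^ 2 + m * u ^ 2)]
  · rw [hb]
    linarith [sq_nonneg (v + (1 + m) * u), sq_nonneg u, sq_nonneg v,
      (by ring : ((v - (1 + m) * u) / 2) ^ 2
        = (v ^ 2 + ((1 + m) * u) ^ 2) / 2 - (v + (1 + m) * u) ^ 2 / 4),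
      (by ring : (1 + m) * u ^ 2 = u ^ 2 + m * u ^ 2)]

/-- The constant 4 comes from the null components. The R² is due to the sphere derivatives, which
carry the weight 1/r² in the energy. -/
theorem jet_sq_le (F : SF M t0) (n : Fin 6) (R : ℝ) (x : Pt M t0) (hR : x.1.1.2 ≤ R) :
    (jet F n).1 x ^ 2 ≤ (4 + R ^ 2) * (enDens F).1 x := by
  have hr := r_pos x.1.2.2
  obtain ⟨h0, h1⟩ := mus_bounds x
  have hrho : 1 ≤ R ^ 2 * (rho M t0).1 x ^ 2 := by
    rw [rho_apply, ← mul_pow, ← div_eq_mul_inv]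
    exact one_le_pow₀ ((one_le_div hr).2 hR)
  have hen := enDens_apply F x
  have he0 := enDens_nonneg F x
  obtain ⟨ha, hb⟩ := sq_le_of_null_components (a := (Dt F).1 x) (b := (Dr F).1 x) h0 h1
  have hp0 := sq_nonneg (F.1 x)
  have hp1 := sq_nonneg ((DS 0 F).1 x)
  have hp2 := sq_nonneg ((DS 1 F).1 x)
  have hp3 := sq_nonneg ((DS 2 F).1 x)
  have hx : ∀ n, (jet F n).1 x = ![F.1 x, (Dt F).1 x, (Dr F).1 x, (DS 0 F).1 x, (DS 1 F).1 x,
      (DS 2 F).1 x] n := fun n => by fin_cases n <;> rfl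
  rw [hx]
  generalize (mus M t0).1 x = m at *
  generalize (rho M t0).1 x = ρ at *
  generalize (enDens F).1 x = e at *
  generalize F.1 x = f at *
  generalize (Dt F).1 x = a at *
  generalize (Dr F).1 x = b at *
  generalize (DS 0 F).1 x = g0 at *
  generalize (DS 1 F).1 x = g1 at *
  generalize (DS 2 F).1 x = g2 at *
  have hN : 0 ≤ (1 + m) * (a - b) ^ 2 + ((1 + m) * a + (1 - m) * b) ^ 2 := by positivity
  have hG : 0 ≤ (1 + m) * (ρ ^ 2 * (g0 ^ 2 + g1 ^ 2 + g2 ^ 2)) := by positivity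
  have hG' : 0 ≤ ρ ^ 2 * (g0 ^ 2 + g1 ^ 2 + g2 ^ 2) := by positivity
  have hsplit : (2 + m) * ρ ^ 2 * (g0 ^ 2 + g1 ^ 2 + g2 ^ 2)
      = (1 + m) * (ρ ^ 2 * (g0 ^ 2 + g1 ^ 2 + g2 ^ 2)) + ρ ^ 2 * (g0 ^ 2 + g1 ^ 2 + g2 ^ 2) := by
    ring
  have hgr : g0 ^ 2 + g1 ^ 2 + g2 ^ 2 ≤ R ^ 2 * e := by
    calc g0 ^ 2 + g1 ^ 2 + g2 ^ 2 ≤ (R ^ 2 * ρ ^ 2) * (g0 ^ 2 + g1 ^ 2 + g2 ^ 2) :=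
          le_mul_of_one_le_left (by positivity) hrho
      _ = R ^ 2 * (ρ ^ 2 * (g0 ^ 2 + g1 ^ 2 + g2 ^ 2)) := by ring
      _ ≤ R ^ 2 * e := by gcongr; linarith
  have hRe : 0 ≤ R ^ 2 * e := by positivity
  rw [add_mul]
  fin_cases n <;> simp <;> linarith

section
variable {ι : Type*} [Fintype ι] (φ : ι → SF M t0)

def enTot : SF M t0 := ∑ I, enDens (φ I)

theorem enTot_apply (x : Pt M t0) : (enTot φ).1 x = ∑ I, (enDens (φ I)).1 x := by
  simp [enTot]

theorem enTot_nonneg (x : Pt M t0) : 0 ≤ (enTot φ).1 x := by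
  rw [enTot_apply]; exact Finset.sum_nonneg fun I _ => enDens_nonneg _ x

variable {φ}

/-- The bound holds for the generators and survives sums and smooth coefficients, since the latter
are bounded on the compact set t ≤ T, r ≤ R. -/
theorem sq_le_of_mem_jetIdeal {F : SF M t0} (hF : F ∈ jetIdeal φ) (T R : ℝ) :
    ∃ C, 0 ≤ C ∧ ∀ x : Pt M t0, x.1.1.1 ≤ T → x.1.1.2 ≤ R → F.1 x ^ 2 ≤ C * (enTot φ).1 x := by
  induction hF using Submodule.span_induction with
  | mem F hF =>
    obtain ⟨⟨I, n⟩, rfl⟩ := hF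
    refine ⟨4 + R ^ 2, by positivity, fun x _ hR => (jet_sq_le (φ I) n R x hR).trans ?_⟩
    gcongr
    rw [enTot_apply]
    exact Finset.single_le_sum (f := fun I => (enDens (φ I)).1 x)
      (fun I _ => enDens_nonneg (φ I) x) (Finset.mem_univ I)
  | zero => exact ⟨0, le_rfl, fun x _ _ => by simp⟩
  | add F G _ _ hF hG =>
    obtain ⟨C, hC0, hC⟩ := hF
    obtain ⟨D, hD0, hD⟩ := hG
    refine ⟨2 * C + 2 * D, by positivity, fun x hT hR => ?_⟩
    have h1 := hC x hT hR
    have h2 := hD x hT hR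
    change (F.1 x + G.1 x) ^ 2 ≤ _
    nlinarith [sq_nonneg (F.1 x - G.1 x)]
  | smul G F _ hF =>
    obtain ⟨C, hC0, hC⟩ := hF
    obtain ⟨A, hA⟩ := G.exists_bound T R
    refine ⟨A ^ 2 * C, by positivity, fun x hT hR => ?_⟩
    have h1 := hC x hT hR
    have h2 := hA x hT hR
    have h3 : G.1 x ^ 2 ≤ A ^ 2 := by
      rw [← sq_abs]; exact pow_le_pow_left₀ (abs_nonneg _) h2 2
    change (G.1 x * F.1 x) ^ 2 ≤ _
    rw [mul_pow, mul_assoc]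
    exact mul_le_mul h3 h1 (sq_nonneg _) (sq_nonneg _)

theorem abs_le_of_mem_jetIdeal_sq {F : SF M t0} (hF : F ∈ jetIdeal φ * jetIdeal φ) (T R : ℝ) :
    ∃ C, ∀ x : Pt M t0, x.1.1.1 ≤ T → x.1.1.2 ≤ R → |F.1 x| ≤ C * (enTot φ).1 x := by
  induction hF using Submodule.mul_induction_on' with
  | mem_mul_mem F hF G hG =>
    obtain ⟨C, hC0, hC⟩ := sq_le_of_mem_jetIdeal hF T R
    obtain ⟨D, hD0, hD⟩ := sq_le_of_mem_jetIdeal hG T R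
    refine ⟨C + D, fun x hT hR => ?_⟩
    have h1 := hC x hT hR
    have h2 := hD x hT hR
    change |F.1 x * G.1 x| ≤ _
    rw [abs_le]
    constructor <;> nlinarith [sq_nonneg (F.1 x - G.1 x), sq_nonneg (F.1 x + G.1 x),
      sq_nonneg (F.1 x), sq_nonneg (G.1 x)]
  | add F _ G _ hF hG =>
    obtain ⟨C, hC⟩ := hF
    obtain ⟨D, hD⟩ := hG
    refine ⟨C + D, fun x hT hR => ?_⟩
    rw [add_mul]
    exact (abs_add_le _ _).trans (add_le_add (hC x hT hR) (hD x hT hR))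

variable (φ) in
/-- A smooth solution of a system of wave equations with first order coupling and vanishing Cauchy
data on `Σ` vanishes on `D⁺(Σ)`. -/
theorem eq_zero_of_wave_mem_jetIdeal (hφ : ∀ I, wave (φ I) ∈ jetIdeal φ)
    (h0 : ∀ I, ZeroOnSigma (φ I)) (h1 : ∀ I, ZeroOnSigma (Dt (φ I))) (I : ι) : φ I = 0 := by
  have hin : ∀ I, inDer (φ I) ∈ jetIdeal φ := fun I => Ideal.sub_mem _ (Dt_mem φ I) (Dr_mem φ I)
  have hout : ∀ I, outDer (φ I) ∈ jetIdeal φ := fun I =>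
    Ideal.add_mem _ (Ideal.mul_mem_left _ _ (Dt_mem φ I)) (Ideal.mul_mem_left _ _ (Dr_mem φ I))
  -- The right side of `energy_identity` without the sphere divergence. Each term is a product of
  -- two elements of the jet ideal; for the wave term this is the hypothesis.
  let q : ι → SF M t0 := fun I =>
    - (2 * ((inDer (φ I) + outDer (φ I)) * wave (φ I)))
        + (2 * (φ I * Dt (φ I)) + 2 * (mus M t0 * rho M t0) * (inDer (φ I) * outDer (φ I))
          + mus M t0 * rho M t0 * (inDer (φ I) * inDer (φ I))
          + 3 * (mus M t0 * rho M t0 ^ 3) * ∑ i, DS i (φ I) * DS i (φ I))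
  have hq : ∀ I, q I ∈ jetIdeal φ * jetIdeal φ := fun I => by
    refine Ideal.add_mem _ (neg_mem (Ideal.mul_mem_left _ _ (Ideal.mul_mem_mul
      (Ideal.add_mem _ (hin I) (hout I)) (hφ I)))) (Ideal.add_mem _ (Ideal.add_mem _
      (Ideal.add_mem _ ?_ ?_) ?_) ?_)
    · exact Ideal.mul_mem_left _ _ (Ideal.mul_mem_mul (self_mem φ I) (Dt_mem φ I))
    · exact Ideal.mul_mem_left _ _ (Ideal.mul_mem_mul (hin I) (hout I))
    · exact Ideal.mul_mem_left _ _ (Ideal.mul_mem_mul (hin I) (hin I))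
    · exact Ideal.mul_mem_left _ _ (Ideal.sum_mem _ fun i _ =>
        Ideal.mul_mem_mul (DS_mem φ I i) (DS_mem φ I i))
  have hid : Dt (avg (enTot φ)) + Dr (avg (∑ I, enFlux (φ I))) = avg (∑ I, q I) := by
    have hrad : IsRadial (rho M t0 ^ 2) := fun _ _ _ => rfl
    -- By `avg_DS` the integral of a divergence is that of the normal component, and a multiple of a
    -- sphere gradient has none.
    have hdiv : ∀ I, avg (2 * (rho M t0 ^ 2 * ∑ i, DS i ((inDer (φ I) + outDer (φ I))
        * DS i (φ I)))) = 0 := fun I => by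
      rw [two_mul, map_add, avg_mul_of_isRadial hrad, map_sum]
      have : ∑ i, avg (DS i ((inDer (φ I) + outDer (φ I)) * DS i (φ I))) = 0 := by
        simp only [avg_DS]
        rw [← Finset.mul_sum, ← map_sum]
        have e : ∑ i, om i * ((inDer (φ I) + outDer (φ I)) * DS i (φ I))
            = (inDer (φ I) + outDer (φ I)) * ∑ i, om i * DS i (φ I) := by
          rw [Finset.mul_sum]; exact Finset.sum_congr rfl fun i _ => by ring
        rw [e, om_DS, mul_zero, map_zero, mul_zero]
      rw [this]; simp
    rw [Dt_avg, Dr_avg, ← map_add, enTot, map_sum, map_sum, ← Finset.sum_add_distrib, map_sum,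
      map_sum]
    refine Finset.sum_congr rfl fun I _ => ?_
    rw [energy_identity, map_add, map_sub, hdiv, zero_sub, ← map_neg, ← map_add]
    congr 1
    simp only [q]
    ring
  obtain w : S2 := ⟨EuclideanSpace.single 0 1, by simp⟩
  -- Integration over the spheres reduces the estimate to the variables (t*, r); the averages do not
  -- depend on the auxiliary point `w`.
  have hE := energy_eq_zero (avg (enTot φ)) (avg (∑ I, enFlux (φ I))) w
    (fun b => avg_nonneg (fun w => enTot_nonneg φ (b, w)) w)
    (fun b => by
      have : (avg (enTot φ)).1 (b, w) + (avg (∑ I, enFlux (φ I))).1 (b, w)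
          = (avg (enTot φ + ∑ I, enFlux (φ I))).1 (b, w) := by rw [map_add]; rfl
      rw [this]
      refine avg_nonneg (fun w => ?_) w
      have e : (enTot φ + ∑ I, enFlux (φ I)).1 (b, w)
          = ∑ I, ((enDens (φ I)).1 (b, w) + (enFlux (φ I)).1 (b, w)) := by
        simp [enTot, Finset.sum_add_distrib]
      rw [e]
      exact Finset.sum_nonneg fun I _ => enDens_add_enFlux_nonneg _ _)
    (fun b hb => by
      have : 0 ≤ (avg (-∑ I, enFlux (φ I))).1 (b, w) := by
        refine avg_nonneg (fun w => ?_) w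
        have e : (-∑ I, enFlux (φ I)).1 (b, w) = - ∑ I, (enFlux (φ I)).1 (b, w) := by simp
        rw [e, neg_nonneg]
        exact Finset.sum_nonpos fun I _ => enFlux_nonpos _ _ hb
      rw [map_neg] at this
      exact neg_nonneg.1 this)
    (fun b hb => by
      have hz : ∀ w, (enTot φ).1 (b, w) = 0 := fun w => by
        rw [enTot_apply]
        refine Finset.sum_eq_zero fun I _ => ?_
        rw [enDens_apply, h0 I _ hb, h1 I _ hb, (h0 I).Dr _ hb, (h0 I).DS _ _ hb,
          (h0 I).DS _ _ hb, (h0 I).DS _ _ hb]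
        ring
      rw [avg_apply]
      simp [hz])
    (fun T R => by
      obtain ⟨C, hC⟩ := abs_le_of_mem_jetIdeal_sq (φ := φ)
        (Ideal.sum_mem _ fun I (_ : I ∈ Finset.univ) => hq I) T R
      refine ⟨C, fun b hT hR => ?_⟩
      rw [hid]
      have e : C * (avg (enTot φ)).1 (b, w) = (avg (C • enTot φ)).1 (b, w) := by
        rw [map_smul]; rfl
      rw [e]
      exact avg_mono (fun w => (le_abs_self _).trans (hC (b, w) hT hR)) w)
  apply Subtype.ext
  funext ⟨b, w'⟩
  have hz := eq_zero_of_avg_eq_zero (fun w => enTot_nonneg φ (b, w)) (hE b) w'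
  rw [enTot_apply] at hz
  have hz' := (Finset.sum_eq_zero_iff_of_nonneg fun I _ => enDens_nonneg (φ I) (b, w')).1 hz I
    (Finset.mem_univ I)
  have h := jet_sq_le (φ I) 0 _ (b, w') le_rfl
  rw [hz', mul_zero] at h
  exact pow_eq_zero_iff two_ne_zero |>.1 (le_antisymm h (sq_nonneg _))

end
end LinGrav
end

noncomputable section
namespace LinGrav
open Set Filter Topology MeasureTheory

variable {M t0 : ℝ}

/-! ### The operators of the equations on the algebra of smooth functions -/

section Rep
variable {f g : Scal} {F G : SF M t0}

theorem Rep.add (hf : Rep f F) (hg : Rep g G) :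
    Rep (fun t r w => f t r w + g t r w) (F + G) :=
  fun t r h w => congrArg₂ (· + ·) (hf t r h w) (hg t r h w)

theorem Rep.sub (hf : Rep f F) (hg : Rep g G) :
    Rep (fun t r w => f t r w - g t r w) (F - G) :=
  fun t r h w => congrArg₂ (· - ·) (hf t r h w) (hg t r h w)

theorem Rep.neg (hf : Rep f F) : Rep (fun t r w => -f t r w) (-F) := 
  fun t r h w => congrArg (- ·) (hf t r h w)

theorem Rep.mul (hf : Rep f F) (hg : Rep g G) :
    Rep (fun t r w => f t r w * g t r w) (F * G) :=
  fun t r h w => congrArg₂ (· * ·) (hf t r h w) (hg t r h w)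

theorem Rep.sum {ι : Type*} {s : Finset ι} {f : ι → Scal} {F : ι → SF M t0}
    (hf : ∀ i, Rep (f i) (F i)) :
    Rep (fun t r w => ∑ i ∈ s, f i t r w) (∑ i ∈ s, F i) := fun t r h w => by
  refine (Finset.sum_congr rfl fun i _ => hf i t r h w).trans ?_
  simp

theorem Rep.const (c : ℝ) : Rep (fun _ _ _ => c) (algebraMap ℝ (SF M t0) c) :=
  fun _ _ _ _ => rfl

theorem Rep.zero : Rep (fun _ _ _ => 0) (0 : SF M t0) := fun _ _ _ _ => rfl

theorem Rep.one : Rep (fun _ _ _ => 1) (1 : SF M t0) := fun _ _ _ _ => rfl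

theorem Rep.om (i : Fin 3) : Rep (fun _ _ w => (w : E3) i) (om (M := M) (t0 := t0) i) :=
  fun _ _ _ _ => rfl

theorem Rep.avg (hf : Rep f F) : Rep (fun t r _ => ∫ η, f t r η ∂sigma) (avg F) :=
  fun t r h w => by
    exact congrArg (fun g : S2 → ℝ => ∫ η, g η ∂sigma) (funext fun η => hf t r h η)

end Rep

section IsRadial
variable {F G : SF M t0}

theorem IsRadial.add (hF : IsRadial F) (hG : IsRadial G) : IsRadial (F + G) :=
  fun b w w' => congrArg₂ (· + ·) (hF b w w') (hG b w w')
theorem IsRadial.sub (hF : IsRadial F) (hG : IsRadial G) : IsRadial (F - G) :=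
  fun b w w' => congrArg₂ (· - ·) (hF b w w') (hG b w w')
theorem IsRadial.mul (hF : IsRadial F) (hG : IsRadial G) : IsRadial (F * G) :=
  fun b w w' => congrArg₂ (· * ·) (hF b w w') (hG b w w')
theorem IsRadial.sum {ι : Type*} {s : Finset ι} {F : ι → SF M t0} (hF : ∀ i, IsRadial (F i)) :
    IsRadial (∑ i ∈ s, F i) := fun b w w' => by
  simp only [AddSubmonoidClass.coe_finsetSum, Finset.sum_apply]
  exact Finset.sum_congr rfl fun i _ => hF i b w w'

end IsRadial

variable [hM : Fact (0 < M)]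

variable (M t0) in
def gS (a b : Fin 2) : SF M t0 :=
  !![-(1 - mus M t0), mus M t0; mus M t0, 1 + mus M t0] a b

variable (M t0) in
def giS (a b : Fin 2) : SF M t0 :=
  !![-(1 + mus M t0), mus M t0; mus M t0, 1 - mus M t0] a b

variable (M t0) in
/-- The common value of the derivatives of all the components of the metric. -/
def dgS (a : Fin 2) : SF M t0 := ![0, -(mus M t0 * rho M t0)] a

variable (M t0) in
def GamS (c a b : Fin 2) : SF M t0 :=
  algebraMap ℝ _ (1 / 2) * ∑ d, giS M t0 c d * (dgS M t0 a + dgS M t0 b - dgS M t0 d)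

variable (M t0) in
def drS (a : Fin 2) : SF M t0 := ![0, 1] a

variable (M t0) in
def PS (a : Fin 2) : SF M t0 := ∑ b, giS M t0 a b * drS M t0 b

theorem Rep.rho : Rep (fun _ r _ => r⁻¹) (rho M t0) := fun _ _ _ _ => rfl

theorem Rep.mu : Rep (fun _ r _ => LinGrav.mu M r) (mus M t0) := fun _ r _ _ => by
  rw [mus_apply]; exact div_eq_mul_inv _ _

theorem Rep.gQ (a b : Fin 2) : Rep (fun _ r _ => LinGrav.gQ M r a b) (gS M t0 a b) := by
  fin_cases a <;> fin_cases b
  · exact (Rep.one.sub Rep.mu).neg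
  · exact Rep.mu
  · exact Rep.mu
  · exact Rep.one.add Rep.mu

theorem Rep.gQinv (a b : Fin 2) : Rep (fun _ r _ => LinGrav.gQinv M r a b) (giS M t0 a b) := by
  fin_cases a <;> fin_cases b
  · exact (Rep.one.add Rep.mu).neg
  · exact Rep.mu
  · exact Rep.mu
  · exact Rep.one.sub Rep.mu

theorem Rep.pd_gQ (a b d : Fin 2) :
    Rep (fun _ r _ => pd a (fun x => LinGrav.gQ M x b d) r) (dgS M t0 a) := by
  fin_cases a
  · exact Rep.zero
  · intro t r h w
    have hr := r_pos h.2
    have hmu : HasDerivAt (fun x => LinGrav.mu M x) (-(LinGrav.mu M r * r⁻¹)) r := by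
      have := (hasDerivAt_inv hr.ne').const_mul (2 * M)
      refine (this.congr_deriv ?_).congr_of_eventuallyEq (Eventually.of_forall fun x => ?_)
      · rw [LinGrav.mu]; field_simp
      · simp only [LinGrav.mu, div_eq_mul_inv]
    have hd : HasDerivAt (fun x => LinGrav.gQ M x b d) (-(LinGrav.mu M r * r⁻¹)) r := by
      fin_cases b <;> fin_cases d
      · exact ((hmu.const_sub 1).neg).congr_deriv (by ring)
      · exact hmu
      · exact hmu
      · exact hmu.const_add 1
    refine hd.deriv.trans ?_
    exact (Rep.mu.mul Rep.rho).neg t r h w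

theorem Rep.Gam (c a b : Fin 2) : Rep (fun _ r _ => LinGrav.Gam M c a b r) (GamS M t0 c a b) :=
  (Rep.const _).mul (Rep.sum fun d => (Rep.gQinv c d).mul
    (((Rep.pd_gQ a b d).add (Rep.pd_gQ b a d)).sub (Rep.pd_gQ d a b)))

theorem Rep.dr (a : Fin 2) : Rep (fun _ _ _ => LinGrav.dr a) (drS M t0 a) := by
  fin_cases a
  · exact Rep.zero
  · exact Rep.one

theorem Rep.P (a : Fin 2) : Rep (fun _ r _ => LinGrav.P M a r) (PS M t0 a) :=
  Rep.sum fun b => (Rep.gQinv a b).mul (Rep.dr b)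

theorem isRadial_gS (a b : Fin 2) : IsRadial (gS M t0 a b) := by
  fin_cases a <;> fin_cases b <;> exact fun _ _ _ => rfl
theorem isRadial_giS (a b : Fin 2) : IsRadial (giS M t0 a b) := by
  fin_cases a <;> fin_cases b <;> exact fun _ _ _ => rfl
theorem isRadial_dgS (a : Fin 2) : IsRadial (dgS M t0 a) := by
  fin_cases a <;> exact fun _ _ _ => rfl
theorem isRadial_drS (a : Fin 2) : IsRadial (drS M t0 a) := by
  fin_cases a <;> exact fun _ _ _ => rfl
theorem isRadial_GamS (c a b : Fin 2) : IsRadial (GamS M t0 c a b) :=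
  IsRadial.mul (fun _ _ _ => rfl) (IsRadial.sum fun d => (isRadial_giS c d).mul
    (((isRadial_dgS a).add (isRadial_dgS b)).sub (isRadial_dgS d)))
theorem isRadial_PS (a : Fin 2) : IsRadial (PS M t0 a) :=
  IsRadial.sum fun b => (isRadial_giS a b).mul (isRadial_drS b)
theorem isRadial_rho : IsRadial (rho M t0) := fun _ _ _ => rfl

section Operators

def NQ1 (w : Fin 2 → SF M t0) (c a : Fin 2) : SF M t0 :=
  DQ c (w a) - ∑ d, GamS M t0 d c a * w d

def NQ2 (h : Fin 2 → Fin 2 → SF M t0) (c a b : Fin 2) : SF M t0 :=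
  DQ c (h a b) - ∑ d, GamS M t0 d c a * h d b - ∑ d, GamS M t0 d c b * h a d

def NQ3 (k : Fin 2 → Fin 2 → Fin 2 → SF M t0) (c a b e : Fin 2) : SF M t0 :=
  DQ c (k a b e) - ∑ d, GamS M t0 d c a * k d b e - ∑ d, GamS M t0 d c b * k a d e
    - ∑ d, GamS M t0 d c e * k a b d

def DelQ1 (w : Fin 2 → SF M t0) : SF M t0 := -∑ a, ∑ b, giS M t0 a b * NQ1 w a b

def DelQ2 (h : Fin 2 → Fin 2 → SF M t0) (c : Fin 2) : SF M t0 :=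
  -∑ a, ∑ b, giS M t0 a b * NQ2 h a b c

def BoxQ0 (f : SF M t0) : SF M t0 := ∑ c, ∑ d, giS M t0 c d * NQ1 (fun a => DQ a f) c d

def BoxQ1 (w : Fin 2 → SF M t0) (a : Fin 2) : SF M t0 :=
  ∑ c, ∑ d, giS M t0 c d * NQ2 (NQ1 w) c d a

def BoxQ2 (h : Fin 2 → Fin 2 → SF M t0) (a b : Fin 2) : SF M t0 :=
  ∑ c, ∑ d, giS M t0 c d * NQ3 (NQ2 h) c d a b

def ConP (h : Fin 2 → Fin 2 → SF M t0) (b : Fin 2) : SF M t0 := ∑ a, PS M t0 a * h a b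

def HatDr (q : Fin 2 → SF M t0) (a b : Fin 2) : SF M t0 :=
  drS M t0 a * q b + drS M t0 b * q a
    - gS M t0 a b * ∑ c, ∑ d, giS M t0 c d * drS M t0 c * q d

def NHat1 (w : Fin 2 → SF M t0) (a b : Fin 2) : SF M t0 :=
  NQ1 w a b + NQ1 w b a + gS M t0 a b * DelQ1 w

def NHat2P (h : Fin 2 → Fin 2 → SF M t0) (a b : Fin 2) : SF M t0 :=
  ∑ c, PS M t0 c * (NQ2 h a b c + NQ2 h b a c + gS M t0 a b * DelQ2 h c)

variable {w : Fin 2 → Scal} {W : Fin 2 → SF M t0} {h : Fin 2 → Fin 2 → Scal}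
  {H : Fin 2 → Fin 2 → SF M t0} {k : Fin 2 → Fin 2 → Fin 2 → Scal}
  {K : Fin 2 → Fin 2 → Fin 2 → SF M t0} {f : Scal} {F : SF M t0}

theorem Rep.nQ1 (hw : ∀ a, Rep (w a) (W a)) (c a : Fin 2) :
    Rep (LinGrav.nQ1 M t0 w c a) (NQ1 W c a) :=
  ((hw a).dQ c).sub (Rep.sum fun d => (Rep.Gam d c a).mul (hw d))

theorem Rep.nQ2 (hh : ∀ a b, Rep (h a b) (H a b)) (c a b : Fin 2) :
    Rep (LinGrav.nQ2 M t0 h c a b) (NQ2 H c a b) :=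
  (((hh a b).dQ c).sub (Rep.sum fun d => (Rep.Gam d c a).mul (hh d b))).sub
    (Rep.sum fun d => (Rep.Gam d c b).mul (hh a d))

theorem Rep.nQ3 (hk : ∀ a b e, Rep (k a b e) (K a b e)) (c a b e : Fin 2) :
    Rep (LinGrav.nQ3 M t0 k c a b e) (NQ3 K c a b e) :=
  ((((hk a b e).dQ c).sub (Rep.sum fun d => (Rep.Gam d c a).mul (hk d b e))).sub
    (Rep.sum fun d => (Rep.Gam d c b).mul (hk a d e))).sub
    (Rep.sum fun d => (Rep.Gam d c e).mul (hk a b d))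

theorem Rep.deltaQ1 (hw : ∀ a, Rep (w a) (W a)) : Rep (LinGrav.deltaQ1 M t0 w) (DelQ1 W) :=
  (Rep.sum fun a => Rep.sum fun b => (Rep.gQinv a b).mul (Rep.nQ1 hw a b)).neg

theorem Rep.deltaQ2 (hh : ∀ a b, Rep (h a b) (H a b)) (c : Fin 2) :
    Rep (LinGrav.deltaQ2 M t0 h c) (DelQ2 H c) :=
  (Rep.sum fun a => Rep.sum fun b => (Rep.gQinv a b).mul (Rep.nQ2 hh a b c)).neg

theorem Rep.boxQ0 (hf : Rep f F) : Rep (LinGrav.boxQ0 M t0 f) (BoxQ0 F) :=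
  Rep.sum fun a => Rep.sum fun b => (Rep.gQinv a b).mul (Rep.nQ1 (fun a => hf.dQ a) a b)

theorem Rep.boxQ1 (hw : ∀ a, Rep (w a) (W a)) (a : Fin 2) :
    Rep (LinGrav.boxQ1 M t0 w a) (BoxQ1 W a) :=
  Rep.sum fun c => Rep.sum fun d => (Rep.gQinv c d).mul (Rep.nQ2 (Rep.nQ1 hw) c d a)

theorem Rep.boxQ2 (hh : ∀ a b, Rep (h a b) (H a b)) (a b : Fin 2) :
    Rep (LinGrav.boxQ2 M t0 h a b) (BoxQ2 H a b) :=
  Rep.sum fun c => Rep.sum fun d => (Rep.gQinv c d).mul (Rep.nQ3 (Rep.nQ2 hh) c d a b)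

theorem Rep.conP (hh : ∀ a b, Rep (h a b) (H a b)) (b : Fin 2) :
    Rep (LinGrav.conP M h b) (ConP H b) :=
  Rep.sum fun a => (Rep.P a).mul (hh a b)

theorem Rep.hatProd_dr (hw : ∀ a, Rep (w a) (W a)) (a b : Fin 2) :
    Rep (LinGrav.hatProd M (fun c _ _ _ => LinGrav.dr c) w a b) (HatDr W a b) :=
  (((Rep.dr a).mul (hw b)).add ((Rep.dr b).mul (hw a))).sub ((Rep.gQ a b).mul
    (Rep.sum fun c => Rep.sum fun d => ((Rep.gQinv c d).mul (Rep.dr c)).mul (hw d)))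

theorem Rep.nHat1 (hw : ∀ a, Rep (w a) (W a)) (a b : Fin 2) :
    Rep (LinGrav.nHat1 M t0 w a b) (NHat1 W a b) :=
  ((Rep.nQ1 hw a b).add (Rep.nQ1 hw b a)).add ((Rep.gQ a b).mul (Rep.deltaQ1 hw))

theorem Rep.nHat2P (hh : ∀ a b, Rep (h a b) (H a b)) (a b : Fin 2) :
    Rep (LinGrav.nHat2P M t0 h a b) (NHat2P H a b) :=
  Rep.sum fun c => (Rep.P c).mul (((Rep.nQ2 hh a b c).add (Rep.nQ2 hh b a c)).add
    ((Rep.gQ a b).mul (Rep.deltaQ2 hh c)))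

end Operators

section Sphere

variable (M t0) in
def prS (i j : Fin 3) : SF M t0 := (if i = j then 1 else 0) - om i * om j

def NS1 (ξ : Fin 3 → SF M t0) (i j : Fin 3) : SF M t0 := ∑ k, prS M t0 j k * DS i (ξ k)

def NS2 (θ : Fin 3 → Fin 3 → SF M t0) (i j k : Fin 3) : SF M t0 :=
  ∑ l, ∑ m, prS M t0 j l * prS M t0 k m * DS i (θ l m)

def NS3 (κ : Fin 3 → Fin 3 → Fin 3 → SF M t0) (i j k p : Fin 3) : SF M t0 :=
  ∑ l, ∑ m, ∑ q, prS M t0 j l * prS M t0 k m * prS M t0 p q * DS i (κ l m q)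

variable {ξ : Fin 3 → Scal} {X : Fin 3 → SF M t0} {θ : Fin 3 → Fin 3 → Scal}
  {Θ : Fin 3 → Fin 3 → SF M t0} {κ : Fin 3 → Fin 3 → Fin 3 → Scal}
  {Κ : Fin 3 → Fin 3 → Fin 3 → SF M t0} {f : Scal} {F : SF M t0}

theorem Rep.proj (i j : Fin 3) : Rep (fun _ _ w => LinGrav.proj w i j) (prS M t0 i j) := by
  refine Rep.sub ?_ ((Rep.om i).mul (Rep.om j))
  by_cases hij : i = j
  · simp only [hij, if_true]; exact Rep.one
  · simp only [hij, if_false]; exact Rep.zero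

theorem Rep.nS1 (hξ : ∀ i, Rep (ξ i) (X i)) (i j : Fin 3) :
    Rep (LinGrav.nS1 ξ i j) (NS1 X i j) :=
  Rep.sum fun k => (Rep.proj j k).mul ((hξ k).dS i)

theorem Rep.nS2 (hθ : ∀ i j, Rep (θ i j) (Θ i j)) (i j k : Fin 3) :
    Rep (LinGrav.nS2 θ i j k) (NS2 Θ i j k) :=
  Rep.sum fun l => Rep.sum fun m => ((Rep.proj j l).mul (Rep.proj k m)).mul ((hθ l m).dS i)

theorem Rep.nS3 (hκ : ∀ i j k, Rep (κ i j k) (Κ i j k)) (i j k p : Fin 3) :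
    Rep (LinGrav.nS3 κ i j k p) (NS3 Κ i j k p) :=
  Rep.sum fun l => Rep.sum fun m => Rep.sum fun q =>
    (((Rep.proj j l).mul (Rep.proj k m)).mul (Rep.proj p q)).mul ((hκ l m q).dS i)

theorem Rep.inv_sq : Rep (fun _ r _ => (r ^ 2)⁻¹) (LinGrav.rho M t0 ^ 2) := 
  fun _ r _ _ => (inv_pow r 2).symm

theorem Rep.divS1 (hξ : ∀ i, Rep (ξ i) (X i)) :
    Rep (LinGrav.divS1 ξ) (LinGrav.rho M t0 ^ 2 * ∑ i, NS1 X i i) :=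
  Rep.inv_sq.mul (Rep.sum fun i => Rep.nS1 hξ i i)

theorem Rep.divS2 (hθ : ∀ i j, Rep (θ i j) (Θ i j)) (j : Fin 3) :
    Rep (LinGrav.divS2 θ j) (LinGrav.rho M t0 ^ 2 * ∑ i, NS2 Θ i i j) :=
  Rep.inv_sq.mul (Rep.sum fun i => Rep.nS2 hθ i i j)

theorem Rep.lapS0 (hf : Rep f F) :
    Rep (LinGrav.lapS0 f) (LinGrav.rho M t0 ^ 2 * ∑ i, NS1 (fun j => DS j F) i i) :=
  Rep.inv_sq.mul (Rep.sum fun i => Rep.nS1 (fun j => hf.dS j) i i)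

theorem Rep.lapS1 (hξ : ∀ i, Rep (ξ i) (X i)) (j : Fin 3) :
    Rep (LinGrav.lapS1 ξ j) (LinGrav.rho M t0 ^ 2 * ∑ i, NS2 (NS1 X) i i j) :=
  Rep.inv_sq.mul (Rep.sum fun i => Rep.nS2 (Rep.nS1 hξ) i i j)

theorem Rep.lapS2 (hθ : ∀ i j, Rep (θ i j) (Θ i j)) (j k : Fin 3) :
    Rep (LinGrav.lapS2 θ j k) (LinGrav.rho M t0 ^ 2 * ∑ i, NS3 (NS2 Θ) i i j k) :=
  Rep.inv_sq.mul (Rep.sum fun i => Rep.nS3 (Rep.nS2 hθ) i i j k)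

end Sphere

end LinGrav
end

noncomputable section
namespace LinGrav
open Set Filter Topology MeasureTheory

variable {M t0 : ℝ}

/-! ### The operators modulo lower order terms -/

/-- The ideal need not be stable under derivations, so membership of the derivative is a separate
hypothesis. -/
theorem der_mul_mem
    {J : Ideal (SF M t0)} (D : Derivation ℝ (SF M t0) (SF M t0)) (c : SF M t0) {x : SF M t0}
    (hx : x ∈ J) (hD : D x ∈ J) : D (c * x) ∈ J := by
  rw [Derivation.leibniz, smul_eq_mul, smul_eq_mul]
  exact J.add_mem (J.mul_mem_left _ hD) (Ideal.mul_mem_right _ _ hx)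

variable [hM : Fact (0 < M)]

section Quotient
variable {J : Ideal (SF M t0)} {w : Fin 2 → SF M t0} {h : Fin 2 → Fin 2 → SF M t0} {f : SF M t0}

theorem NQ1_mem (h0 : ∀ a, w a ∈ J) (h1 : ∀ c a, DQ c (w a) ∈ J) (c a : Fin 2) : NQ1 w c a ∈ J :=
  J.sub_mem (h1 c a) (J.sum_mem fun d _ => J.mul_mem_left _ (h0 d))

theorem NQ2_mem (h0 : ∀ a b, h a b ∈ J) (h1 : ∀ c a b, DQ c (h a b) ∈ J) (c a b : Fin 2) :
    NQ2 h c a b ∈ J :=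
  J.sub_mem (J.sub_mem (h1 c a b) (J.sum_mem fun d _ => J.mul_mem_left _ (h0 d b)))
    (J.sum_mem fun d _ => J.mul_mem_left _ (h0 a d))

theorem DelQ1_mem (h0 : ∀ a, w a ∈ J) (h1 : ∀ c a, DQ c (w a) ∈ J) : DelQ1 w ∈ J :=
  J.neg_mem (J.sum_mem fun a _ => J.sum_mem fun b _ => J.mul_mem_left _ (NQ1_mem h0 h1 a b))

theorem DelQ2_mem (h0 : ∀ a b, h a b ∈ J) (h1 : ∀ c a b, DQ c (h a b) ∈ J) (c : Fin 2) :
    DelQ2 h c ∈ J :=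
  J.neg_mem (J.sum_mem fun a _ => J.sum_mem fun b _ => J.mul_mem_left _ (NQ2_mem h0 h1 a b c))

theorem ConP_mem (h0 : ∀ a b, h a b ∈ J) (b : Fin 2) : ConP h b ∈ J :=
  J.sum_mem fun a _ => J.mul_mem_left _ (h0 a b)

theorem HatDr_mem (h0 : ∀ a, w a ∈ J) (a b : Fin 2) : HatDr w a b ∈ J :=
  J.sub_mem (J.add_mem (J.mul_mem_left _ (h0 b)) (J.mul_mem_left _ (h0 a)))
    (J.mul_mem_left _ (J.sum_mem fun _ _ => J.sum_mem fun d _ => J.mul_mem_left _ (h0 d)))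

theorem NHat1_mem (h0 : ∀ a, w a ∈ J) (h1 : ∀ c a, DQ c (w a) ∈ J) (a b : Fin 2) :
    NHat1 w a b ∈ J :=
  J.add_mem (J.add_mem (NQ1_mem h0 h1 a b) (NQ1_mem h0 h1 b a))
    (J.mul_mem_left _ (DelQ1_mem h0 h1))

theorem NHat2P_mem (h0 : ∀ a b, h a b ∈ J) (h1 : ∀ c a b, DQ c (h a b) ∈ J) (a b : Fin 2) :
    NHat2P h a b ∈ J :=
  J.sum_mem fun c _ => J.mul_mem_left _ (J.add_mem (J.add_mem (NQ2_mem h0 h1 a b c)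
    (NQ2_mem h0 h1 b a c)) (J.mul_mem_left _ (DelQ2_mem h0 h1 c)))

theorem ConP_der_mem (h0 : ∀ a b, h a b ∈ J) (h1 : ∀ c a b, DQ c (h a b) ∈ J) (c b : Fin 2) :
    DQ c (ConP h b) ∈ J := by
  rw [ConP, map_sum]
  exact J.sum_mem fun a _ => der_mul_mem _ _ (h0 a b) (h1 c a b)

/-- The part of the wave operator without derivatives along the spheres. -/
def wave2 (F : SF M t0) : SF M t0 := ∑ c, ∑ d, giS M t0 c d * DQ c (DQ d F)

theorem wave_eq (F : SF M t0) : wave F = wave2 F + rho M t0 ^ 2 * lapl F := by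
  simp only [wave, wave2, Fin.sum_univ_two, giS, DQ]
  simp [Dt_Dr]
  ring

/-- Christoffel symbols only produce terms of order at most one, so modulo `J` a covariant wave
operator acts on each component as `wave2`. The same reason applies to tensors of rank 1 and 2. -/
theorem BoxQ0_mem (h1 : ∀ c, DQ c f ∈ J) : BoxQ0 f - wave2 f ∈ J := by
  rw [BoxQ0, wave2, ← Finset.sum_sub_distrib]
  refine J.sum_mem fun c _ => ?_
  rw [← Finset.sum_sub_distrib]
  refine J.sum_mem fun d _ => ?_
  rw [← mul_sub, NQ1, sub_sub_cancel_left]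
  exact J.mul_mem_left _ (J.neg_mem (J.sum_mem fun e _ => J.mul_mem_left _ (h1 e)))

theorem BoxQ1_mem (h0 : ∀ a, w a ∈ J) (h1 : ∀ c a, DQ c (w a) ∈ J) (a : Fin 2) :
    BoxQ1 w a - wave2 (w a) ∈ J := by
  rw [BoxQ1, wave2, ← Finset.sum_sub_distrib]
  refine J.sum_mem fun c _ => ?_
  rw [← Finset.sum_sub_distrib]
  refine J.sum_mem fun d _ => ?_
  rw [← mul_sub, NQ2, sub_right_comm, sub_right_comm _ _ (DQ c (DQ d (w a)))]
  refine J.mul_mem_left _ (J.sub_mem (J.sub_mem ?_ ?_) ?_)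
  · rw [NQ1, map_sub, sub_sub_cancel_left, map_sum]
    exact J.neg_mem (J.sum_mem fun e _ => der_mul_mem _ _ (h0 e) (h1 c e))
  · exact J.sum_mem fun e _ => J.mul_mem_left _ (NQ1_mem h0 h1 _ _)
  · exact J.sum_mem fun e _ => J.mul_mem_left _ (NQ1_mem h0 h1 _ _)

theorem BoxQ2_mem (h0 : ∀ a b, h a b ∈ J) (h1 : ∀ c a b, DQ c (h a b) ∈ J) (a b : Fin 2) :
    BoxQ2 h a b - wave2 (h a b) ∈ J := by
  rw [BoxQ2, wave2, ← Finset.sum_sub_distrib]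
  refine J.sum_mem fun c _ => ?_
  rw [← Finset.sum_sub_distrib]
  refine J.sum_mem fun d _ => ?_
  rw [← mul_sub, NQ3, sub_right_comm, sub_right_comm _ _ (DQ c (DQ d (h a b))),
    sub_right_comm _ _ (DQ c (DQ d (h a b)))]
  refine J.mul_mem_left _ (J.sub_mem (J.sub_mem (J.sub_mem ?_ ?_) ?_) ?_)
  · rw [NQ2, map_sub, map_sub, sub_right_comm, sub_right_comm _ _ (DQ c (DQ d (h a b))), sub_self,
      zero_sub, map_sum, map_sum]
    exact J.sub_mem (J.neg_mem (J.sum_mem fun e _ => der_mul_mem _ _ (h0 e b) (h1 c e b)))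
      (J.sum_mem fun e _ => der_mul_mem _ _ (h0 a e) (h1 c a e))
  · exact J.sum_mem fun e _ => J.mul_mem_left _ (NQ2_mem h0 h1 _ _ _)
  · exact J.sum_mem fun e _ => J.mul_mem_left _ (NQ2_mem h0 h1 _ _ _)
  · exact J.sum_mem fun e _ => J.mul_mem_left _ (NQ2_mem h0 h1 _ _ _)

end Quotient

/-! ### Additivity of the operators -/

section Additive
variable (w w' : Fin 2 → SF M t0) (h h' : Fin 2 → Fin 2 → SF M t0)
  (k k' : Fin 2 → Fin 2 → Fin 2 → SF M t0)

theorem NQ1_sub : NQ1 (w - w') = NQ1 w - NQ1 w' := by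
  funext c a
  simp only [NQ1, Pi.sub_apply, map_sub, mul_sub, Finset.sum_sub_distrib]; ring

theorem NQ2_sub : NQ2 (h - h') = NQ2 h - NQ2 h' := by
  funext c a b
  simp only [NQ2, Pi.sub_apply, map_sub, mul_sub, Finset.sum_sub_distrib]; ring

theorem NQ3_sub : NQ3 (k - k') = NQ3 k - NQ3 k' := by
  funext c a b e
  simp only [NQ3, Pi.sub_apply, map_sub, mul_sub, Finset.sum_sub_distrib]; ring

theorem DelQ1_sub : DelQ1 (w - w') = DelQ1 w - DelQ1 w' := by
  simp only [DelQ1, NQ1_sub, Pi.sub_apply, mul_sub, Finset.sum_sub_distrib]; ring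

theorem DelQ2_sub : DelQ2 (h - h') = DelQ2 h - DelQ2 h' := by
  funext c
  simp only [DelQ2, NQ2_sub, Pi.sub_apply, mul_sub, Finset.sum_sub_distrib]; ring

theorem BoxQ1_sub : BoxQ1 (w - w') = BoxQ1 w - BoxQ1 w' := by
  funext a
  simp only [BoxQ1, NQ1_sub, NQ2_sub, Pi.sub_apply, mul_sub, Finset.sum_sub_distrib]

theorem BoxQ2_sub : BoxQ2 (h - h') = BoxQ2 h - BoxQ2 h' := by
  funext a b
  simp only [BoxQ2, NQ2_sub, NQ3_sub, Pi.sub_apply, mul_sub, Finset.sum_sub_distrib]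

theorem ConP_sub : ConP (h - h') = ConP h - ConP h' := by
  funext b
  simp only [ConP, Pi.sub_apply, mul_sub, Finset.sum_sub_distrib]

theorem NHat1_sub : NHat1 (w - w') = NHat1 w - NHat1 w' := by
  funext a b
  simp only [NHat1, NQ1_sub, DelQ1_sub, Pi.sub_apply, mul_sub]; ring

theorem NHat2P_sub : NHat2P (h - h') = NHat2P h - NHat2P h' := by
  funext a b
  simp only [NHat2P, NQ2_sub, DelQ2_sub, Pi.sub_apply, mul_sub, mul_add, Finset.sum_sub_distrib,
    Finset.sum_add_distrib]; ring

end Additive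

/-! ### Commutation with maps acting on the spheres -/

/-- Additive maps commuting with `∂_{t*}`, `∂_r` and multiplication by functions of `(t*, r)`. -/
structure SphereMap (T : SF M t0 →+ SF M t0) : Prop where
  mul : ∀ {c : SF M t0}, IsRadial c → ∀ F, T (c * F) = c * T F
  dQ : ∀ a F, T (DQ a F) = DQ a (T F)

section Commute
variable {T : SF M t0 →+ SF M t0} (w : Fin 2 → SF M t0)
  (h : Fin 2 → Fin 2 → SF M t0) (k : Fin 2 → Fin 2 → Fin 2 → SF M t0)

theorem SphereMap.nQ1 (hT : SphereMap T) (c a : Fin 2) :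
    T (NQ1 w c a) = NQ1 (fun a => T (w a)) c a := by
  simp only [NQ1, map_sub, map_sum, hT.dQ, hT.mul (isRadial_GamS _ _ _)]

theorem SphereMap.nQ2 (hT : SphereMap T) (c a b : Fin 2) :
    T (NQ2 h c a b) = NQ2 (fun a b => T (h a b)) c a b := by
  simp only [NQ2, map_sub, map_sum, hT.dQ, hT.mul (isRadial_GamS _ _ _)]

theorem SphereMap.nQ3 (hT : SphereMap T) (c a b e : Fin 2) :
    T (NQ3 k c a b e) = NQ3 (fun a b e => T (k a b e)) c a b e := by
  simp only [NQ3, map_sub, map_sum, hT.dQ, hT.mul (isRadial_GamS _ _ _)]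

theorem SphereMap.delQ1 (hT : SphereMap T) : T (DelQ1 w) = DelQ1 (fun a => T (w a)) := by
  simp only [DelQ1, map_neg, map_sum, hT.mul (isRadial_giS _ _), hT.nQ1]

theorem SphereMap.delQ2 (hT : SphereMap T) (c : Fin 2) :
    T (DelQ2 h c) = DelQ2 (fun a b => T (h a b)) c := by
  simp only [DelQ2, map_neg, map_sum, hT.mul (isRadial_giS _ _), hT.nQ2]

theorem SphereMap.boxQ0 (hT : SphereMap T) (F : SF M t0) : T (BoxQ0 F) = BoxQ0 (T F) := by
  simp only [BoxQ0, map_sum, hT.mul (isRadial_giS _ _), hT.nQ1, hT.dQ]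

theorem SphereMap.boxQ1 (hT : SphereMap T) (a : Fin 2) :
    T (BoxQ1 w a) = BoxQ1 (fun a => T (w a)) a := by
  simp only [BoxQ1, map_sum, hT.mul (isRadial_giS _ _), hT.nQ2, hT.nQ1]

theorem SphereMap.boxQ2 (hT : SphereMap T) (a b : Fin 2) :
    T (BoxQ2 h a b) = BoxQ2 (fun a b => T (h a b)) a b := by
  simp only [BoxQ2, map_sum, hT.mul (isRadial_giS _ _), hT.nQ3, hT.nQ2]

theorem SphereMap.conP (hT : SphereMap T) (b : Fin 2) :
    T (ConP h b) = ConP (fun a b => T (h a b)) b := by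
  simp only [ConP, map_sum, hT.mul (isRadial_PS _)]

theorem SphereMap.hatDr (hT : SphereMap T) (a b : Fin 2) :
    T (HatDr w a b) = HatDr (fun a => T (w a)) a b := by
  simp only [HatDr, map_sum, map_sub, map_add, mul_assoc, hT.mul (isRadial_giS _ _),
    hT.mul (isRadial_drS _), hT.mul (isRadial_gS _ _)]

theorem SphereMap.nHat1 (hT : SphereMap T) (a b : Fin 2) :
    T (NHat1 w a b) = NHat1 (fun a => T (w a)) a b := by
  simp only [NHat1, map_add, hT.nQ1, hT.delQ1, hT.mul (isRadial_gS _ _)]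

theorem SphereMap.nHat2P (hT : SphereMap T) (a b : Fin 2) :
    T (NHat2P h a b) = NHat2P (fun a b => T (h a b)) a b := by
  simp only [NHat2P, map_sum, map_add, hT.nQ2, hT.delQ2, hT.mul (isRadial_gS _ _),
    hT.mul (isRadial_PS _)]

end Commute

end LinGrav
end

noncomputable section
namespace LinGrav
open Set Filter Topology MeasureTheory

variable {M t0 : ℝ}

/-! ### Calculus on the unit sphere -/

theorem prS_symm (i j : Fin 3) : prS M t0 i j = prS M t0 j i := by
  simp only [prS, eq_comm, mul_comm]

theorem sum_prS_DS (l : Fin 3) (F : SF M t0) : ∑ i, prS M t0 i l * DS i F = DS l F := by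
  have h : ∑ i, prS M t0 i l * DS i F = DS l F - om l * ∑ i, om i * DS i F := by
    simp only [prS, sub_mul, Finset.sum_sub_distrib, Finset.mul_sum, ite_mul, one_mul, zero_mul,
      Finset.sum_ite_eq', Finset.mem_univ, if_true]
    congr 1
    exact Finset.sum_congr rfl fun i _ => by ring
  rw [h, om_DS, mul_zero, sub_zero]

theorem sum_prS_mul {v : Fin 3 → SF M t0} (hv : ∑ i, om i * v i = 0) (j : Fin 3) :
    ∑ i, prS M t0 j i * v i = v j := by
  have h : ∑ i, prS M t0 j i * v i = v j - om j * ∑ i, om i * v i := by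
    simp only [prS, sub_mul, Finset.sum_sub_distrib, Finset.mul_sum, ite_mul, one_mul, zero_mul,
      Finset.sum_ite_eq, Finset.mem_univ, if_true]
    congr 1
    exact Finset.sum_congr rfl fun i _ => by ring
  rw [h, hv, mul_zero, sub_zero]

/-- The divergence of a 1-form on the unit sphere. -/
def dv (X : Fin 3 → SF M t0) : SF M t0 := ∑ i, DS i (X i)

theorem sum_NS1_diag (X : Fin 3 → SF M t0) : ∑ i, NS1 X i i = dv X := by
  simp only [NS1]
  rw [Finset.sum_comm]
  exact Finset.sum_congr rfl fun k _ => sum_prS_DS k _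

theorem sum_DS_om_mul {X : Fin 3 → SF M t0} (hX : ∑ i, om i * X i = 0) (l : Fin 3) :
    ∑ k, DS l (om k) * X k = X l := by
  simp only [DS_om]
  exact sum_prS_mul hX l

/-- Differentiate the tangency relation; the result is the second fundamental form of the sphere. -/
theorem sum_om_DS {X : Fin 3 → SF M t0} (hX : ∑ i, om i * X i = 0) (l : Fin 3) :
    ∑ k, om k * DS l (X k) = -X l := by
  have h := congrArg (DS l) hX
  simp only [map_sum, Derivation.leibniz, smul_eq_mul, map_zero, Finset.sum_add_distrib] at h
  have h2 := sum_DS_om_mul hX l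
  simp only [mul_comm (DS l _)] at h2
  rw [h2] at h
  exact eq_neg_of_add_eq_zero_left h

/-- The projection removes exactly the normal component found in `sum_om_DS`. -/
theorem NS1_tangent {X : Fin 3 → SF M t0} (hX : ∑ i, om i * X i = 0) (l m : Fin 3) :
    NS1 X l m = DS l (X m) + om m * X l := by
  have h : NS1 X l m = DS l (X m) - om m * ∑ k, om k * DS l (X k) := by
    simp only [NS1, prS, sub_mul, Finset.sum_sub_distrib, Finset.mul_sum, ite_mul, one_mul,
      zero_mul, Finset.sum_ite_eq, Finset.mem_univ, if_true]
    congr 1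
    exact Finset.sum_congr rfl fun i _ => by ring
  rw [h, sum_om_DS hX]; ring

theorem sum_DS_om (F : SF M t0) : ∑ i, DS i (om i * F) = 2 * F := by
  have h1 := om_sq (M := M) (t0 := t0)
  have h2 := om_DS F
  simp only [Derivation.leibniz, smul_eq_mul, DS_om, if_true, Finset.sum_add_distrib]
  simp only [Fin.sum_univ_three] at *
  linear_combination h2 - F * h1

theorem lapl_om (k : Fin 3) : lapl (om k) = -2 * om (M := M) (t0 := t0) k := by
  have h := sum_DS_om (om (M := M) (t0 := t0) k)
  have e : lapl (om (M := M) (t0 := t0) k) = ∑ i, DS i (if i = k then 1 else 0)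
      - ∑ i, DS i (om i * om k) := by
    simp only [lapl, DS_om, map_sub, Finset.sum_sub_distrib]
  have h0 : ∀ i, DS i (if i = k then 1 else 0 : SF M t0) = 0 := fun i => by
    split_ifs <;> simp
  rw [e, h]
  simp only [h0, Finset.sum_const_zero]
  ring

theorem lapl_mul (F G : SF M t0) :
    lapl (F * G) = F * lapl G + 2 * ∑ i, DS i F * DS i G + G * lapl F := by
  simp only [lapl, Derivation.leibniz, smul_eq_mul, map_add, Finset.mul_sum,
    ← Finset.sum_add_distrib]
  exact Finset.sum_congr rfl fun i _ => by ring

/-- Apply the Laplacian to the tangency relation: the mixed term is twice the divergence, and the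
term with `lapl (om k)` is a multiple of the relation itself. Thus this second order normal
component is in fact of first order. -/
theorem sum_om_lapl {X : Fin 3 → SF M t0} (hX : ∑ i, om i * X i = 0) :
    ∑ k, om k * lapl (X k) = -2 * dv X := by
  have h := congrArg lapl hX
  have hl : lapl (∑ i, om i * X i) = ∑ i, lapl (om i * X i) := by
    simp only [lapl, map_sum]; exact Finset.sum_comm
  have h0 : lapl (0 : SF M t0) = 0 := by simp [lapl]
  rw [hl, h0] at h
  simp only [lapl_mul, lapl_om, Finset.sum_add_distrib, ← Finset.mul_sum] at h
  have h3 : ∑ k, ∑ i, DS i (om (M := M) (t0 := t0) k) * DS i (X k) = dv X := by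
    refine Finset.sum_congr rfl fun k _ => ?_
    simp only [DS_om]
    exact sum_prS_DS k (X k)
  rw [h3] at h
  have h4 : ∑ x, X x * (-2 * om x) = -2 * ∑ i, om i * X i := by
    rw [Finset.mul_sum]; exact Finset.sum_congr rfl fun i _ => by ring
  rw [h4, hX] at h
  linear_combination h

theorem dv_NS1_tangent {X : Fin 3 → SF M t0} (hX : ∑ i, om i * X i = 0) (m : Fin 3) :
    ∑ l, DS l (NS1 X l m) = lapl (X m) + X m + om m * dv X := by
  simp only [NS1_tangent hX, map_add, Finset.sum_add_distrib, Derivation.leibniz, smul_eq_mul]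
  rw [lapl, dv, Finset.mul_sum]
  have : ∑ l, X l * DS l (om (M := M) (t0 := t0) m) = X m := by
    rw [← sum_prS_mul hX m]
    refine Finset.sum_congr rfl fun i _ => ?_
    rw [DS_om, prS_symm, mul_comm]; rfl
  rw [this]; ring

theorem sum_NS2_diag (Y : Fin 3 → Fin 3 → SF M t0) (j : Fin 3) :
    ∑ i, NS2 Y i i j = ∑ m, prS M t0 j m * ∑ l, DS l (Y l m) := by
  simp only [NS2]
  rw [Finset.sum_comm, Finset.sum_congr rfl fun l _ => Finset.sum_comm, Finset.sum_comm]
  refine Finset.sum_congr rfl fun m _ => ?_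
  rw [Finset.mul_sum]
  refine Finset.sum_congr rfl fun l _ => ?_
  rw [← sum_prS_DS l (Y l m), Finset.mul_sum]
  exact Finset.sum_congr rfl fun i _ => by ring

theorem sum_NS3_diag (Y : Fin 3 → Fin 3 → Fin 3 → SF M t0) (j k : Fin 3) :
    ∑ i, NS3 Y i i j k = ∑ m, prS M t0 j m * ∑ q, prS M t0 k q * ∑ l, DS l (Y l m q) := by
  simp only [NS3]
  rw [Finset.sum_comm, Finset.sum_congr rfl fun l _ => Finset.sum_comm, Finset.sum_comm]
  refine Finset.sum_congr rfl fun m _ => ?_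
  rw [Finset.sum_congr rfl fun l _ => Finset.sum_comm, Finset.sum_comm, Finset.mul_sum]
  refine Finset.sum_congr rfl fun q _ => ?_
  rw [Finset.mul_sum, Finset.mul_sum]
  refine Finset.sum_congr rfl fun l _ => ?_
  rw [← sum_prS_DS l (Y l m q), Finset.mul_sum, Finset.mul_sum]
  exact Finset.sum_congr rfl fun i _ => by ring

/-- The covariant Laplacian on tangential 1-forms in terms of ambient components. -/
theorem sum_NS2_NS1 {X : Fin 3 → SF M t0} (hX : ∑ i, om i * X i = 0) (j : Fin 3) :
    ∑ i, NS2 (NS1 X) i i j = lapl (X j) + 2 * (om j * dv X) + X j := by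
  rw [sum_NS2_diag]
  simp only [dv_NS1_tangent hX]
  have h2 : ∑ m, prS M t0 j m * (lapl (X m) + X m + om m * dv X)
      = (∑ m, prS M t0 j m * lapl (X m)) + (∑ m, prS M t0 j m * X m)
        + (∑ m, prS M t0 j m * om m) * dv X := by
    rw [Finset.sum_mul, ← Finset.sum_add_distrib, ← Finset.sum_add_distrib]
    exact Finset.sum_congr rfl fun i _ => by ring
  have h3 : ∑ m, prS M t0 j m * lapl (X m) = lapl (X j) - om j * ∑ i, om i * lapl (X i) := by
    simp only [prS, sub_mul, Finset.sum_sub_distrib, Finset.mul_sum, ite_mul, one_mul, zero_mul,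
      Finset.sum_ite_eq, Finset.mem_univ, if_true]
    congr 1
    exact Finset.sum_congr rfl fun i _ => by ring
  have h4 : ∑ m, prS M t0 j m * om m = 0 := by
    have : ∑ m, prS M t0 j m * om m = om j - om j * ∑ i, om i * om i := by
      simp only [prS, sub_mul, Finset.sum_sub_distrib, Finset.mul_sum, ite_mul, one_mul, zero_mul,
        Finset.sum_ite_eq, Finset.mem_univ, if_true]
      congr 1
      exact Finset.sum_congr rfl fun i _ => by ring
    rw [this, om_sq, mul_one, sub_self]
  rw [h2, h3, h4, sum_prS_mul hX, sum_om_lapl hX]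
  ring

/-- The correction arises from moving the derivative past two others with `DS_DS`, using that
gradients are tangential and that the position vector has divergence 2. -/
theorem DS_lapl (j : Fin 3) (F : SF M t0) :
    DS j (lapl F) = lapl (DS j F) + 2 * (om j * lapl F) := by
  have hterm : ∀ i, DS j (DS i (DS i F)) = DS i (DS i (DS j F))
      + (DS i (om j) * DS i F + om j * DS i (DS i F) - DS i (om i) * DS j F - om i * DS i (DS j F))
      + om j * DS i (DS i F) - om i * DS j (DS i F) := fun i => by
    rw [DS_DS j i (DS i F), DS_DS j i F]
    simp only [map_add, map_sub, Derivation.leibniz, smul_eq_mul]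
    ring
  have h1 : ∑ i, DS i (om (M := M) (t0 := t0) j) * DS i F = DS j F := by
    simp only [DS_om]; exact sum_prS_DS j F
  have h2 : ∑ i, DS i (om (M := M) (t0 := t0) i) = 2 := by
    have := sum_DS_om (M := M) (t0 := t0) 1
    simpa using this
  have h3 := om_DS (DS j F)
  have h4 : ∑ i, om i * DS j (DS i F) = - DS j F := by
    have h := congrArg (DS j) (om_DS F)
    simp only [map_sum, Derivation.leibniz, smul_eq_mul, map_zero, Finset.sum_add_distrib] at h
    have h5 : ∑ i, DS i F * DS j (om (M := M) (t0 := t0) i) = DS j F := by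
      rw [← h1]
      refine Finset.sum_congr rfl fun i _ => ?_
      rw [DS_om, DS_om, mul_comm]
      simp only [eq_comm, mul_comm]
    rw [h5] at h
    exact eq_neg_of_add_eq_zero_left h
  have e : DS j (lapl F) = ∑ i, DS j (DS i (DS i F)) := by rw [lapl, map_sum]
  rw [e]
  simp only [hterm, Finset.sum_add_distrib, Finset.sum_sub_distrib, ← Finset.mul_sum,
    ← Finset.sum_mul]
  rw [h1, h2, h3, h4]
  simp only [lapl]
  ring

/-- Commutation of the divergence and the Laplacian on 1-forms of the unit sphere. -/
theorem dv_sum_NS2_NS1 {X : Fin 3 → SF M t0} (hX : ∑ i, om i * X i = 0) :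
    dv (fun j => ∑ i, NS2 (NS1 X) i i j) = lapl (dv X) + dv X := by
  simp only [sum_NS2_NS1 hX]
  have e1 : dv (fun j => lapl (X j) + 2 * (om j * dv X) + X j)
      = ∑ j, DS j (lapl (X j)) + 2 * ∑ j, DS j (om j * dv X) + dv X := by
    simp only [dv, map_add, Finset.sum_add_distrib, two_mul]
  have e2 : lapl (dv X) = ∑ j, lapl (DS j (X j)) := by
    simp only [lapl, dv, map_sum]; exact Finset.sum_comm
  rw [e1, sum_DS_om, e2]
  simp only [DS_lapl, Finset.sum_add_distrib, ← Finset.mul_sum]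
  rw [sum_om_lapl hX]
  ring

theorem sum_om_lapl_mem {J : Ideal (SF M t0)} {X : Fin 3 → SF M t0}
    (h1 : ∀ l a, DS l (X a) ∈ J) (hX : ∑ i, om i * X i = 0) :
    ∑ k, om k * lapl (X k) ∈ J := by
  rw [sum_om_lapl hX]
  exact J.mul_mem_left _ (J.sum_mem fun i _ => h1 i i)

theorem sum_prS_lapl_mem {J : Ideal (SF M t0)} {X : Fin 3 → SF M t0}
    (h1 : ∀ l a, DS l (X a) ∈ J) (hX : ∑ i, om i * X i = 0) (j : Fin 3) :
    ∑ m, prS M t0 j m * lapl (X m) - lapl (X j) ∈ J := by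
  have h3 : ∑ m, prS M t0 j m * lapl (X m) = lapl (X j) - om j * ∑ i, om i * lapl (X i) := by
    simp only [prS, sub_mul, Finset.sum_sub_distrib, Finset.mul_sum, ite_mul, one_mul, zero_mul,
      Finset.sum_ite_eq, Finset.mem_univ, if_true]
    congr 1
    exact Finset.sum_congr rfl fun i _ => by ring
  rw [h3, sub_sub_cancel_left]
  exact J.neg_mem (J.mul_mem_left _ (sum_om_lapl_mem h1 hX))

/-- Modulo lower order terms, the covariant Laplacian on tangential 2-tensors acts on ambient
components as the scalar Laplacian. -/
theorem sum_NS3_NS2_mem {J : Ideal (SF M t0)} {θ : Fin 3 → Fin 3 → SF M t0}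
    (h1 : ∀ l a b, DS l (θ a b) ∈ J)
    (hl : ∀ b, ∑ a, om a * θ a b = 0) (hr : ∀ a, ∑ b, om b * θ a b = 0) (j k : Fin 3) :
    ∑ i, NS3 (NS2 θ) i i j k - lapl (θ j k) ∈ J := by
  -- In the quotient the first derivatives of θ vanish, so terms in which a derivative falls on a
  -- projection drop out and the projections may be moved past the second derivatives.
  let π := Ideal.Quotient.mk J
  have hπ1 : ∀ l a b, π (DS l (θ a b)) = 0 := fun l a b =>
    Ideal.Quotient.eq_zero_iff_mem.2 (h1 l a b)
  have hπl : ∀ b m, ∑ a, π (prS M t0 m a) * π (lapl (θ a b)) = π (lapl (θ m b)) := fun b m => by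
    have := sum_prS_lapl_mem (X := fun a => θ a b) (fun l a => h1 l a b) (hl b) m
    rw [← Ideal.Quotient.eq] at this
    rw [← this, map_sum]
    exact Finset.sum_congr rfl fun i _ => (map_mul _ _ _).symm
  have hπr : ∀ a m, ∑ b, π (prS M t0 m b) * π (lapl (θ a b)) = π (lapl (θ a m)) := fun a m => by
    have := sum_prS_lapl_mem (X := fun b => θ a b) (fun l b => h1 l a b) (hr a) m
    rw [← Ideal.Quotient.eq] at this
    rw [← this, map_sum]
    exact Finset.sum_congr rfl fun i _ => (map_mul _ _ _).symm
  have hlap : ∀ a b, ∑ l, π (DS l (DS l (θ a b))) = π (lapl (θ a b)) := fun a b => by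
    rw [lapl, map_sum]
  have hmid : ∀ m q, ∑ l, π (DS l (NS2 θ l m q)) = π (lapl (θ m q)) := fun m q => by
    have e : ∀ l, π (DS l (NS2 θ l m q))
        = ∑ a, π (prS M t0 m a) * ∑ b, π (prS M t0 q b) * π (DS l (DS l (θ a b))) := fun l => by
      simp only [NS2, map_sum, Derivation.leibniz, smul_eq_mul, map_add, map_mul, hπ1, zero_mul,
        mul_zero, add_zero, Finset.mul_sum, mul_assoc]
    simp only [e]
    rw [Finset.sum_comm, ← hπl]
    refine Finset.sum_congr rfl fun a _ => ?_
    rw [← Finset.mul_sum, Finset.sum_comm, ← hπr]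
    congr 1
    refine Finset.sum_congr rfl fun b _ => ?_
    rw [← Finset.mul_sum, hlap]
  rw [← Ideal.Quotient.eq, sum_NS3_diag]
  change π _ = π _
  simp only [map_sum, map_mul, hmid, hπr, hπl]

/-- Green's identity: the difference is the divergence of a tangential field, which integrates to
zero by `avg_DS`. -/
theorem avg_lapl_mul (F G : SF M t0) : avg (lapl F * G) = avg (F * lapl G) := by
  have h : lapl F * G - F * lapl G = ∑ i, DS i (DS i F * G - F * DS i G) := by
    simp only [lapl, Finset.sum_mul, Finset.mul_sum, map_sub, Derivation.leibniz, smul_eq_mul,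
      ← Finset.sum_sub_distrib]
    exact Finset.sum_congr rfl fun i _ => by ring
  rw [← sub_eq_zero, ← map_sub, h, map_sum]
  simp only [avg_DS]
  rw [← Finset.mul_sum, ← map_sum]
  have e : ∑ i, om i * (DS i F * G - F * DS i G)
      = (∑ i, om i * DS i F) * G - F * ∑ i, om i * DS i G := by
    rw [Finset.sum_mul, Finset.mul_sum, ← Finset.sum_sub_distrib]
    exact Finset.sum_congr rfl fun i _ => by ring
  rw [e, om_DS, om_DS]
  simp

end LinGrav
end

noncomputable section
namespace LinGrav
open Set Filter Topology MeasureTheory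

variable {M t0 : ℝ}

/-! ### Means and `l = 1` modes -/

theorem avg_one : avg (1 : SF M t0) = algebraMap ℝ _ (4 * Real.pi) := by
  apply Subtype.ext
  funext x
  change ∫ η, (1 : ℝ) ∂sigma = 4 * Real.pi
  rw [integral_const, sigma_univ, smul_eq_mul, mul_one]

theorem isRadial_algebraMap (c : ℝ) : IsRadial (algebraMap ℝ (SF M t0) c) := fun _ _ _ => rfl
theorem isRadial_one : IsRadial (1 : SF M t0) := fun _ _ _ => rfl
theorem isRadial_zero : IsRadial (0 : SF M t0) := fun _ _ _ => rfl

theorem DQ_avg (a : Fin 2) (F : SF M t0) : DQ a (avg F) = avg (DQ a F) := by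
  fin_cases a
  · exact Dt_avg F
  · exact Dr_avg F

theorem DQ_DS (a : Fin 2) (i : Fin 3) (F : SF M t0) : DQ a (DS i F) = DS i (DQ a F) := by
  fin_cases a
  · exact Dt_DS i F
  · exact Dr_DS i F

theorem DQ_om (a : Fin 2) (i : Fin 3) : DQ a (om (M := M) (t0 := t0) i) = 0 := by
  fin_cases a
  · exact Dt_om i
  · exact Dr_om i

/-- The mean value over the spheres. -/
def mean : SF M t0 →+ SF M t0 where
  toFun F := algebraMap ℝ _ (1 / (4 * Real.pi)) * avg F
  map_zero' := by simp
  map_add' F G := by rw [map_add, mul_add]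

theorem mean_apply (F : SF M t0) : mean F = algebraMap ℝ _ (1 / (4 * Real.pi)) * avg F := rfl

theorem isRadial_mean (F : SF M t0) : IsRadial (mean F) :=
  (isRadial_algebraMap _).mul (isRadial_avg F)

theorem mean_of_isRadial {c : SF M t0} (hc : IsRadial c) : mean c = c := by
  have h := avg_mul_of_isRadial hc 1
  rw [mul_one, avg_one] at h
  rw [mean_apply, h, mul_left_comm, ← map_mul, one_div_mul_cancel (by positivity), map_one, mul_one]

theorem DS_of_isRadial {c : SF M t0} (hc : IsRadial c) (i : Fin 3) : DS i c = 0 := by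
  rw [← mean_of_isRadial hc, mean_apply, ← Algebra.smul_def, Derivation.map_smul, DS_avg, smul_zero]

theorem DQ_algebraMap_mul (a : Fin 2) (c : ℝ) (F : SF M t0) :
    DQ a (algebraMap ℝ _ c * F) = algebraMap ℝ _ c * DQ a F := by
  rw [← Algebra.smul_def, Derivation.map_smul, Algebra.smul_def]

theorem sphereMap_mean : SphereMap (mean (M := M) (t0 := t0)) where
  mul hc F := by rw [mean_apply, avg_mul_of_isRadial hc, mul_left_comm, mean_apply]
  dQ a F := by rw [mean_apply, ← DQ_avg, mean_apply, DQ_algebraMap_mul]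

theorem sphereMap_DS (i : Fin 3) : SphereMap (DS (M := M) (t0 := t0) i : SF M t0 →+ SF M t0) where
  mul hc F := by
    change DS i _ = _ * DS i F
    rw [Derivation.leibniz, DS_of_isRadial hc]; simp
  dQ a F := (DQ_DS a i F).symm

/-- The coefficient of the test function `V`. -/
def coef (V : SF M t0) : SF M t0 →+ SF M t0 where
  toFun F := avg (F * V)
  map_zero' := by simp
  map_add' F G := by rw [add_mul, map_add]

theorem coef_apply (V F : SF M t0) : coef V F = avg (F * V) := rfl

theorem isRadial_coef (V F : SF M t0) : IsRadial (coef V F) := isRadial_avg _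

theorem sphereMap_coef {V : SF M t0} (hV : ∀ a, DQ a V = 0) : SphereMap (coef V) where
  mul hc F := by rw [coef_apply, mul_assoc, avg_mul_of_isRadial hc, coef_apply]
  dQ a F := by
    rw [coef_apply, coef_apply, DQ_avg, Derivation.leibniz, hV, smul_zero, zero_add, smul_eq_mul,
      mul_comm]

theorem mean_lapl (F : SF M t0) : mean (lapl F) = 0 := by
  have h := avg_lapl_mul F 1
  have h0 : lapl (1 : SF M t0) = 0 := by simp [lapl, Derivation.map_one_eq_zero]
  rw [mul_one, h0, mul_zero, map_zero] at h
  rw [mean_apply, h, mul_zero]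

variable (M t0) in
def Ys (k : Fin 3) : SF M t0 := algebraMap ℝ _ √(3 / (4 * Real.pi)) * om k

theorem DQ_Ys (k : Fin 3) (a : Fin 2) : DQ a (Ys M t0 k) = 0 := by
  rw [Ys, DQ_algebraMap_mul, DQ_om, mul_zero]

theorem DS_algebraMap_mul (i : Fin 3) (c : ℝ) (F : SF M t0) :
    DS i (algebraMap ℝ _ c * F) = algebraMap ℝ _ c * DS i F := by
  rw [← Algebra.smul_def, Derivation.map_smul, Algebra.smul_def]

theorem lapl_Ys (k : Fin 3) : lapl (Ys M t0 k) = -2 * Ys M t0 k := by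
  have : lapl (Ys M t0 k) = algebraMap ℝ _ √(3 / (4 * Real.pi)) * lapl (om k) := by
    simp only [lapl, Ys, DS_algebraMap_mul, Finset.mul_sum]
  rw [this, lapl_om, Ys]; ring

theorem coef_Ys_lapl (k : Fin 3) (F : SF M t0) :
    coef (Ys M t0 k) (lapl F) = -2 * coef (Ys M t0 k) F := by
  have h2 : IsRadial (-2 : SF M t0) := fun _ _ _ => rfl
  rw [coef_apply, avg_lapl_mul, lapl_Ys, mul_left_comm, coef_apply, avg_mul_of_isRadial h2]

theorem avg_om (k : Fin 3) : avg (om (M := M) (t0 := t0) k) = 0 := by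
  have h := avg_DS k (1 : SF M t0)
  rw [Derivation.map_one_eq_zero, map_zero, mul_one] at h
  have h2 : (2⁻¹ : ℝ) • (2 * avg (om (M := M) (t0 := t0) k)) = 0 := by rw [← h, smul_zero]
  have h3 : (2 * avg (om (M := M) (t0 := t0) k)) = (2 : ℝ) • avg (om k) := by
    rw [Algebra.smul_def, map_ofNat]
  rwa [h3, smul_smul, inv_mul_cancel₀ two_ne_zero, one_smul] at h2

theorem avg_Ys (k : Fin 3) : avg (Ys M t0 k) = 0 := by
  rw [Ys, avg_mul_of_isRadial (isRadial_algebraMap _), avg_om, mul_zero]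

theorem coef_Ys_of_isRadial {c : SF M t0} (hc : IsRadial c) (k : Fin 3) :
    coef (Ys M t0 k) c = 0 := by
  rw [coef_apply, avg_mul_of_isRadial hc, avg_Ys, mul_zero]

theorem Rep.Y0 : Rep (fun _ _ w => LinGrav.Y0 w) (algebraMap ℝ (SF M t0) (1 / √(4 * Real.pi))) :=
  fun _ _ _ _ => rfl

theorem Rep.Y1 (k : Fin 3) : Rep (fun _ _ w => LinGrav.Y1 k w) (Ys M t0 k) :=
  (Rep.const _).mul (Rep.om k)

theorem Rep.projL0 {f : Scal} {F : SF M t0} (hf : Rep f F) : Rep (LinGrav.projL0 f) (mean F) := by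
  have h := ((hf.mul Rep.Y0).avg).mul Rep.Y0
  -- The two normalising factors of the constant harmonic multiply to 1/(4π), which gives the mean
  -- value.
  have e : LinGrav.avg (F * algebraMap ℝ (SF M t0) (1 / √(4 * Real.pi)))
      * algebraMap ℝ (SF M t0) (1 / √(4 * Real.pi)) = mean F := by
    rw [mul_comm F, avg_mul_of_isRadial (isRadial_algebraMap _), mul_right_comm, ← map_mul,
      mean_apply, div_mul_div_comm, one_mul, Real.mul_self_sqrt (by positivity)]
  rw [e] at h
  exact h

theorem Rep.projL01 {f : Scal} {F : SF M t0} (hf : Rep f F) :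
    Rep (LinGrav.projL01 f) (mean F + ∑ k, coef (Ys M t0 k) F * Ys M t0 k) :=
  hf.projL0.add (Rep.sum fun k => ((hf.mul (Rep.Y1 k)).avg).mul (Rep.Y1 k))

theorem Rep.eq_of {f g : Scal} {F G : SF M t0} (hf : Rep f F) (hg : Rep g G)
    (h : ∀ t r (w : S2), DPlus M t0 t r → f t r w = g t r w) : F = G :=
  Rep.ext hf fun t r ht w => (h t r w ht).trans (hg t r ht w)

theorem Rep.ofNat (n : ℕ) [n.AtLeastTwo] :
    Rep (fun _ _ _ => OfNat.ofNat n) (OfNat.ofNat n : SF M t0) := fun t r h w => by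
  rw [← map_ofNat (algebraMap ℝ (SF M t0))]; rfl

variable [hM : Fact (0 < M)]

section
variable {c : ℝ} {C : SF M t0}

theorem Rep.div_r (hc : Rep (fun _ _ _ => c) C) :
    Rep (fun _ r _ => c / r) (C * LinGrav.rho M t0) := by
  simp only [div_eq_mul_inv]
  exact hc.mul Rep.rho

theorem Rep.div_r_sq (hc : Rep (fun _ _ _ => c) C) :
    Rep (fun _ r _ => c / r ^ 2) (C * LinGrav.rho M t0 ^ 2) := by
  simp only [div_eq_mul_inv]
  exact hc.mul Rep.inv_sq

theorem Rep.ghatL0P {h : Fin 2 → Fin 2 → Scal} {H : Fin 2 → Fin 2 → SF M t0}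
    (hh : ∀ a b, Rep (h a b) (H a b)) (b : Fin 2) :
    Rep (LinGrav.ghatL0P M h b) (ConP (fun a b => mean (H a b)) b) :=
  Rep.conP (fun a b => (hh a b).projL0) b

end

/-! ### The equations as identities between smooth functions -/

namespace IsSolution
variable {S : LinMetric} (hS : IsSolution M t0 S)

def g (a b : Fin 2) : SF M t0 := (hS.smooth_ghat a b).toSF
def q : SF M t0 := hS.smooth_trQ.toSF
def x (a : Fin 2) (i : Fin 3) : SF M t0 := (hS.smooth_cross a i).toSF
def s (i j : Fin 3) : SF M t0 := (hS.smooth_shat i j).toSF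
def p : SF M t0 := hS.smooth_trS.toSF

theorem rep_g (a b : Fin 2) : Rep (S.ghat a b) (hS.g a b) := SmoothScal.rep _
theorem rep_q : Rep S.trQ hS.q := SmoothScal.rep _
theorem rep_x (a : Fin 2) (i : Fin 3) : Rep (S.cross a i) (hS.x a i) := SmoothScal.rep _
theorem rep_s (i j : Fin 3) : Rep (S.shat i j) (hS.s i j) := SmoothScal.rep _
theorem rep_p : Rep S.trS hS.p := SmoothScal.rep _

theorem x_tangent (a : Fin 2) : ∑ i, om i * hS.x a i = 0 :=
  Rep.eq_of (Rep.sum fun i => (Rep.om i).mul (hS.rep_x a i)) Rep.zero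
    fun t r w h => hS.cross_tangent t r w h a

theorem s_tangent_left (j : Fin 3) : ∑ i, om i * hS.s i j = 0 :=
  Rep.eq_of (Rep.sum fun i => (Rep.om i).mul (hS.rep_s i j)) Rep.zero
    fun t r w h => hS.shat_tangent t r w h j

theorem s_symm (i j : Fin 3) : hS.s i j = hS.s j i :=
  Rep.eq_of (hS.rep_s i j) (hS.rep_s j i) fun t r w h => hS.shat_symm t r w h i j

theorem s_tangent_right (i : Fin 3) : ∑ j, om j * hS.s i j = 0 := by
  rw [← hS.s_tangent_left i]
  exact Finset.sum_congr rfl fun j _ => by rw [hS.s_symm]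

theorem sf_ghat (a b : Fin 2) :
    BoxQ2 hS.g a b + rho M t0 ^ 2 * lapl (hS.g a b)
      + 2 * rho M t0 * ∑ c, PS M t0 c * NQ2 hS.g c a b
      - 2 * rho M t0 * NHat2P hS.g a b
      - 4 * rho M t0 * (mus M t0 * rho M t0) * hS.g a b
    = 1 * rho M t0 * HatDr (fun c => DQ c hS.q) a b
      + 2 * rho M t0 * HatDr (fun c => rho M t0 ^ 2 * dv (hS.x c)) a b
      - 1 * rho M t0 * HatDr (fun c => DQ c hS.p) a b
      - NHat1 (fun c => rho M t0 * ConP (fun a b => mean (hS.g a b)) c) a b := by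
  have hL : ∀ a b, Rep (lapS0 (S.ghat a b)) (rho M t0 ^ 2 * lapl (hS.g a b)) := fun a b => by
    have := Rep.lapS0 (hS.rep_g a b)
    rwa [sum_NS1_diag] at this
  have hD : ∀ c, Rep (divS1 (S.cross c)) (rho M t0 ^ 2 * dv (hS.x c)) := fun c => by
    have := Rep.divS1 (hS.rep_x c)
    rwa [sum_NS1_diag] at this
  refine Rep.eq_of ?_ ?_ fun t r w h => hS.eq_ghat t r w h a b
  · exact ((((Rep.boxQ2 hS.rep_g a b).add (hL a b)).add ((Rep.ofNat 2).div_r.mul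
      (Rep.sum fun c => (Rep.P c).mul (Rep.nQ2 hS.rep_g c a b)))).sub
      ((Rep.ofNat 2).div_r.mul (Rep.nHat2P hS.rep_g a b))).sub
      (((Rep.ofNat 4).div_r.mul (by
        simp only [div_eq_mul_inv]; exact Rep.mu.mul Rep.rho)).mul (hS.rep_g a b))
  · exact (((Rep.one.div_r.mul (Rep.hatProd_dr (fun c => hS.rep_q.dQ c) a b)).add
      ((Rep.ofNat 2).div_r.mul (Rep.hatProd_dr hD a b))).sub
      (Rep.one.div_r.mul (Rep.hatProd_dr (fun c => hS.rep_p.dQ c) a b))).sub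
      (Rep.nHat1 (fun c => Rep.rho.mul (Rep.ghatL0P hS.rep_g c)) a b)

theorem sf_trQ :
    BoxQ0 hS.q + rho M t0 ^ 2 * lapl hS.q
    = 2 * rho M t0 * DelQ1 (ConP (fun a b => mean (hS.g a b)))
      - 2 * rho M t0 ^ 2 * ∑ a, PS M t0 a * ConP (fun a b => mean (hS.g a b)) a := by
  have hL : Rep (lapS0 S.trQ) (rho M t0 ^ 2 * lapl hS.q) := by
    have := Rep.lapS0 hS.rep_q
    rwa [sum_NS1_diag] at this
  refine Rep.eq_of ?_ ?_ hS.eq_trQ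
  · exact (Rep.boxQ0 hS.rep_q).add hL
  · exact ((Rep.ofNat 2).div_r.mul (Rep.deltaQ1 (Rep.ghatL0P hS.rep_g))).sub
      ((Rep.ofNat 2).div_r_sq.mul (Rep.sum fun a => (Rep.P a).mul (Rep.ghatL0P hS.rep_g a)))

theorem sf_cross (a : Fin 2) (i : Fin 3) :
    BoxQ1 (fun c => hS.x c i) a + rho M t0 ^ 2 * ∑ j, NS2 (NS1 (hS.x a)) j j i
      - 2 * rho M t0 * ∑ b, PS M t0 b * NQ1 (fun c => hS.x c i) a b
      - 1 * rho M t0 ^ 2 * hS.x a i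
      + 2 * rho M t0 ^ 2 * (drS M t0 a * ∑ b, PS M t0 b * hS.x b i)
    = 2 * rho M t0 * (drS M t0 a * (rho M t0 ^ 2 * ∑ j, NS2 hS.s j j i)) := by
  refine Rep.eq_of ?_ ?_ fun t r w h => hS.eq_cross t r w h a i
  · exact ((((Rep.boxQ1 (fun c => hS.rep_x c i) a).add (Rep.lapS1 (hS.rep_x a) i)).sub
      ((Rep.ofNat 2).div_r.mul (Rep.sum fun b => (Rep.P b).mul
        (Rep.nQ1 (fun c => hS.rep_x c i) a b)))).sub
      (Rep.one.div_r_sq.mul (hS.rep_x a i))).add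
      ((Rep.ofNat 2).div_r_sq.mul ((Rep.dr a).mul (Rep.sum fun b => (Rep.P b).mul (hS.rep_x b i))))
  · exact (Rep.ofNat 2).div_r.mul ((Rep.dr a).mul (Rep.divS2 hS.rep_s i))

theorem sf_shat (i j : Fin 3) :
    BoxQ0 (hS.s i j) + rho M t0 ^ 2 * ∑ k, NS3 (NS2 hS.s) k k i j
      - 2 * rho M t0 * ∑ c, PS M t0 c * DQ c (hS.s i j)
      - 4 * rho M t0 * (mus M t0 * rho M t0) * hS.s i j = 0 := by
  refine Rep.eq_of ?_ Rep.zero fun t r w h => hS.eq_shat t r w h i j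
  exact (((Rep.boxQ0 (hS.rep_s i j)).add (Rep.lapS2 hS.rep_s i j)).sub
      ((Rep.ofNat 2).div_r.mul (Rep.sum fun c => (Rep.P c).mul ((hS.rep_s i j).dQ c)))).sub
      (((Rep.ofNat 4).div_r.mul (by
        simp only [div_eq_mul_inv]; exact Rep.mu.mul Rep.rho)).mul (hS.rep_s i j))

theorem sf_trS :
    BoxQ0 hS.p + rho M t0 ^ 2 * lapl hS.p
      + 2 * rho M t0 * ∑ c, PS M t0 c * DQ c hS.p + 2 * rho M t0 ^ 2 * hS.p
    = 4 * rho M t0 ^ 2 * ∑ a, PS M t0 a * ConP hS.g a + 2 * rho M t0 ^ 2 * hS.q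
      - 4 * rho M t0 ^ 2 * ∑ a, PS M t0 a * ConP (fun a b => mean (hS.g a b)) a := by
  have hL : Rep (lapS0 S.trS) (rho M t0 ^ 2 * lapl hS.p) := by
    have := Rep.lapS0 hS.rep_p
    rwa [sum_NS1_diag] at this
  refine Rep.eq_of ?_ ?_ hS.eq_trS
  · exact (((Rep.boxQ0 hS.rep_p).add hL).add ((Rep.ofNat 2).div_r.mul
      (Rep.sum fun c => (Rep.P c).mul (hS.rep_p.dQ c)))).add ((Rep.ofNat 2).div_r_sq.mul hS.rep_p)
  · exact (((Rep.ofNat 4).div_r_sq.mul (Rep.sum fun a => (Rep.P a).mul (Rep.conP hS.rep_g a))).add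
      ((Rep.ofNat 2).div_r_sq.mul hS.rep_q)).sub
      ((Rep.ofNat 4).div_r_sq.mul (Rep.sum fun a => (Rep.P a).mul (Rep.ghatL0P hS.rep_g a)))

theorem sf_gauge_S (i : Fin 3) :
    -DelQ1 (fun c => hS.x c i) - algebraMap ℝ _ (1 / 2) * DS i hS.q
      + rho M t0 ^ 2 * ∑ j, NS2 hS.s j j i = 0 := by
  refine Rep.eq_of ?_ Rep.zero fun t r w h => hS.gauge_S t r w h i
  exact ((Rep.deltaQ1 (fun c => hS.rep_x c i)).neg.sub
    ((Rep.const _).mul (hS.rep_q.dS i))).add (Rep.divS2 hS.rep_s i)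

end IsSolution

end LinGrav
end

noncomputable section
namespace LinGrav
open Set Filter Topology MeasureTheory

variable {M t0 : ℝ}

/-! ### Cauchy data -/

theorem ZeroOnSigma.of_rep {f : Scal} {F : SF M t0} (hf : Rep f F)
    (h : ∀ r w, 2 * M ≤ r → f t0 r w = 0) : ZeroOnSigma F := by
  rintro ⟨⟨⟨t, r⟩, hx⟩, w⟩ ht
  have ht : t = t0 := ht
  subst ht
  exact (hf t r hx w).symm.trans (h r w hx.2)

theorem ZeroOnSigma.sub_of_rep {f f' : Scal} {F F' : SF M t0} (hf : Rep f F) (hf' : Rep f' F')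
    (h : ∀ r w, 2 * M ≤ r → f t0 r w = f' t0 r w) : ZeroOnSigma (F - F') :=
  ZeroOnSigma.of_rep (hf.sub hf') fun r w hr => sub_eq_zero.2 (h r w hr)

theorem ZeroOnSigma.avg {F : SF M t0} (hF : ZeroOnSigma F) : ZeroOnSigma (avg F) := fun x hx => by
  rw [avg_apply, integral_congr_ae (Eventually.of_forall fun η => hF (x.1, η) hx), integral_zero]

theorem ZeroOnSigma.mul_right {F : SF M t0} (hF : ZeroOnSigma F) (G : SF M t0) :
    ZeroOnSigma (F * G) := fun x hx => by
  change F.1 x * G.1 x = 0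
  rw [hF x hx, zero_mul]

theorem ZeroOnSigma.mul_left {F : SF M t0} (hF : ZeroOnSigma F) (G : SF M t0) :
    ZeroOnSigma (G * F) := mul_comm F G ▸ hF.mul_right G

theorem ZeroOnSigma.add {F G : SF M t0} (hF : ZeroOnSigma F) (hG : ZeroOnSigma G) :
    ZeroOnSigma (F + G) := fun x hx => by
  change F.1 x + G.1 x = 0
  rw [hF x hx, hG x hx, zero_add]

theorem zeroOnSigma_zero : ZeroOnSigma (0 : SF M t0) := fun _ _ => rfl

theorem ZeroOnSigma.sum {ι : Type*} {s : Finset ι} {F : ι → SF M t0}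
    (hF : ∀ i, ZeroOnSigma (F i)) : ZeroOnSigma (∑ i ∈ s, F i) := by
  classical
  induction s using Finset.induction_on with
  | empty => exact zeroOnSigma_zero
  | insert i s hi ih => rw [Finset.sum_insert hi]; exact (hF i).add ih

theorem ZeroOnSigma.mean {F : SF M t0} (hF : ZeroOnSigma F) : ZeroOnSigma (mean F) :=
  hF.avg.mul_left _

theorem ZeroOnSigma.coef {F : SF M t0} (hF : ZeroOnSigma F) (V : SF M t0) :
    ZeroOnSigma (coef V F) := (hF.mul_right V).avg

theorem ZeroOnSigma.apply_sub {F F' : SF M t0} (h : ZeroOnSigma (F - F')) {r : ℝ}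
    (hr : DPlus M t0 t0 r) (w : S2) : F.1 (⟨(t0, r), hr⟩, w) = F'.1 (⟨(t0, r), hr⟩, w) :=
  sub_eq_zero.1 (h _ rfl)

theorem zeroOnSigma_sub {F F' : SF M t0}
    (h : ∀ r (hr : DPlus M t0 t0 r) w, F.1 (⟨(t0, r), hr⟩, w) = F'.1 (⟨(t0, r), hr⟩, w)) :
    ZeroOnSigma (F - F') := by
  rintro ⟨⟨⟨t, r⟩, hx⟩, w⟩ ht
  have ht : t = t0 := ht
  subst ht
  exact sub_eq_zero.2 (h r hx w)

theorem sum_fin_three (W : Fin 3 → Fin 2 → SF M t0) :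
    (fun c => ∑ i, W i c) = W 0 + W 1 + W 2 := by
  funext c; simp only [Fin.sum_univ_three, Pi.add_apply]

variable [hM : Fact (0 < M)]

theorem DQ_mem {ι : Type*} (φ : ι → SF M t0) (c : Fin 2) (I : ι) : DQ c (φ I) ∈ jetIdeal φ := by
  fin_cases c
  · exact Dt_mem φ I
  · exact Dr_mem φ I

theorem nvec_zero_ne {r : ℝ} (hr : 2 * M ≤ r) : nvec M 0 r ≠ 0 := by
  have := r_pos hr
  have hm := hM.out
  change √(1 + mu M r) ≠ 0
  rw [mu]
  positivity

/-- Equal values on Σ give equal r-derivatives there, so equal derivatives along n leave only the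
t*-derivatives, whose coefficient in n is nonzero. -/
theorem ZeroOnSigma.Dt_sub_of_lieN0 {f f' : Scal} {F F' : SF M t0} (hf : Rep f F)
    (hf' : Rep f' F') (h0 : ZeroOnSigma (F - F'))
    (h : ∀ r w, 2 * M ≤ r → lieN0 M t0 f t0 r w = lieN0 M t0 f' t0 r w) :
    ZeroOnSigma (Dt (F - F')) := by
  rw [map_sub]
  refine zeroOnSigma_sub fun r hr w => ?_
  have h1 := h r w hr.2
  have h2 := h0.Dr
  rw [map_sub] at h2
  have h3 := h2.apply_sub hr w
  have a0 := hf.dQ 0 t0 r hr w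
  have a1 := hf.dQ 1 t0 r hr w
  have b0 := hf'.dQ 0 t0 r hr w
  have b1 := hf'.dQ 1 t0 r hr w
  simp only [lieN0, Fin.sum_univ_two] at h1
  rw [a0, a1, b0, b1] at h1
  change _ * (LinGrav.Dt F).1 _ + _ * (LinGrav.Dr F).1 _
    = _ * (LinGrav.Dt F').1 _ + _ * (LinGrav.Dr F').1 _ at h1
  rw [h3] at h1
  exact mul_left_cancel₀ (nvec_zero_ne hr.2) (add_right_cancel h1)

/-- The additional terms of the Lie derivative contain only undifferentiated components, which agree
on Σ and cancel. -/
theorem ZeroOnSigma.Dt_sub_of_lieN1 {f f' : Fin 2 → Scal} {F F' : Fin 2 → SF M t0}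
    (hf : ∀ a, Rep (f a) (F a)) (hf' : ∀ a, Rep (f' a) (F' a))
    (h0 : ∀ a, ZeroOnSigma (F a - F' a)) {a : Fin 2}
    (h : ∀ r w, 2 * M ≤ r → lieN1 M t0 f a t0 r w = lieN1 M t0 f' a t0 r w) :
    ZeroOnSigma (Dt (F a - F' a)) := by
  refine ZeroOnSigma.Dt_sub_of_lieN0 (hf a) (hf' a) (h0 a) fun r w hr => ?_
  have h1 := h r w hr
  have h2 : ∀ b, f b t0 r w = f' b t0 r w := fun b => by
    rw [hf b t0 r ⟨le_rfl, hr⟩, hf' b t0 r ⟨le_rfl, hr⟩, (h0 b).apply_sub ⟨le_rfl, hr⟩]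
  simp only [lieN1, h2] at h1
  exact add_right_cancel h1

theorem ZeroOnSigma.Dt_sub_of_lieN2 {f f' : Fin 2 → Fin 2 → Scal} {F F' : Fin 2 → Fin 2 → SF M t0}
    (hf : ∀ a b, Rep (f a b) (F a b)) (hf' : ∀ a b, Rep (f' a b) (F' a b))
    (h0 : ∀ a b, ZeroOnSigma (F a b - F' a b)) {a b : Fin 2}
    (h : ∀ r w, 2 * M ≤ r → lieN2 M t0 f a b t0 r w = lieN2 M t0 f' a b t0 r w) :
    ZeroOnSigma (Dt (F a b - F' a b)) := by
  refine ZeroOnSigma.Dt_sub_of_lieN0 (hf a b) (hf' a b) (h0 a b) fun r w hr => ?_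
  have h1 := h r w hr
  have h2 : ∀ a b, f a b t0 r w = f' a b t0 r w := fun a b => by
    rw [hf a b t0 r ⟨le_rfl, hr⟩, hf' a b t0 r ⟨le_rfl, hr⟩, (h0 a b).apply_sub ⟨le_rfl, hr⟩]
  simp only [lieN2, h2] at h1
  exact add_right_cancel (add_right_cancel h1)

/-! ### Sums over the indices of the sphere -/

theorem NQ1_add (w w' : Fin 2 → SF M t0) : NQ1 (w + w') = NQ1 w + NQ1 w' := by
  funext c a
  simp only [NQ1, Pi.add_apply, map_add, mul_add, Finset.sum_add_distrib]; ring

theorem NQ2_add (h h' : Fin 2 → Fin 2 → SF M t0) : NQ2 (h + h') = NQ2 h + NQ2 h' := by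
  funext c a b
  simp only [NQ2, Pi.add_apply, map_add, mul_add, Finset.sum_add_distrib]; ring

theorem DelQ1_add (w w' : Fin 2 → SF M t0) : DelQ1 (w + w') = DelQ1 w + DelQ1 w' := by
  simp only [DelQ1, NQ1_add, Pi.add_apply, mul_add, Finset.sum_add_distrib]; ring

theorem BoxQ1_add (w w' : Fin 2 → SF M t0) : BoxQ1 (w + w') = BoxQ1 w + BoxQ1 w' := by
  funext a
  simp only [BoxQ1, NQ1_add, NQ2_add, Pi.add_apply, mul_add, Finset.sum_add_distrib]

/-- Applying a sphere map to each ambient component and summing covers two cases at once: `DS`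
yields the divergence, and `coef` of a vector harmonic yields the pairing with it. -/
theorem sum_map_NQ1
    {T : Fin 3 → SF M t0 →+ SF M t0} (hT : ∀ i, SphereMap (T i))
    (X : Fin 2 → Fin 3 → SF M t0) (c a : Fin 2) :
    ∑ i, T i (NQ1 (fun c => X c i) c a) = NQ1 (fun c => ∑ i, T i (X c i)) c a := by
  rw [sum_fin_three fun i c => T i (X c i), NQ1_add, NQ1_add]
  simp only [(hT _).nQ1, Fin.sum_univ_three, Pi.add_apply]

theorem sum_map_DelQ1
    {T : Fin 3 → SF M t0 →+ SF M t0} (hT : ∀ i, SphereMap (T i))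
    (X : Fin 2 → Fin 3 → SF M t0) :
    ∑ i, T i (DelQ1 fun c => X c i) = DelQ1 (fun c => ∑ i, T i (X c i)) := by
  rw [sum_fin_three fun i c => T i (X c i), DelQ1_add, DelQ1_add]
  simp only [(hT _).delQ1, Fin.sum_univ_three]

theorem sum_map_BoxQ1
    {T : Fin 3 → SF M t0 →+ SF M t0} (hT : ∀ i, SphereMap (T i))
    (X : Fin 2 → Fin 3 → SF M t0) (a : Fin 2) :
    ∑ i, T i (BoxQ1 (fun c => X c i) a) = BoxQ1 (fun c => ∑ i, T i (X c i)) a := by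
  rw [sum_fin_three fun i c => T i (X c i), BoxQ1_add, BoxQ1_add]
  simp only [(hT _).boxQ1, Fin.sum_univ_three, Pi.add_apply]

theorem isRadial_rho_sq : IsRadial (rho M t0 ^ 2) := fun _ _ _ => rfl
theorem isRadial_two_rho_sq : IsRadial (2 * rho M t0 ^ 2) := fun _ _ _ => rfl
theorem isRadial_two_rho : IsRadial (2 * rho M t0) := fun _ _ _ => rfl

/-- The operator of the equation for the mixed part. -/
def crossOp (D L : Fin 2 → SF M t0) (a : Fin 2) : SF M t0 :=
  BoxQ1 D a + rho M t0 ^ 2 * L a - 2 * rho M t0 * ∑ b, PS M t0 b * NQ1 D a b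
    - rho M t0 ^ 2 * D a + 2 * rho M t0 ^ 2 * (drS M t0 a * ∑ b, PS M t0 b * D b)

theorem sum_map_crossOp {T : Fin 3 → SF M t0 →+ SF M t0} (hT : ∀ i, SphereMap (T i))
    (X L : Fin 2 → Fin 3 → SF M t0) (a : Fin 2) :
    ∑ i, T i (crossOp (fun c => X c i) (fun c => L c i) a)
      = crossOp (fun c => ∑ i, T i (X c i)) (fun c => ∑ i, T i (L c i)) a := by
  simp only [crossOp, map_add, map_sub, map_sum, Finset.sum_add_distrib, Finset.sum_sub_distrib,
    (hT _).mul isRadial_rho_sq, (hT _).mul isRadial_two_rho_sq, (hT _).mul isRadial_two_rho,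
    (hT _).mul (isRadial_PS _), (hT _).mul (isRadial_drS _), sum_map_BoxQ1 hT, ← Finset.mul_sum,
    ← sum_map_NQ1 hT]
  rw [Finset.sum_comm (s := Finset.univ (α := Fin 3)),
    Finset.sum_comm (s := Finset.univ (α := Fin 3))]
  simp only [← Finset.mul_sum]

/-- Here `L` is whatever the sphere Laplacian has become after projection; it only has to agree with
`lapl` up to lower order. -/
theorem wave_mem_of_crossOp {D L : Fin 2 → SF M t0} (h : ∀ a, crossOp D L a = 0)
    (hL : ∀ a, L a - lapl (D a) ∈ jetIdeal D) (a : Fin 2) : wave (D a) ∈ jetIdeal D := by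
  have h0 : ∀ a, D a ∈ jetIdeal D := self_mem D
  have h1 : ∀ c a, DQ c (D a) ∈ jetIdeal D := DQ_mem D
  have e : wave (D a) = -(BoxQ1 D a - wave2 (D a)) - rho M t0 ^ 2 * (L a - lapl (D a))
      + 2 * rho M t0 * (∑ b, PS M t0 b * NQ1 D a b) + rho M t0 ^ 2 * D a
      - 2 * rho M t0 ^ 2 * (drS M t0 a * ∑ b, PS M t0 b * D b) := by
    have h2 := h a
    rw [crossOp] at h2
    rw [wave_eq]
    linear_combination h2
  rw [e]
  refine Ideal.sub_mem _ (Ideal.add_mem _ (Ideal.add_mem _ (Ideal.sub_mem _ ?_ ?_) ?_) ?_) ?_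
  · exact neg_mem (BoxQ1_mem h0 h1 a)
  · exact Ideal.mul_mem_left _ _ (hL a)
  · exact Ideal.mul_mem_left _ _ (Ideal.sum_mem _ fun b _ =>
      Ideal.mul_mem_left _ _ (NQ1_mem h0 h1 a b))
  · exact Ideal.mul_mem_left _ _ (h0 a)
  · exact Ideal.mul_mem_left _ _ (Ideal.mul_mem_left _ _
      (Ideal.sum_mem _ fun b _ => Ideal.mul_mem_left _ _ (h0 b)))

/-! ### Vanishing of the traceless `S`-part and of the divergence of the mixed part. -/

namespace IsSolution
variable {S : LinMetric} (hS : IsSolution M t0 S) {𝔪 : ℝ} {𝔞 : S2 → ℝ}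

/-- The equation is homogeneous, and by `sum_NS3_NS2_mem` the ambient components satisfy scalar wave
equations coupled only at lower order. -/
theorem s_eq_zero (hK : IsKerrAdaptedRW M t0 𝔪 𝔞 S) (i j : Fin 3) : hS.s i j = 0 := by
  let φ : Fin 3 × Fin 3 → SF M t0 := fun I => hS.s I.1 I.2
  have z0 : ∀ i j, ZeroOnSigma (hS.s i j) := fun i j =>
    ZeroOnSigma.of_rep (hS.rep_s i j) fun r w hr => hK.shat r w hr i j
  refine eq_zero_of_wave_mem_jetIdeal φ (fun ⟨i, j⟩ => ?_) (fun I => z0 I.1 I.2)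
    (fun ⟨i, j⟩ => ?_) (i, j)
  · have h0 : ∀ i j, hS.s i j ∈ jetIdeal φ := fun i j => self_mem φ (i, j)
    have h1 : ∀ c i j, DQ c (hS.s i j) ∈ jetIdeal φ := fun c i j => DQ_mem φ c (i, j)
    have e : wave (hS.s i j) = -(BoxQ0 (hS.s i j) - wave2 (hS.s i j))
        - rho M t0 ^ 2 * (∑ k, NS3 (NS2 hS.s) k k i j - lapl (hS.s i j))
        + 2 * rho M t0 * (∑ c, PS M t0 c * DQ c (hS.s i j))
        + 4 * rho M t0 * (mus M t0 * rho M t0) * hS.s i j := by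
      rw [wave_eq]
      linear_combination hS.sf_shat i j
    change wave (hS.s i j) ∈ _
    rw [e]
    refine Ideal.add_mem _ (Ideal.add_mem _ (Ideal.sub_mem _ ?_ ?_) ?_) ?_
    · exact neg_mem (BoxQ0_mem fun c => h1 c i j)
    · exact Ideal.mul_mem_left _ _ (sum_NS3_NS2_mem (fun l a b => DS_mem φ (a, b) l)
        hS.s_tangent_left hS.s_tangent_right i j)
    · exact Ideal.mul_mem_left _ _ (Ideal.sum_mem _ fun b _ => Ideal.mul_mem_left _ _ (h1 b i j))
    · exact Ideal.mul_mem_left _ _ (h0 i j)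
  · have := ZeroOnSigma.Dt_sub_of_lieN0 (hS.rep_s i j) (Rep.zero (M := M) (t0 := t0))
      (by rw [sub_zero]; exact z0 i j) fun r w hr => by
        rw [hK.lie_shat r w hr i j]
        simp [lieN0, dQ]
    rwa [sub_zero] at this

theorem sf_crossOp (hK : IsKerrAdaptedRW M t0 𝔪 𝔞 S) (a : Fin 2) (i : Fin 3) :
    crossOp (fun c => hS.x c i) (fun c => ∑ j, NS2 (NS1 (hS.x c)) j j i) a = 0 := by
  have h := hS.sf_cross a i
  have hz : ∑ j, NS2 hS.s j j i = 0 := by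
    simp only [NS2, hS.s_eq_zero hK, map_zero, mul_zero, Finset.sum_const_zero]
  rw [hz] at h
  rw [crossOp]
  linear_combination h

/-- The divergence commutes with the `𝒬`-operators and turns the 1-form Laplacian into `lapl + 1`,
so the source-free equation for the mixed part yields a homogeneous system for its divergence. -/
theorem dv_x_eq_zero (hK : IsKerrAdaptedRW M t0 𝔪 𝔞 S) (a : Fin 2) : dv (hS.x a) = 0 := by
  let D : Fin 2 → SF M t0 := fun a => dv (hS.x a)
  have hD : ∀ c, Rep (divS1 (S.cross c)) (rho M t0 ^ 2 * D c) := fun c => by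
    have := Rep.divS1 (hS.rep_x c)
    rwa [sum_NS1_diag] at this
  -- The data are stated for the divergence of the metric of radius r, which carries the nowhere
  -- vanishing factor 1/r² relative to the unit sphere.
  have zr : ∀ {F : SF M t0}, ZeroOnSigma (rho M t0 ^ 2 * F) → ZeroOnSigma F := fun {F} h x hx => by
    have h2 : (rho M t0).1 x ^ 2 * F.1 x = 0 := h x hx
    have h3 : (rho M t0).1 x ≠ 0 := inv_ne_zero (r_pos x.1.2.2).ne'
    exact (mul_eq_zero.1 h2).resolve_left (pow_ne_zero _ h3)
  have z0 : ∀ a, ZeroOnSigma (rho M t0 ^ 2 * D a) := fun a =>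
    ZeroOnSigma.of_rep (hD a) fun r w hr => hK.div_cross r w hr a
  refine eq_zero_of_wave_mem_jetIdeal D (fun a => ?_) (fun a => zr (z0 a)) (fun a => zr ?_) a
  · refine wave_mem_of_crossOp (L := fun a => lapl (D a) + D a) (fun a => ?_) (fun a => ?_) a
    · have h := sum_map_crossOp sphereMap_DS hS.x (fun c i => ∑ j, NS2 (NS1 (hS.x c)) j j i) a
      simp only [hS.sf_crossOp hK, map_zero, Finset.sum_const_zero] at h
      have e : (fun c => lapl (D c) + D c)
          = fun c => dv (fun i => ∑ j, NS2 (NS1 (hS.x c)) j j i) :=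
        funext fun c => (dv_sum_NS2_NS1 (hS.x_tangent c)).symm
      rw [e]
      exact h.symm
    · rw [add_sub_cancel_left]; exact self_mem D a
  · have := ZeroOnSigma.Dt_sub_of_lieN1 (f := fun c => divS1 (S.cross c)) (f' := fun _ _ _ _ => 0)
      (F' := fun _ => 0) hD (fun _ => Rep.zero) (fun a => by rw [sub_zero]; exact z0 a) (a := a)
      fun r w hr => by
        rw [hK.lie_div_cross r w hr a]
        simp [lieN1, lieN0, dQ]
    rw [sub_zero] at this
    rwa [Derivation.leibniz, Derivation.leibniz_pow, Dt_rho, smul_zero, smul_zero, smul_zero,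
      add_zero] at this

end IsSolution

end LinGrav
end

noncomputable section
namespace LinGrav
open Set Filter Topology MeasureTheory

variable {M t0 : ℝ} [hM : Fact (0 < M)]

/-! ### The linearised Kerr solutions -/

variable (M t0) in
/-- Half of the mass function `μ`. -/
def eps : SF M t0 := M • rho M t0

theorem mus_eq : mus M t0 = 2 * eps M t0 := by
  rw [mus, eps, Algebra.smul_def, Algebra.smul_def, map_mul, map_ofNat, mul_assoc]

theorem Dt_eps : Dt (eps M t0) = 0 := by rw [eps, Derivation.map_smul, Dt_rho, smul_zero]
theorem Dr_eps : Dr (eps M t0) = -(eps M t0 * rho M t0) := by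
  rw [eps, Derivation.map_smul, Dr_rho, smul_neg, smul_mul_assoc]

/-- In terms of M/r the factor 1/2 of the Christoffel symbols cancels, and all entries are integer
polynomials accessible to `ring`. -/
theorem GamS_eq (c a b : Fin 2) : GamS M t0 c a b =
    ![![![2 * eps M t0 ^ 2 * rho M t0, (1 + 2 * eps M t0) * eps M t0 * rho M t0],
        ![(1 + 2 * eps M t0) * eps M t0 * rho M t0, 2 * (1 + eps M t0) * eps M t0 * rho M t0]],
      ![![(1 - 2 * eps M t0) * eps M t0 * rho M t0, -2 * eps M t0 ^ 2 * rho M t0],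
        ![-2 * eps M t0 ^ 2 * rho M t0, -(1 + 2 * eps M t0) * eps M t0 * rho M t0]]] c a b := by
  have half : ∀ {X t : SF M t0}, X = 2 * t → algebraMap ℝ (SF M t0) (1 / 2) * X = t :=
    fun {X t} h => by
      rw [h, ← mul_assoc, ← map_ofNat (algebraMap ℝ (SF M t0)), ← map_mul]; norm_num
  refine half ?_
  fin_cases c <;> fin_cases a <;> fin_cases b <;>
    simp [Fin.sum_univ_two, giS, dgS, mus_eq] <;> ring

theorem giS_eq (a b : Fin 2) : giS M t0 a b =
    ![![-(1 + 2 * eps M t0), 2 * eps M t0], ![2 * eps M t0, 1 - 2 * eps M t0]] a b := by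
  fin_cases a <;> fin_cases b <;> simp [giS, mus_eq]

theorem gS_eq (a b : Fin 2) : gS M t0 a b =
    ![![-(1 - 2 * eps M t0), 2 * eps M t0], ![2 * eps M t0, 1 + 2 * eps M t0]] a b := by
  fin_cases a <;> fin_cases b <;> simp [gS, mus_eq]

theorem PS_eq (a : Fin 2) : PS M t0 a = ![2 * eps M t0, 1 - 2 * eps M t0] a := by
  fin_cases a <;> simp [PS, drS, giS_eq, Fin.sum_univ_two]

theorem fin2_apply {α : Type*} (u v : α) : (![u, v] 0 = u) ∧ (![u, v] 1 = v) := ⟨rfl, rfl⟩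

section Mass
variable (k : SF M t0)

/-- All components of a multiple of (dt* + dr)² are equal. The covariant derivative keeps this form
because the sum of the Christoffel symbols over the upper index does not depend on the lower ones.
-/
theorem NQ2_mass (hk : ∀ a, DQ a k = 0) :
    NQ2 (fun _ _ => k * rho M t0) = fun c _ _ =>
      ![-2 * k * eps M t0 * rho M t0 ^ 2, -k * rho M t0 ^ 2 * (1 + 2 * eps M t0)] c := by
  have h0 : Dt k = 0 := hk 0
  have h1 : Dr k = 0 := hk 1
  funext c a b
  fin_cases c <;> fin_cases a <;> fin_cases b <;>
    simp [NQ2, DQ, Fin.sum_univ_two, GamS_eq, Dt_rho, Dr_rho, h0, h1] <;> ring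

theorem BoxQ2_mass (hk : ∀ a, DQ a k = 0) :
    BoxQ2 (fun _ _ => k * rho M t0) = fun _ _ => 2 * k * rho M t0 ^ 3 * (1 + eps M t0) := by
  have h0 : Dt k = 0 := hk 0
  have h1 : Dr k = 0 := hk 1
  have h3 : ∀ c d a b, NQ3 (NQ2 fun _ _ => k * rho M t0) c d a b =
      DQ c (![-2 * k * eps M t0 * rho M t0 ^ 2, -k * rho M t0 ^ 2 * (1 + 2 * eps M t0)] d)
      - ∑ e, GamS M t0 e c d
        * ![-2 * k * eps M t0 * rho M t0 ^ 2, -k * rho M t0 ^ 2 * (1 + 2 * eps M t0)] e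
      - 2 * (![1, 1] c * eps M t0 * rho M t0)
        * ![-2 * k * eps M t0 * rho M t0 ^ 2, -k * rho M t0 ^ 2 * (1 + 2 * eps M t0)] d :=
      fun c d a b => by
    rw [NQ2_mass k hk]
    simp only [NQ3, ← Finset.sum_mul]
    have hs : ∀ c a, ∑ d, GamS M t0 d c a = eps M t0 * rho M t0 := fun c a => by
      fin_cases c <;> fin_cases a <;> simp [Fin.sum_univ_two, GamS_eq] <;> ring
    have hc : (![1, 1] c : SF M t0) = 1 := by fin_cases c <;> rfl
    rw [hs, hs, hc]
    ring
  funext a b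
  simp only [BoxQ2, h3]
  simp [Fin.sum_univ_two, DQ, giS_eq, GamS_eq, Derivation.leibniz_pow, Dt_rho, Dr_rho, Dt_eps,
    Dr_eps, h0, h1, der_two, Derivation.map_one_eq_zero]
  ring

theorem DelQ2_mass (hk : ∀ a, DQ a k = 0) :
    DelQ2 (fun _ _ => k * rho M t0) = fun _ => k * rho M t0 ^ 2 := by
  funext c
  rw [DelQ2, NQ2_mass k hk]
  simp [Fin.sum_univ_two, giS_eq]
  ring

theorem ConP_mass : ConP (fun _ _ => k * rho M t0) = fun _ => k * rho M t0 := by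
  funext b
  simp only [ConP, Fin.sum_univ_two, PS_eq, fin2_apply]
  ring

theorem NHat2P_mass (hk : ∀ a, DQ a k = 0) :
    NHat2P (fun _ _ => k * rho M t0) = fun _ _ => -k * rho M t0 ^ 2 * (1 + 2 * eps M t0) := by
  funext a b
  rw [NHat2P, NQ2_mass k hk, DelQ2_mass k hk]
  fin_cases a <;> fin_cases b <;> simp [Fin.sum_univ_two, PS_eq, gS_eq] <;> ring

theorem NQ1_mass (hk : ∀ a, DQ a k = 0) :
    NQ1 (fun _ => k * rho M t0) = fun c _ =>
      ![-k * eps M t0 * rho M t0 ^ 2, -k * rho M t0 ^ 2 * (1 + eps M t0)] c := by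
  have h0 : Dt k = 0 := hk 0
  have h1 : Dr k = 0 := hk 1
  funext c a
  fin_cases c <;> fin_cases a <;>
    simp [NQ1, DQ, Fin.sum_univ_two, GamS_eq, Dt_rho, Dr_rho, h0, h1] <;> ring

theorem DelQ1_mass (hk : ∀ a, DQ a k = 0) :
    DelQ1 (fun _ => k * rho M t0) = k * rho M t0 ^ 2 := by
  rw [DelQ1, NQ1_mass k hk]
  simp [Fin.sum_univ_two, giS_eq]
  ring

theorem NHat1_mass (hk : ∀ a, DQ a k = 0) :
    NHat1 (fun _ => rho M t0 * (k * rho M t0))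
      = fun _ _ => 2 * k * rho M t0 ^ 3 * (eps M t0 - 1) := by
  have h0 : Dt k = 0 := hk 0
  have h1 : Dr k = 0 := hk 1
  have h : NQ1 (fun _ => rho M t0 * (k * rho M t0)) = fun c _ =>
      ![-k * eps M t0 * rho M t0 ^ 3, -k * rho M t0 ^ 3 * (2 + eps M t0)] c := by
    funext c a
    fin_cases c <;> fin_cases a <;>
      simp [NQ1, DQ, Fin.sum_univ_two, GamS_eq, Dt_rho, Dr_rho, h0, h1] <;> ring
  funext a b
  rw [NHat1, DelQ1, h]
  fin_cases a <;> fin_cases b <;> simp [Fin.sum_univ_two, giS_eq, gS_eq] <;> ring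

end Mass

/-- The rotating part of the linearised Kerr solutions. -/
theorem crossOp_rotation (k : SF M t0) (hk : ∀ a, DQ a k = 0) (a : Fin 2) :
    crossOp (fun a => k * ![mus M t0, 1 + mus M t0] a)
      (fun a => -(k * ![mus M t0, 1 + mus M t0] a)) a = 0 := by
  have h0 : Dt k = 0 := hk 0
  have h1 : Dr k = 0 := hk 1
  have h : NQ1 (fun a => k * ![mus M t0, 1 + mus M t0] a) = fun c a =>
      ![![-k * eps M t0 * rho M t0, 0],
        ![-2 * k * eps M t0 * rho M t0, -k * eps M t0 * rho M t0]] c a := by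
    funext c a
    fin_cases c <;> fin_cases a <;>
      simp [NQ1, DQ, Fin.sum_univ_two, GamS_eq, mus_eq, Dt_eps, Dr_eps, h0, h1, der_two,
        Derivation.map_one_eq_zero] <;> ring
  simp only [crossOp, BoxQ1, h]
  fin_cases a <;>
    simp [NQ2, Fin.sum_univ_two, DQ, giS_eq, GamS_eq, PS_eq, drS, mus_eq, Dt_rho, Dr_rho, Dt_eps,
      Dr_eps, h0, h1, der_two, Derivation.map_one_eq_zero] <;> ring

theorem crossOp_sub (D D' L L' : Fin 2 → SF M t0) (a : Fin 2) :
    crossOp (fun a => D a - D' a) (fun a => L a - L' a) a = crossOp D L a - crossOp D' L' a := by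
  have h : (fun a => D a - D' a) = D - D' := rfl
  rw [h]
  simp only [crossOp, BoxQ1_sub, NQ1_sub, Pi.sub_apply, mul_sub, Finset.sum_sub_distrib]
  ring

end LinGrav
end

noncomputable section
namespace LinGrav
open Set Filter Topology MeasureTheory

variable {M t0 : ℝ}

theorem lapl_of_isRadial {F : SF M t0} (hF : IsRadial F) : lapl F = 0 := by
  simp [lapl, DS_of_isRadial hF]

variable [hM : Fact (0 < M)]

/-! ### The `l = 0` and `l = 1` modes of the scalar equations -/

def ghatOp (G : Fin 2 → Fin 2 → SF M t0) (l : SF M t0) (a b : Fin 2) : SF M t0 :=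
  BoxQ2 G a b + rho M t0 ^ 2 * (l * G a b) + 2 * rho M t0 * ∑ c, PS M t0 c * NQ2 G c a b
    - 2 * rho M t0 * NHat2P G a b - 4 * rho M t0 * (mus M t0 * rho M t0) * G a b

theorem ghatOp_sub (G G' : Fin 2 → Fin 2 → SF M t0) (l : SF M t0) (a b : Fin 2) :
    ghatOp (G - G') l a b = ghatOp G l a b - ghatOp G' l a b := by
  simp only [ghatOp, BoxQ2_sub, NQ2_sub, NHat2P_sub, Pi.sub_apply, mul_sub,
    Finset.sum_sub_distrib]
  ring

/-- The equations for the modes of `(ĝ̃, tr g̃, tr g̸)` with Laplace eigenvalue `l`, where `H` is the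
`l = 0` part of `ĝ̃`. -/
structure ModeSystem (l : SF M t0) (G H : Fin 2 → Fin 2 → SF M t0) (q p : SF M t0) : Prop where
  ghat : ∀ a b, ghatOp G l a b = rho M t0 * HatDr (fun c => DQ c q) a b
    - rho M t0 * HatDr (fun c => DQ c p) a b - NHat1 (fun c => rho M t0 * ConP H c) a b
  trQ : BoxQ0 q + rho M t0 ^ 2 * (l * q) = 2 * rho M t0 * DelQ1 (ConP H)
    - 2 * rho M t0 ^ 2 * ∑ a, PS M t0 a * ConP H a
  trS : BoxQ0 p + rho M t0 ^ 2 * (l * p) + 2 * rho M t0 * ∑ c, PS M t0 c * DQ c p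
      + 2 * rho M t0 ^ 2 * p
    = 4 * rho M t0 ^ 2 * ∑ a, PS M t0 a * ConP G a + 2 * rho M t0 ^ 2 * q
      - 4 * rho M t0 ^ 2 * ∑ a, PS M t0 a * ConP H a

/-- A system of modes is determined by its Cauchy data. -/
theorem ModeSystem.eq_zero {l : SF M t0} {G H : Fin 2 → Fin 2 → SF M t0} {q p : SF M t0}
    (h : ModeSystem l G H q p) (hH : H = G ∨ H = 0)
    (hG : ∀ a b, IsRadial (G a b)) (hq : IsRadial q) (hp : IsRadial p)
    (zG : ∀ a b, ZeroOnSigma (G a b)) (zq : ZeroOnSigma q) (zp : ZeroOnSigma p)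
    (dG : ∀ a b, ZeroOnSigma (Dt (G a b))) (dq : ZeroOnSigma (Dt q)) (dp : ZeroOnSigma (Dt p)) :
    (∀ a b, G a b = 0) ∧ q = 0 ∧ p = 0 := by
  -- One finite family containing all unknowns; `H` adds none, being either `G` or zero.
  let φ : (Fin 2 × Fin 2) ⊕ Bool → SF M t0 :=
    Sum.elim (fun I => G I.1 I.2) (fun b => if b then q else p)
  have G0 : ∀ a b, G a b ∈ jetIdeal φ := fun a b => self_mem φ (.inl (a, b))
  have q0 : q ∈ jetIdeal φ := self_mem φ (.inr true)
  have p0 : p ∈ jetIdeal φ := self_mem φ (.inr false)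
  have G1 : ∀ c a b, DQ c (G a b) ∈ jetIdeal φ := fun c a b => DQ_mem φ c (.inl (a, b))
  have q1 : ∀ c, DQ c q ∈ jetIdeal φ := fun c => DQ_mem φ c (.inr true)
  have p1 : ∀ c, DQ c p ∈ jetIdeal φ := fun c => DQ_mem φ c (.inr false)
  have H0 : ∀ a b, H a b ∈ jetIdeal φ := fun a b => by
    rcases hH with rfl | rfl
    · exact G0 a b
    · exact zero_mem _
  have H1 : ∀ c a b, DQ c (H a b) ∈ jetIdeal φ := fun c a b => by
    rcases hH with rfl | rfl
    · exact G1 c a b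
    · simp
  have C0 : ∀ b, ConP H b ∈ jetIdeal φ := ConP_mem H0
  have C1 : ∀ c b, DQ c (ConP H b) ∈ jetIdeal φ := ConP_der_mem H0 H1
  have PC : ∑ a, PS M t0 a * ConP H a ∈ jetIdeal φ :=
    Ideal.sum_mem _ fun a _ => Ideal.mul_mem_left _ _ (C0 a)
  have wG : ∀ a b, wave (G a b) ∈ jetIdeal φ := fun a b => by
    have e : wave (G a b) = -(BoxQ2 G a b - wave2 (G a b)) - rho M t0 ^ 2 * (l * G a b)
        - 2 * rho M t0 * (∑ c, PS M t0 c * NQ2 G c a b)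
        + 2 * rho M t0 * NHat2P G a b + 4 * rho M t0 * (mus M t0 * rho M t0) * G a b
        + rho M t0 * HatDr (fun c => DQ c q) a b - rho M t0 * HatDr (fun c => DQ c p) a b
        - NHat1 (fun c => rho M t0 * ConP H c) a b := by
      have h2 := h.ghat a b
      rw [ghatOp] at h2
      -- Mode coefficients are constant on the spheres, so the sphere Laplacian in `wave` vanishes
      -- and the eigenvalue term is merely of order zero.
      rw [wave_eq, lapl_of_isRadial (hG a b)]
      linear_combination h2
    rw [e]
    refine sub_mem (sub_mem (add_mem (add_mem (add_mem (sub_mem (sub_mem ?_ ?_) ?_) ?_) ?_) ?_) ?_)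
      ?_
    · exact neg_mem (BoxQ2_mem G0 G1 a b)
    · exact Ideal.mul_mem_left _ _ (Ideal.mul_mem_left _ _ (G0 a b))
    · exact Ideal.mul_mem_left _ _ (Ideal.sum_mem _ fun c _ =>
        Ideal.mul_mem_left _ _ (NQ2_mem G0 G1 c a b))
    · exact Ideal.mul_mem_left _ _ (NHat2P_mem G0 G1 a b)
    · exact Ideal.mul_mem_left _ _ (G0 a b)
    · exact Ideal.mul_mem_left _ _ (HatDr_mem q1 a b)
    · exact Ideal.mul_mem_left _ _ (HatDr_mem p1 a b)
    · exact NHat1_mem (fun a => Ideal.mul_mem_left _ _ (C0 a))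
        (fun c a => der_mul_mem _ _ (C0 a) (C1 c a)) a b
  have wq : wave q ∈ jetIdeal φ := by
    have e : wave q = -(BoxQ0 q - wave2 q) - rho M t0 ^ 2 * (l * q)
        + 2 * rho M t0 * DelQ1 (ConP H) - 2 * rho M t0 ^ 2 * ∑ a, PS M t0 a * ConP H a := by
      rw [wave_eq, lapl_of_isRadial hq]
      linear_combination h.trQ
    rw [e]
    refine sub_mem (add_mem (sub_mem ?_ ?_) ?_) ?_
    · exact neg_mem (BoxQ0_mem q1)
    · exact Ideal.mul_mem_left _ _ (Ideal.mul_mem_left _ _ q0)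
    · exact Ideal.mul_mem_left _ _ (DelQ1_mem C0 C1)
    · exact Ideal.mul_mem_left _ _ PC
  have wp : wave p ∈ jetIdeal φ := by
    have e : wave p = -(BoxQ0 p - wave2 p) - rho M t0 ^ 2 * (l * p)
        - 2 * rho M t0 * (∑ c, PS M t0 c * DQ c p) - 2 * rho M t0 ^ 2 * p
        + 4 * rho M t0 ^ 2 * (∑ a, PS M t0 a * ConP G a) + 2 * rho M t0 ^ 2 * q
        - 4 * rho M t0 ^ 2 * ∑ a, PS M t0 a * ConP H a := by
      rw [wave_eq, lapl_of_isRadial hp]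
      linear_combination h.trS
    rw [e]
    refine sub_mem (add_mem (add_mem (sub_mem (sub_mem (sub_mem ?_ ?_) ?_) ?_) ?_) ?_) ?_
    · exact neg_mem (BoxQ0_mem p1)
    · exact Ideal.mul_mem_left _ _ (Ideal.mul_mem_left _ _ p0)
    · exact Ideal.mul_mem_left _ _ (Ideal.sum_mem _ fun c _ => Ideal.mul_mem_left _ _ (p1 c))
    · exact Ideal.mul_mem_left _ _ p0
    · exact Ideal.mul_mem_left _ _ (Ideal.sum_mem _ fun c _ =>
        Ideal.mul_mem_left _ _ (ConP_mem G0 c))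
    · exact Ideal.mul_mem_left _ _ q0
    · exact Ideal.mul_mem_left _ _ PC
  have key := eq_zero_of_wave_mem_jetIdeal φ
    (by rintro (⟨a, b⟩ | b)
        · exact wG a b
        · cases b
          · exact wp
          · exact wq)
    (by rintro (⟨a, b⟩ | b)
        · exact zG a b
        · cases b
          · exact zp
          · exact zq)
    (by rintro (⟨a, b⟩ | b)
        · exact dG a b
        · cases b
          · exact dp
          · exact dq)
  exact ⟨fun a b => key (.inl (a, b)), key (.inr true), key (.inr false)⟩

/-- The comparison solution for l = 0: the eigenvalue is 0 and the field is its own spherical mean,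
so it also enters as `H`. -/
theorem modeSystem_mass (k : SF M t0) (hk : ∀ a, DQ a k = 0) :
    ModeSystem 0 (fun _ _ => k * rho M t0) (fun _ _ => k * rho M t0) 0 0 where
  ghat a b := by
    have e : ∀ a b, HatDr (fun c => DQ c (0 : SF M t0)) a b = 0 := fun a b => by simp [HatDr]
    rw [ghatOp, e, ConP_mass, NHat1_mass k hk, BoxQ2_mass k hk, NHat2P_mass k hk, NQ2_mass k hk]
    simp only [Fin.sum_univ_two, PS_eq, fin2_apply, mus_eq]
    ring
  trQ := by
    have e : BoxQ0 (0 : SF M t0) = 0 := by simp [BoxQ0, NQ1]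
    rw [e, ConP_mass, DelQ1_mass k hk]
    simp only [Fin.sum_univ_two, PS_eq, fin2_apply]
    ring
  trS := by
    have e : BoxQ0 (0 : SF M t0) = 0 := by simp [BoxQ0, NQ1]
    rw [e]; simp

theorem BoxQ0_sub (f f' : SF M t0) : BoxQ0 (f - f') = BoxQ0 f - BoxQ0 f' := by
  have : (fun a => DQ a (f - f')) = (fun a => DQ a f) - fun a => DQ a f' :=
    funext fun a => map_sub _ _ _
  simp only [BoxQ0, this, NQ1_sub, Pi.sub_apply, mul_sub, Finset.sum_sub_distrib]

theorem HatDr_sub (w w' : Fin 2 → SF M t0) (a b : Fin 2) :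
    HatDr (w - w') a b = HatDr w a b - HatDr w' a b := by
  simp only [HatDr, Pi.sub_apply, mul_sub, Finset.sum_sub_distrib]; ring

theorem ModeSystem.sub {l : SF M t0} {G H G' H' : Fin 2 → Fin 2 → SF M t0} {q p q' p' : SF M t0}
    (h : ModeSystem l G H q p) (h' : ModeSystem l G' H' q' p') :
    ModeSystem l (G - G') (H - H') (q - q') (p - p') where
  ghat a b := by
    have e : ∀ f f' : SF M t0, (fun c => DQ c (f - f')) = (fun c => DQ c f) - fun c => DQ c f' :=
      fun f f' => funext fun a => map_sub _ _ _
    have e2 : (fun c => rho M t0 * ConP (H - H') c)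
        = (fun c => rho M t0 * ConP H c) - fun c => rho M t0 * ConP H' c := by
      funext c; rw [ConP_sub]; exact mul_sub _ _ _
    rw [ghatOp_sub, h.ghat, h'.ghat, e, e, HatDr_sub, HatDr_sub, e2, NHat1_sub]
    simp only [Pi.sub_apply]
    ring
  trQ := by
    rw [BoxQ0_sub, ConP_sub, DelQ1_sub]
    simp only [Pi.sub_apply, mul_sub, Finset.sum_sub_distrib]
    linear_combination h.trQ - h'.trQ
  trS := by
    rw [BoxQ0_sub, ConP_sub, ConP_sub]
    simp only [Pi.sub_apply, map_sub, mul_sub, Finset.sum_sub_distrib]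
    linear_combination h.trS - h'.trS

namespace IsSolution
variable {S : LinMetric} (hS : IsSolution M t0 S) {𝔪 : ℝ} {𝔞 : S2 → ℝ}

/-- Once div ω vanishes, these equations no longer involve the mixed part, and any sphere map that
diagonalises the Laplacian gives a closed system. -/
theorem modeSystem (hK : IsKerrAdaptedRW M t0 𝔪 𝔞 S) {T : SF M t0 →+ SF M t0} (hT : SphereMap T)
    {l : SF M t0} (hl : ∀ F, T (lapl F) = l * T F) :
    ModeSystem l (fun a b => T (hS.g a b)) (fun a b => T (mean (hS.g a b))) (T hS.q) (T hS.p) := by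
  have r1 : IsRadial (rho M t0 ^ 2) := isRadial_rho_sq
  have r2 : IsRadial (2 * rho M t0 ^ 2) := isRadial_two_rho_sq
  have r3 : IsRadial (2 * rho M t0) := isRadial_two_rho
  have r4 : IsRadial (4 * rho M t0 ^ 2) := fun _ _ _ => rfl
  have r5 : IsRadial (4 * rho M t0 * (mus M t0 * rho M t0)) := fun _ _ _ => rfl
  have hP : ∀ H : Fin 2 → Fin 2 → SF M t0,
      T (∑ a, PS M t0 a * ConP H a) = ∑ a, PS M t0 a * ConP (fun a b => T (H a b)) a := fun H => by
    simp only [map_sum, hT.mul (isRadial_PS _), hT.conP]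
  constructor
  · intro a b
    have h := congrArg T (hS.sf_ghat a b)
    have hD : HatDr (fun c => rho M t0 ^ 2 * dv (hS.x c)) a b = 0 := by
      simp only [hS.dv_x_eq_zero hK]
      simp [HatDr]
    rw [hD, mul_zero, add_zero, one_mul] at h
    simp only [map_add, map_sub, hT.boxQ2, hT.mul r1, hT.mul r3, hT.mul r5, hl, hT.nHat2P,
      hT.mul isRadial_rho, hT.hatDr, hT.nHat1, hT.conP, hT.dQ, map_sum, hT.mul (isRadial_PS _),
      hT.nQ2] at h
    rw [ghatOp, h]
  · have h := congrArg T hS.sf_trQ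
    simp only [map_add, map_sub, hT.boxQ0, hT.mul r1, hT.mul r2, hT.mul r3, hl, hT.delQ1, hT.conP,
      hP] at h
    exact h
  · have h := congrArg T hS.sf_trS
    have hQ : T (∑ c, PS M t0 c * DQ c hS.p) = ∑ c, PS M t0 c * DQ c (T hS.p) := by
      simp only [map_sum, hT.mul (isRadial_PS _), hT.dQ]
    simp only [map_add, map_sub, hT.boxQ0, hT.mul r1, hT.mul r2, hT.mul r3, hT.mul r4, hl, hP,
      hQ] at h
    exact h

end IsSolution

end LinGrav
end

noncomputable section
namespace LinGrav
open Set Filter Topology MeasureTheory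

variable {M t0 : ℝ}

/-! ### Functions with vanishing gradient along the spheres -/

/-- The degree-zero extension factors through y ↦ y/‖y‖, so its derivative vanishes on all of the
connected set ℝ³ minus the origin. -/
theorem isRadial_of_DS_eq_zero {F : SF M t0} (hF : ∀ i, DS i F = 0) : IsRadial F := by
  rintro ⟨⟨t, r⟩, h⟩ w w'
  have h0 : ∀ v : S2, HasFDerivAt (fun y : E3 => F.ext (t, r, y)) (0 : E3 →L[ℝ] ℝ) (v : E3) :=
      fun v => by
    have h1 := F.hasFDerivAt_sphere h v
    refine h1.congr_fderiv ?_
    refine ContinuousLinearMap.coe_injective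
      ((EuclideanSpace.basisFun (Fin 3) ℝ).toBasis.ext fun i => ?_)
    have h2 : (DS i F).1 (⟨(t, r), h⟩, v) = 0 := by rw [hF i]; rfl
    have h3 : (fderivWithin ℝ F.ext (region M t0) (t, r, (v : E3)))
        (0, 0, EuclideanSpace.single i 1) = 0 := h2
    simpa using h3
  have hs : IsPreconnected ({(0 : E3)}ᶜ : Set E3) :=
    (isConnected_compl_singleton_of_one_lt_rank (by
      rw [← Module.finrank_eq_rank, finrank_euclideanSpace_fin]; norm_num) 0).isPreconnected
  have hd : ∀ y ∈ ({(0 : E3)}ᶜ : Set E3),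
      HasFDerivAt (fun y : E3 => F.ext (t, r, y)) (0 : E3 →L[ℝ] ℝ) y := fun y hy => by
    have hy : y ≠ 0 := hy
    have hn : DifferentiableAt ℝ (fun z : E3 => ‖z‖⁻¹ • z) y :=
      (((contDiffAt_norm ℝ hy).differentiableAt (n := 1) one_ne_zero).inv
        (norm_ne_zero_iff.2 hy)).smul differentiableAt_id
    have e : ‖y‖⁻¹ • y = (toS2 y : E3) := by simp [toS2, hy]
    have h1 := h0 (toS2 y)
    rw [← e] at h1
    have h2 := HasFDerivAt.comp (g := fun y : E3 => F.ext (t, r, y))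
      (f := fun z : E3 => ‖z‖⁻¹ • z) y h1 hn.hasFDerivAt
    rw [ContinuousLinearMap.zero_comp] at h2
    refine h2.congr_of_eventuallyEq ?_
    filter_upwards [isOpen_compl_singleton.mem_nhds hy] with z hz
    have hz : z ≠ 0 := hz
    simp [SF.ext, retract, toS2_smul (inv_pos.2 (norm_pos_iff.2 hz))]
  have hc := isOpen_compl_singleton.is_const_of_fderiv_eq_zero (𝕜 := ℝ) hs
    (fun y hy => (hd y hy).differentiableAt.differentiableWithinAt) (fun y hy => (hd y hy).fderiv)
    (coe_S2_ne w) (coe_S2_ne w')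
  simpa only [F.ext_mk h] using hc

/-- If ΔF = 0 then Δ(F²) is twice the squared gradient, and its integral over the sphere is zero. -/
theorem DS_eq_zero_of_lapl_eq_zero {F : SF M t0} (hF : lapl F = 0) (i : Fin 3) : DS i F = 0 := by
  have h := congrArg avg (lapl_mul F F)
  have h2 : avg (lapl (F * F)) = 0 := by
    have := avg_lapl_mul (F * F) 1
    have h0 : lapl (1 : SF M t0) = 0 := lapl_of_isRadial isRadial_one
    rwa [mul_one, h0, mul_zero, map_zero] at this
  rw [h2, hF, mul_zero, zero_add, add_zero,
    avg_mul_of_isRadial (G := 2) (fun _ _ _ => rfl)] at h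
  apply Subtype.ext
  funext ⟨b, w⟩
  have happ : ∀ w, (∑ i, DS i F * DS i F).1 (b, w) = ∑ i, (DS i F).1 (b, w) * (DS i F).1 (b, w) :=
    fun w => by simp
  have h3 : (avg (∑ i, DS i F * DS i F)).1 (b, w) = 0 := by
    have h4 := congrArg (fun G : SF M t0 => G.1 (b, w)) h
    have h5 : 0 = 2 * (avg (∑ i, DS i F * DS i F)).1 (b, w) := h4
    linarith
  have h6 := eq_zero_of_avg_eq_zero (fun w => by
    rw [happ]; exact Finset.sum_nonneg fun i _ => mul_self_nonneg _) h3 w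
  rw [happ] at h6
  have h7 := (Finset.sum_eq_zero_iff_of_nonneg fun i _ => mul_self_nonneg _).1 h6 i
    (Finset.mem_univ i)
  exact mul_self_eq_zero.1 h7

/-! ### Orthogonality of the `l = 0, 1` harmonics -/

theorem coef_mul_of_isRadial {c : SF M t0} (hc : IsRadial c) (V F : SF M t0) :
    coef V (c * F) = c * coef V F := by
  rw [coef_apply, mul_assoc, avg_mul_of_isRadial hc, coef_apply]

/-- Integrating the derivative of a coordinate in two ways shows that three times the integral
equals 4π times the Kronecker delta. -/
theorem avg_om_mul_om (k l : Fin 3) : avg (om k * om (M := M) (t0 := t0) l)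
    = algebraMap ℝ _ (4 * Real.pi / 3) * (if k = l then 1 else 0) := by
  have h := avg_DS k (om (M := M) (t0 := t0) l)
  have hd : avg (if k = l then 1 else 0 : SF M t0)
      = algebraMap ℝ _ (4 * Real.pi) * (if k = l then 1 else 0) := by
    split_ifs
    · rw [avg_one, mul_one]
    · rw [map_zero, mul_zero]
  have h2 : avg (2 * (om (M := M) (t0 := t0) k * om l)) = 2 * avg (om k * om l) :=
    avg_mul_of_isRadial (fun _ _ _ => rfl) _
  rw [DS_om, map_sub, hd] at h
  have h3 : algebraMap ℝ (SF M t0) (4 * Real.pi) = 3 * algebraMap ℝ _ (4 * Real.pi / 3) := by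
    rw [← map_ofNat (algebraMap ℝ (SF M t0)) 3, ← map_mul]; congr 1; ring
  have h4 : algebraMap ℝ (SF M t0) (1 / 3) * 3 = 1 := by
    rw [← map_ofNat (algebraMap ℝ (SF M t0)) 3, ← map_mul]; norm_num
  rw [h3] at h
  linear_combination (-algebraMap ℝ (SF M t0) (1 / 3)) * h
    + (algebraMap ℝ (SF M t0) (4 * Real.pi / 3) * (if k = l then 1 else 0)
        - avg (om k * om l)) * h4

theorem sqrt_sq_algebraMap : algebraMap ℝ (SF M t0) √(3 / (4 * Real.pi))
    * algebraMap ℝ (SF M t0) √(3 / (4 * Real.pi)) = algebraMap ℝ _ (3 / (4 * Real.pi)) := by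
  rw [← map_mul, Real.mul_self_sqrt (by positivity)]

theorem coef_Ys_Ys (k l : Fin 3) : coef (Ys M t0 k) (Ys M t0 l) = if k = l then 1 else 0 := by
  have e : Ys M t0 l * Ys M t0 k = algebraMap ℝ _ (3 / (4 * Real.pi)) * (om k * om l) := by
    rw [Ys, Ys, ← sqrt_sq_algebraMap]; ring
  rw [coef_apply, e, avg_mul_of_isRadial (isRadial_algebraMap _), avg_om_mul_om, ← mul_assoc,
    ← map_mul]
  have : 3 / (4 * Real.pi) * (4 * Real.pi / 3) = 1 := by field_simp
  rw [this, map_one, one_mul]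

theorem mean_Ys (k : Fin 3) : mean (Ys M t0 k) = 0 := by rw [mean_apply, avg_Ys, mul_zero]

/-- The projection to the `l = 0, 1` harmonics. -/
def harm (F : SF M t0) : SF M t0 := mean F + ∑ k, coef (Ys M t0 k) F * Ys M t0 k

theorem mean_harm (F : SF M t0) : mean (harm F) = mean F := by
  rw [harm, map_add, map_sum, mean_of_isRadial (isRadial_mean F)]
  simp only [sphereMap_mean.mul (isRadial_coef _ _), mean_Ys, mul_zero, Finset.sum_const_zero,
    add_zero]

theorem coef_harm (l : Fin 3) (F : SF M t0) : coef (Ys M t0 l) (harm F) = coef (Ys M t0 l) F := by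
  rw [harm, map_add, map_sum, coef_Ys_of_isRadial (isRadial_mean F), zero_add]
  simp only [coef_mul_of_isRadial (isRadial_coef _ _), coef_Ys_Ys, mul_ite, mul_one, mul_zero,
    Finset.sum_ite_eq, Finset.mem_univ, if_true]

/-! ### Vector harmonics and the l = 1 part of 1-forms. -/

def crossS (X : Fin 3 → SF M t0) (i : Fin 3) : SF M t0 :=
  crossProduct (fun j => om j) X i

theorem Rep.starS {ξ : Fin 3 → Scal} {X : Fin 3 → SF M t0} (h : ∀ i, Rep (ξ i) (X i)) (i : Fin 3) :
    Rep (LinGrav.starS ξ i) (crossS X i) := by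
  fin_cases i
  · exact ((Rep.om 1).mul (h 2)).sub ((Rep.om 2).mul (h 1))
  · exact ((Rep.om 2).mul (h 0)).sub ((Rep.om 0).mul (h 2))
  · exact ((Rep.om 0).mul (h 1)).sub ((Rep.om 1).mul (h 0))

variable (M t0) in
/-- The even vector harmonics. -/
def GYs (k i : Fin 3) : SF M t0 := DS i (Ys M t0 k)

variable (M t0) in
/-- The odd vector harmonics. -/
def SGs (k i : Fin 3) : SF M t0 := crossS (GYs M t0 k) i

theorem Rep.gradY1 (k i : Fin 3) : Rep (LinGrav.gradY1 k i) (GYs M t0 k i) := (Rep.Y1 k).dS i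

theorem Rep.starGradY1 (k i : Fin 3) : Rep (LinGrav.starGradY1 k i) (SGs M t0 k i) :=
  Rep.starS (Rep.gradY1 k) i

theorem GYs_eq (k i : Fin 3) : GYs M t0 k i
    = algebraMap ℝ _ √(3 / (4 * Real.pi)) * ((if i = k then 1 else 0) - om i * om k) := by
  rw [GYs, Ys, DS_algebraMap_mul, DS_om]

/-- The normal part of the projected basis vector is killed by the cross product with ω, leaving ω ×
e_k, a rotation field. Its components are linear in ω, hence have mean zero and Laplace eigenvalue
-2. -/
theorem SGs_eq (k i : Fin 3) : SGs M t0 k i = algebraMap ℝ _ √(3 / (4 * Real.pi))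
    * ![![0, om 2, -om 1], ![-om 2, 0, om 0], ![om 1, -om 0, 0]] k i := by
  fin_cases k <;> fin_cases i <;> simp [SGs, crossS, cross_apply, GYs_eq] <;> ring

theorem DQ_SGs (a : Fin 2) (k i : Fin 3) : DQ a (SGs M t0 k i) = 0 := by
  rw [SGs_eq, DQ_algebraMap_mul]
  fin_cases k <;> fin_cases i <;> simp [DQ_om]

theorem avg_SGs (k i : Fin 3) : avg (SGs M t0 k i) = 0 := by
  rw [SGs_eq, avg_mul_of_isRadial (isRadial_algebraMap _)]
  fin_cases k <;> fin_cases i <;> simp [avg_om]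

theorem lapl_algebraMap_mul (c : ℝ) (F : SF M t0) :
    lapl (algebraMap ℝ _ c * F) = algebraMap ℝ _ c * lapl F := by
  simp only [lapl, DS_algebraMap_mul, Finset.mul_sum]

theorem lapl_neg (F : SF M t0) : lapl (-F) = -lapl F := by simp [lapl]

theorem lapl_SGs (k i : Fin 3) : lapl (SGs M t0 k i) = -2 * SGs M t0 k i := by
  have h0 : lapl (0 : SF M t0) = 0 := by simp [lapl]
  rw [SGs_eq, lapl_algebraMap_mul, mul_left_comm]
  congr 1
  fin_cases k <;> fin_cases i <;> simp [lapl_om, lapl_neg, h0] <;> ring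

/-- The inner product of 1-forms on the spheres. -/
def pairing (U V : Fin 3 → SF M t0) : SF M t0 := ∑ i, coef (V i) (U i)

theorem pairing_eq (U V : Fin 3 → SF M t0) : pairing U V = avg (∑ i, U i * V i) := by
  rw [map_sum]; rfl

theorem pairing_SGs_SGs (k l : Fin 3) :
    pairing (SGs M t0 k) (SGs M t0 l) = if k = l then 2 else 0 := by
  have e : ∑ i, SGs M t0 k i * SGs M t0 l i = algebraMap ℝ _ (3 / (4 * Real.pi))
      * ((if k = l then 1 else 0) - om k * om l) := by
    rw [← om_sq, ← sqrt_sq_algebraMap]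
    simp only [SGs_eq, Fin.sum_univ_three]
    fin_cases k <;> fin_cases l <;> simp <;> ring
  have e2 : avg (if k = l then 1 else 0 : SF M t0)
      = algebraMap ℝ _ (4 * Real.pi) * (if k = l then 1 else 0) := by
    split_ifs
    · rw [avg_one, mul_one]
    · rw [map_zero, mul_zero]
  rw [pairing_eq, e, avg_mul_of_isRadial (isRadial_algebraMap _), map_sub, avg_om_mul_om, e2,
    ← sub_mul, ← mul_assoc, ← map_sub, ← map_mul]
  have : 3 / (4 * Real.pi) * (4 * Real.pi - 4 * Real.pi / 3) = 2 := by field_simp; norm_num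
  rw [this, map_ofNat, mul_ite, mul_one, mul_zero]

/-- The odd harmonic is tangential, so contracting it with a projected basis vector returns one of
its components, which has mean zero. -/
theorem pairing_GYs_SGs (k l : Fin 3) : pairing (GYs M t0 k) (SGs M t0 l) = 0 := by
  have e : ∑ i, GYs M t0 k i * SGs M t0 l i
      = algebraMap ℝ _ √(3 / (4 * Real.pi)) * SGs M t0 l k := by
    simp only [SGs_eq, GYs_eq, Fin.sum_univ_three]
    fin_cases k <;> fin_cases l <;> simp <;> ring
  rw [pairing_eq, e, avg_mul_of_isRadial (isRadial_algebraMap _), avg_SGs, mul_zero]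

theorem pairing_add (U U' V : Fin 3 → SF M t0) :
    pairing (fun i => U i + U' i) V = pairing U V + pairing U' V := by
  simp only [pairing, map_add, Finset.sum_add_distrib]

theorem pairing_sum {ι : Type*} (s : Finset ι) (U : ι → Fin 3 → SF M t0) (V : Fin 3 → SF M t0) :
    pairing (fun i => ∑ k ∈ s, U k i) V = ∑ k ∈ s, pairing (U k) V := by
  simp only [pairing, map_sum]
  exact Finset.sum_comm

theorem pairing_mul {c : SF M t0} (hc : IsRadial c) (U V : Fin 3 → SF M t0) :
    pairing (fun i => c * U i) V = c * pairing U V := by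
  simp only [pairing, coef_mul_of_isRadial hc, Finset.mul_sum]

theorem pairing_sub (U U' V : Fin 3 → SF M t0) :
    pairing (fun i => U i - U' i) V = pairing U V - pairing U' V := by
  simp only [pairing, map_sub, Finset.sum_sub_distrib]

theorem isRadial_pairing (U V : Fin 3 → SF M t0) : IsRadial (pairing U V) :=
  IsRadial.sum fun _ => isRadial_coef _ _

theorem DQ_pairing_SGs (a : Fin 2) (U : Fin 3 → SF M t0) (l : Fin 3) :
    DQ a (pairing U (SGs M t0 l)) = pairing (fun i => DQ a (U i)) (SGs M t0 l) := by
  rw [pairing, pairing, map_sum]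
  exact Finset.sum_congr rfl fun i _ =>
    ((sphereMap_coef fun a => DQ_SGs a l i).dQ a (U i)).symm

theorem ZeroOnSigma.pairing {U : Fin 3 → SF M t0} (hU : ∀ i, ZeroOnSigma (U i))
    (V : Fin 3 → SF M t0) : ZeroOnSigma (pairing U V) :=
  ZeroOnSigma.sum fun i => (hU i).coef (V i)

/-- The projection of a 1-form to the `l = 1` vector harmonics. -/
def harmForm (U : Fin 3 → SF M t0) (i : Fin 3) : SF M t0 :=
  ∑ k, algebraMap ℝ _ (1 / 2) * (pairing U (GYs M t0 k) * GYs M t0 k i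
    + pairing U (SGs M t0 k) * SGs M t0 k i)

theorem Rep.projL01Form {ξ : Fin 3 → Scal} {X : Fin 3 → SF M t0} (h : ∀ i, Rep (ξ i) (X i))
    (i : Fin 3) : Rep (LinGrav.projL01Form ξ i) (harmForm X i) := by
  refine Rep.sum fun k => (Rep.const _).mul (Rep.add ?_ ?_)
  · rw [pairing_eq]
    exact (Rep.sum fun j => (h j).mul (Rep.gradY1 k j)).avg.mul (Rep.gradY1 k i)
  · rw [pairing_eq]
    exact (Rep.sum fun j => (h j).mul (Rep.starGradY1 k j)).avg.mul (Rep.starGradY1 k i)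

theorem half_mul_two : algebraMap ℝ (SF M t0) (1 / 2) * 2 = 1 := by
  rw [← map_ofNat (algebraMap ℝ (SF M t0)), ← map_mul]; norm_num

theorem pairing_harmForm (U : Fin 3 → SF M t0) (l : Fin 3) :
    pairing (harmForm U) (SGs M t0 l) = pairing U (SGs M t0 l) := by
  change pairing (fun i => harmForm U i) _ = _
  simp only [harmForm]
  rw [pairing_sum]
  simp only [pairing_mul (isRadial_algebraMap _), pairing_add, pairing_mul (isRadial_pairing _ _),
    pairing_GYs_SGs, pairing_SGs_SGs, mul_zero, zero_add, mul_ite, Finset.sum_ite_eq',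
    Finset.mem_univ, if_true]
  linear_combination pairing U (SGs M t0 l) * half_mul_two (M := M) (t0 := t0)

/-- The even modes of a divergence-free tangential 1-form vanish. -/
theorem pairing_GYs_eq_zero {U : Fin 3 → SF M t0} (hU : ∑ i, om i * U i = 0) (hd : dv U = 0)
    (k : Fin 3) : pairing U (GYs M t0 k) = 0 := by
  -- The field `U` times a function is still tangential, so its divergence integrates to zero.
  have h : ∑ i, avg (DS i (U i * Ys M t0 k)) = 0 := by
    simp only [avg_DS, ← Finset.mul_sum, ← map_sum, ← mul_assoc, ← Finset.sum_mul, hU, zero_mul,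
      map_zero, mul_zero]
  have e : ∑ i, DS i (U i * Ys M t0 k) = dv U * Ys M t0 k + ∑ i, U i * GYs M t0 k i := by
    simp only [Derivation.leibniz, smul_eq_mul, Finset.sum_add_distrib, dv, GYs, Finset.sum_mul]
    rw [add_comm]
    congr 1
    exact Finset.sum_congr rfl fun i _ => mul_comm _ _
  rw [← map_sum, e, hd, zero_mul, zero_add] at h
  rw [pairing_eq, h]

end LinGrav
end

noncomputable section
namespace LinGrav
open Set Filter Topology MeasureTheory

variable {M t0 : ℝ}

variable [hM : Fact (0 < M)]

theorem ZeroOnSigma.Dt_sphereMap {T : SF M t0 →+ SF M t0} (hT : SphereMap T)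
    (hz : ∀ {F}, ZeroOnSigma F → ZeroOnSigma (T F)) {F : SF M t0} (h : ZeroOnSigma (Dt F)) :
    ZeroOnSigma (Dt (T F)) := by
  have := hT.dQ 0 F
  change T (LinGrav.Dt F) = LinGrav.Dt (T F) at this
  rw [← this]
  exact hz h

/-! ### Identification of the l = 0, 1 part and vanishing of the `𝒬`-trace. -/

namespace IsSolution
variable {S : LinMetric} (hS : IsSolution M t0 S) {𝔪 : ℝ} {𝔞 : S2 → ℝ}

theorem rep_kerr_ghat (a b : Fin 2) : Rep ((kerr M 𝔪 𝔞).ghat a b)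
    (algebraMap ℝ (SF M t0) (2 * 𝔪) * LinGrav.rho M t0) := (Rep.const _).div_r

theorem rep_kerr_cross {c : Fin 3 → ℝ} (hc : ∀ w, 𝔞 w = ∑ k, c k * Y1 k w) (a : Fin 2)
    (i : Fin 3) : Rep ((kerr M 𝔪 𝔞).cross a i)
      (![mus M t0, 1 + mus M t0] a * ∑ k, algebraMap ℝ _ (c k) * SGs M t0 k i) := by
  have h1 : Rep (fun _ _ w => 𝔞 w) (∑ k, algebraMap ℝ (SF M t0) (c k) * Ys M t0 k) := by
    simp only [hc]
    exact Rep.sum fun k => (Rep.const _).mul (Rep.Y1 k)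
  have h2 : Rep (fun _ r _ => ![mu M r, 1 + mu M r] a) (![mus M t0, 1 + mus M t0] a) := by
    fin_cases a
    · exact Rep.mu
    · exact Rep.one.add Rep.mu
  refine h2.mul ?_
  have h3 := Rep.starS (fun j => h1.dS j) i
  have e : crossS (fun j => DS j (∑ k, algebraMap ℝ (SF M t0) (c k) * Ys M t0 k)) i
      = ∑ k, algebraMap ℝ _ (c k) * SGs M t0 k i := by
    simp only [map_sum, DS_algebraMap_mul, SGs, crossS, cross_apply, GYs]
    fin_cases i <;> simp [Fin.sum_univ_three] <;> ring
  rw [e] at h3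
  exact h3

theorem zero_g (hK : IsKerrAdaptedRW M t0 𝔪 𝔞 S) (a b : Fin 2) :
    ZeroOnSigma (harm (hS.g a b) - algebraMap ℝ (SF M t0) (2 * 𝔪) * rho M t0) :=
  ZeroOnSigma.sub_of_rep (hS.rep_g a b).projL01 (rep_kerr_ghat a b)
    fun r w hr => ((hK.kerr_data r hr).1 w).1 a b

theorem zero_q (hK : IsKerrAdaptedRW M t0 𝔪 𝔞 S) : ZeroOnSigma (harm hS.q - 0) :=
  ZeroOnSigma.sub_of_rep hS.rep_q.projL01 Rep.zero fun r w hr => ((hK.kerr_data r hr).1 w).2.1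

theorem zero_p (hK : IsKerrAdaptedRW M t0 𝔪 𝔞 S) : ZeroOnSigma (harm hS.p - 0) :=
  ZeroOnSigma.sub_of_rep hS.rep_p.projL01 Rep.zero
    fun r w hr => ((hK.kerr_data r hr).1 w).2.2.2.2

theorem zero_Dt_g (hK : IsKerrAdaptedRW M t0 𝔪 𝔞 S) (a b : Fin 2) :
    ZeroOnSigma (Dt (harm (hS.g a b) - algebraMap ℝ (SF M t0) (2 * 𝔪) * rho M t0)) :=
  ZeroOnSigma.Dt_sub_of_lieN2 (fun a b => (hS.rep_g a b).projL01)
    (fun a b => rep_kerr_ghat (𝔞 := 𝔞) a b) (hS.zero_g hK)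
    fun r w hr => ((hK.kerr_data r hr).2 w).1 a b

theorem zero_Dt_q (hK : IsKerrAdaptedRW M t0 𝔪 𝔞 S) : ZeroOnSigma (Dt (harm hS.q - 0)) :=
  ZeroOnSigma.Dt_sub_of_lieN0 hS.rep_q.projL01 Rep.zero (hS.zero_q hK)
    fun r w hr => ((hK.kerr_data r hr).2 w).2.1

theorem zero_Dt_p (hK : IsKerrAdaptedRW M t0 𝔪 𝔞 S) : ZeroOnSigma (Dt (harm hS.p - 0)) :=
  ZeroOnSigma.Dt_sub_of_lieN0 hS.rep_p.projL01 Rep.zero (hS.zero_p hK)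
    fun r w hr => ((hK.kerr_data r hr).2 w).2.2.2.2

theorem DQ_algebraMap (a : Fin 2) (c : ℝ) : DQ a (algebraMap ℝ (SF M t0) c) = 0 :=
  Derivation.map_algebraMap _ _

/-- Taking means twice changes nothing, so ξ is expressed by the unknowns of the l = 0 system.
Subtracting the mass solution leaves a solution with zero data. -/
theorem mean_eq (hK : IsKerrAdaptedRW M t0 𝔪 𝔞 S) :
    (∀ a b, mean (hS.g a b) = algebraMap ℝ (SF M t0) (2 * 𝔪) * rho M t0)
      ∧ mean hS.q = 0 ∧ mean hS.p = 0 := by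
  have hm : ∀ F : SF M t0, mean (mean F) = mean F := fun F => mean_of_isRadial (isRadial_mean F)
  have h1 := hS.modeSystem hK sphereMap_mean (l := 0) fun F => by rw [mean_lapl, zero_mul]
  simp only [hm] at h1
  have h2 := h1.sub (modeSystem_mass _ fun a => DQ_algebraMap a (2 * 𝔪))
  have hk : IsRadial (algebraMap ℝ (SF M t0) (2 * 𝔪) * rho M t0) := fun _ _ _ => rfl
  have e : ∀ F c : SF M t0, IsRadial c → mean (harm F - c) = mean F - c := fun F c hc => by
    rw [map_sub, mean_harm, mean_of_isRadial hc]
  have h3 := h2.eq_zero (.inl rfl) (fun a b => (isRadial_mean _).sub hk)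
    ((isRadial_mean _).sub isRadial_zero) ((isRadial_mean _).sub isRadial_zero)
    (fun a b => by have := (hS.zero_g hK a b).mean; rwa [e _ _ hk] at this)
    (e _ _ isRadial_zero ▸ (hS.zero_q hK).mean)
    (e _ _ isRadial_zero ▸ (hS.zero_p hK).mean)
    (fun a b => by
      have := (hS.zero_Dt_g hK a b).Dt_sphereMap sphereMap_mean fun h => h.mean
      rwa [e _ _ hk] at this)
    (e _ _ isRadial_zero ▸ (hS.zero_Dt_q hK).Dt_sphereMap sphereMap_mean fun h => h.mean)
    (e _ _ isRadial_zero ▸ (hS.zero_Dt_p hK).Dt_sphereMap sphereMap_mean fun h => h.mean)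
  exact ⟨fun a b => sub_eq_zero.1 (h3.1 a b), sub_eq_zero.1 h3.2.1, sub_eq_zero.1 h3.2.2⟩

/-- Functions constant on the spheres are orthogonal to the l = 1 harmonics; this removes both ξ and
the mass perturbation from the system and its data. -/
theorem coef_eq_zero (hK : IsKerrAdaptedRW M t0 𝔪 𝔞 S) (k : Fin 3) :
    (∀ a b, coef (Ys M t0 k) (hS.g a b) = 0)
      ∧ coef (Ys M t0 k) hS.q = 0 ∧ coef (Ys M t0 k) hS.p = 0 := by
  have hT : SphereMap (coef (Ys M t0 k)) := sphereMap_coef (DQ_Ys k)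
  have h1 := hS.modeSystem hK hT (coef_Ys_lapl k)
  simp only [coef_Ys_of_isRadial (isRadial_mean _)] at h1
  have hk : IsRadial (algebraMap ℝ (SF M t0) (2 * 𝔪) * rho M t0) := fun _ _ _ => rfl
  have e : ∀ F c : SF M t0, IsRadial c →
      coef (Ys M t0 k) (harm F - c) = coef (Ys M t0 k) F := fun F c hc => by
    rw [map_sub, coef_harm, coef_Ys_of_isRadial hc, sub_zero]
  exact h1.eq_zero (.inr rfl) (fun a b => isRadial_coef _ _) (isRadial_coef _ _) (isRadial_coef _ _)
    (fun a b => e _ _ hk ▸ (hS.zero_g hK a b).coef _) (e _ _ isRadial_zero ▸ (hS.zero_q hK).coef _)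
    (e _ _ isRadial_zero ▸ (hS.zero_p hK).coef _)
    (fun a b => e _ _ hk ▸ (hS.zero_Dt_g hK a b).Dt_sphereMap hT fun h => h.coef _)
    (e _ _ isRadial_zero ▸ (hS.zero_Dt_q hK).Dt_sphereMap hT fun h => h.coef _)
    (e _ _ isRadial_zero ▸ (hS.zero_Dt_p hK).Dt_sphereMap hT fun h => h.coef _)

theorem harm_g_eq (hK : IsKerrAdaptedRW M t0 𝔪 𝔞 S) (a b : Fin 2) :
    harm (hS.g a b) = algebraMap ℝ (SF M t0) (2 * 𝔪) * rho M t0 := by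
  simp only [harm, (hS.mean_eq hK).1, (hS.coef_eq_zero hK _).1, zero_mul, Finset.sum_const_zero,
    add_zero]

theorem harm_q_eq (hK : IsKerrAdaptedRW M t0 𝔪 𝔞 S) : harm hS.q = 0 := by
  simp only [harm, (hS.mean_eq hK).2.1, (hS.coef_eq_zero hK _).2.1, zero_mul,
    Finset.sum_const_zero, add_zero]

theorem harm_p_eq (hK : IsKerrAdaptedRW M t0 𝔪 𝔞 S) : harm hS.p = 0 := by
  simp only [harm, (hS.mean_eq hK).2.2, (hS.coef_eq_zero hK _).2.2, zero_mul,
    Finset.sum_const_zero, add_zero]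

theorem pairing_x (hK : IsKerrAdaptedRW M t0 𝔪 𝔞 S) {c : Fin 3 → ℝ}
    (hc : ∀ w, 𝔞 w = ∑ k, c k * Y1 k w) (l : Fin 3) (a : Fin 2) :
    pairing (hS.x a) (SGs M t0 l)
      = 2 * algebraMap ℝ _ (c l) * ![mus M t0, 1 + mus M t0] a := by
  let κ : Fin 2 → Fin 3 → SF M t0 := fun a i =>
    ![mus M t0, 1 + mus M t0] a * ∑ k, algebraMap ℝ _ (c k) * SGs M t0 k i
  -- The 2 is the squared norm of an odd l = 1 vector harmonic.
  let W : Fin 2 → SF M t0 := fun a => 2 * algebraMap ℝ _ (c l) * ![mus M t0, 1 + mus M t0] a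
  let D : Fin 2 → SF M t0 := fun a => pairing (hS.x a) (SGs M t0 l) - W a
  have hν : ∀ a, IsRadial (![mus M t0, 1 + mus M t0] a) := fun a => by
    fin_cases a <;> exact fun _ _ _ => rfl
  have hW : ∀ a, IsRadial (W a) := fun a =>
    IsRadial.mul (G := ![mus M t0, 1 + mus M t0] a) (fun _ _ _ => rfl) (hν a)
  have hκ : ∀ a, pairing (κ a) (SGs M t0 l) = W a := fun a => by
    change pairing (fun i => κ a i) _ = _
    simp only [κ]
    rw [pairing_mul (hν a), pairing_sum]
    simp only [pairing_mul (isRadial_algebraMap _), pairing_SGs_SGs, mul_ite, mul_zero,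
      Finset.sum_ite_eq', Finset.mem_univ, if_true]
    simp only [W]
    ring
  have hD : ∀ a, D a = pairing (fun i => harmForm (hS.x a) i - κ a i) (SGs M t0 l) := fun a => by
    rw [pairing_sub]
    exact congrArg₂ (· - ·) (pairing_harmForm _ _).symm (hκ a).symm
  have z0 : ∀ a i, ZeroOnSigma (harmForm (hS.x a) i - κ a i) := fun a i =>
    ZeroOnSigma.sub_of_rep (Rep.projL01Form (hS.rep_x a) i) (rep_kerr_cross (𝔪 := 𝔪) hc a i)
      fun r w hr => ((hK.kerr_data r hr).1 w).2.2.1 a i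
  have z1 : ∀ a i, ZeroOnSigma (Dt (harmForm (hS.x a) i - κ a i)) := fun a i =>
    ZeroOnSigma.Dt_sub_of_lieN1 (fun a => Rep.projL01Form (hS.rep_x a) i)
      (fun a => rep_kerr_cross (𝔪 := 𝔪) hc a i) (fun a => z0 a i)
      fun r w hr => ((hK.kerr_data r hr).2 w).2.2.1 a i
  have hrad : ∀ a, IsRadial (D a) := fun a => (isRadial_pairing _ _).sub (hW a)
  have hop : ∀ a, crossOp D (fun a => -D a) a = 0 := fun a => by
    have h := sum_map_crossOp (fun i => sphereMap_coef fun a => DQ_SGs a l i) hS.x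
      (fun c i => ∑ j, NS2 (NS1 (hS.x c)) j j i) a
    simp only [hS.sf_crossOp hK, map_zero, Finset.sum_const_zero] at h
    -- The scalar Laplacian contributes -2 and the curvature term of `sum_NS2_NS1` contributes +1,
    -- while the divergence term is zero: the eigenvalue is -1, as in `crossOp_rotation`.
    have hL : ∀ c, ∑ i, coef (SGs M t0 l i) (∑ j, NS2 (NS1 (hS.x c)) j j i)
        = -pairing (hS.x c) (SGs M t0 l) := fun c => by
      rw [pairing, ← Finset.sum_neg_distrib]
      refine Finset.sum_congr rfl fun i _ => ?_
      have h2 : avg (hS.x c i * (-2 * SGs M t0 l i)) = -2 * avg (hS.x c i * SGs M t0 l i) := by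
        rw [mul_left_comm, avg_mul_of_isRadial (G := -2) fun _ _ _ => rfl]
      rw [sum_NS2_NS1 (hS.x_tangent c), hS.dv_x_eq_zero hK, mul_zero, mul_zero, add_zero, map_add,
        coef_apply, coef_apply, avg_lapl_mul, lapl_SGs, h2]
      ring
    simp only [hL] at h
    have e : (fun a => -D a) = fun a => -pairing (hS.x a) (SGs M t0 l) - -W a :=
      funext fun a => by simp only [D]; ring
    rw [e, crossOp_sub]
    refine sub_eq_zero.2 (h.symm.trans ?_)
    refine (crossOp_rotation (2 * algebraMap ℝ _ (c l)) (fun a => ?_) a).symm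
    rw [Derivation.leibniz, DQ_algebraMap, smul_zero, zero_add]
    have : DQ a (2 : SF M t0) = 0 := der_two _
    rw [this, smul_zero]
  refine sub_eq_zero.1 (eq_zero_of_wave_mem_jetIdeal D (fun a => ?_) (fun a => ?_) (fun a => ?_) a)
  · refine wave_mem_of_crossOp hop (fun a => ?_) a
    rw [lapl_of_isRadial (hrad a), sub_zero]
    exact neg_mem (self_mem D a)
  · rw [hD]; exact ZeroOnSigma.pairing (z0 a) _
  · have := DQ_pairing_SGs 0 (fun i => harmForm (hS.x a) i - κ a i) l
    rw [hD]
    change ZeroOnSigma (DQ 0 _)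
    rw [this]
    exact ZeroOnSigma.pairing (z1 a) _

theorem harmForm_x (hK : IsKerrAdaptedRW M t0 𝔪 𝔞 S) {c : Fin 3 → ℝ}
    (hc : ∀ w, 𝔞 w = ∑ k, c k * Y1 k w) (a : Fin 2) (i : Fin 3) :
    harmForm (hS.x a) i
      = ![mus M t0, 1 + mus M t0] a * ∑ k, algebraMap ℝ _ (c k) * SGs M t0 k i := by
  simp only [harmForm, pairing_GYs_eq_zero (hS.x_tangent a) (hS.dv_x_eq_zero hK a),
    hS.pairing_x hK hc, zero_mul, zero_add, Finset.mul_sum]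
  refine Finset.sum_congr rfl fun k _ => ?_
  linear_combination (algebraMap ℝ _ (c k) * ![mus M t0, 1 + mus M t0] a * SGs M t0 k i)
    * half_mul_two (M := M) (t0 := t0)

/-- The divergence of the second gauge condition leaves only the sphere Laplacian of the trace,
since div ω and the traceless `S`-part vanish. So the trace is constant on spheres, and its mean is
zero by `mean_eq`. -/
theorem q_eq_zero (hK : IsKerrAdaptedRW M t0 𝔪 𝔞 S) : hS.q = 0 := by
  have h : ∀ i, DelQ1 (fun c => hS.x c i) + algebraMap ℝ _ (1 / 2) * DS i hS.q = 0 := fun i => by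
    have h := hS.sf_gauge_S i
    have hz : ∑ j, NS2 hS.s j j i = 0 := by
      simp only [NS2, hS.s_eq_zero hK, map_zero, mul_zero, Finset.sum_const_zero]
    rw [hz] at h
    linear_combination -h
  have h2 : ∑ i, DS i (DelQ1 fun c => hS.x c i) = 0 := by
    have h3 : ∑ i, DS i (DelQ1 fun c => hS.x c i) = DelQ1 fun c => dv (hS.x c) :=
      sum_map_DelQ1 sphereMap_DS hS.x
    rw [h3]
    simp only [hS.dv_x_eq_zero hK]
    simp [DelQ1, NQ1]
  have h4 : lapl hS.q = 0 := by
    have h5 : ∑ i, DS i (DelQ1 (fun c => hS.x c i) + algebraMap ℝ _ (1 / 2) * DS i hS.q) = 0 := by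
      simp only [h, map_zero, Finset.sum_const_zero]
    simp only [map_add, Finset.sum_add_distrib, h2, DS_algebraMap_mul, ← Finset.mul_sum,
      zero_add] at h5
    rw [lapl]
    linear_combination 2 * h5
      - (∑ i, DS i (DS i hS.q)) * half_mul_two (M := M) (t0 := t0)
  rw [← mean_of_isRadial (isRadial_of_DS_eq_zero (DS_eq_zero_of_lapl_eq_zero h4)),
    (hS.mean_eq hK).2.1]

end IsSolution

end LinGrav
end

/-! ### Translation of the identities in the algebra back to the given fields. -/

theorem mainTheorem6 (M : ℝ) (hM : 0 < M) (t0 𝔪 : ℝ) (𝔞 : LinGrav.S2 → ℝ)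
    (h𝔞 : LinGrav.SupportedOnL1 𝔞) (S : LinGrav.LinMetric)
    (hS : LinGrav.IsSolution M t0 S) (hgauge : LinGrav.IsKerrAdaptedRW M t0 𝔪 𝔞 S) :
    ∀ t r, LinGrav.DPlus M t0 t r →
      (∀ ω a, LinGrav.divS1 (S.cross a) t r ω = 0) ∧
      (∀ ω i j, S.shat i j t r ω = 0) ∧
      LinGrav.AgreeAt S.projL01 (LinGrav.kerr M 𝔪 𝔞) t r ∧
      (∀ ω, S.trQ t r ω = 0) := by
  have : Fact (0 < M) := ⟨hM⟩
  obtain ⟨c, hc⟩ := h𝔞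
  intro t r h
  have eq_of : ∀ {f f' : LinGrav.Scal} {F F' : LinGrav.SF M t0}, LinGrav.Rep f F →
      LinGrav.Rep f' F' → F = F' → ∀ ω, f t r ω = f' t r ω := fun hf hf' e ω =>
    (hf t r h ω).trans (e ▸ (hf' t r h ω).symm)
  refine ⟨fun ω a => ?_, fun ω i j => ?_,
    fun ω => ⟨fun a b => ?_, ?_, fun a i => ?_, fun i j => rfl, ?_⟩, fun ω => ?_⟩
  · refine eq_of (LinGrav.Rep.divS1 (hS.rep_x a)) LinGrav.Rep.zero ?_ ω
    rw [LinGrav.sum_NS1_diag, hS.dv_x_eq_zero hgauge, mul_zero]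
  · exact eq_of (hS.rep_s i j) LinGrav.Rep.zero (hS.s_eq_zero hgauge i j) ω
  · exact eq_of (hS.rep_g a b).projL01 (LinGrav.IsSolution.rep_kerr_ghat (𝔞 := 𝔞) a b)
      (hS.harm_g_eq hgauge a b) ω
  · exact eq_of hS.rep_q.projL01 LinGrav.Rep.zero (hS.harm_q_eq hgauge) ω
  · exact eq_of (LinGrav.Rep.projL01Form (hS.rep_x a) i)
      (LinGrav.IsSolution.rep_kerr_cross (𝔪 := 𝔪) hc a i) (hS.harmForm_x hgauge hc a i) ω
  · exact eq_of hS.rep_p.projL01 LinGrav.Rep.zero (hS.harm_p_eq hgauge) ω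
  · exact eq_of hS.rep_q LinGrav.Rep.zero (hS.q_eq_zero hgauge) ω
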